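/- Notation. Let $q\in\mathbb C$, $q\neq 0$. For $m\in\mathbb Z$ let $[m]_q=1+q+\dots+q^{m-1}$ if $m\ge 0$ and $[m]_q=-q^{-1}-\dots-q^{m}$ if $m<0$. $\mathcal H_n(q)$ is the $\mathbb C$-algebra with generators $T_{s_1},\dots,T_{s_{n-1}}$ and relations $T_{s_i}^2=(q-1)T_{s_i}+q$, $T_{s_i}T_{s_j}=T_{s_j}T_{s_i}$ for $|i-j|\ge 2$, and $T_{s_i}T_{s_{i+1}}T_{s_i}=T_{s_{i+1}}T_{s_i}T_{s_{i+1}}$; for $k\le n$ we map $\mathcal H_k(q)\to\mathcal H_n(q)$ by $T_{s_i}\mapsto T_{s_i}$. Put $$\mathcal B_n(q)=\sum_{i=1}^n T_{s_{n-1}}T_{s_{n-2}}\cdots T_{s_i},\qquad \mathcal B_n^*(q)=\sum_{j=1}^n T_{s_j}T_{s_{j+1}}\cdots T_{s_{n-1}},\qquad \mathcal R_n(q)=\mathcal B_n^*(q)\,\mathcal B_n(q),$$ $$\mathcal C_j^{(n)}=\mathcal B_{j+1}(q)\cdots\mathcal B_n(q),\qquad J_k(q)=\sum_{i=1}^{k-1}q^{i-k}\,T_{s_i}\cdots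 T_{s_{k-2}}T_{s_{k-1}}T_{s_{k-2}}\cdots T_{s_i}.$$ $\mathcal H_n(q)$ acts from the right on the complex span of the words $w=w_1\cdots w_n$ with positive integer letters: $w\,T_{s_i}$ is $q\,w$ if $w_i=w_{i+1}$, is $w s_i$ if $w_i<w_{i+1}$, and is $q\,w s_i+(q-1)w$ if $w_i>w_{i+1}$, where $w s_i$ is $w$ with $w_i$ and $w_{i+1}$ exchanged. For partitions $\mu\subseteq\lambda$, let ${\sf SYT}(\lambda\setminus\mu)$ be the set of standard fillings of $\lambda\setminus\mu$ with $|\mu|+1,\dots,|\lambda|$, increasing along rows and down columns; put ${\sf SYT}(\lambda)={\sf SYT}(\lambda\setminus\emptyset)$ and $\mathfrak c_{\lambda\setminus\mu}(q)=\sum_{(i,j)\in\lambda\setminus\mu}[j-i]_q$. Let $|\lambda|=n$. For $\mathfrak t\in{\sf SYT}(\lambda)$ let $\mathrm{word}(\mathfrak t)$ be the word whose $i$-th letter is the row of $\mathfrak t$ containing $i$, let $c_m$ be the content (column minus row) of the entry $m$ of $\mathfrak t$, let $\mathfrak C(m)=\{d\in\mathbb Z:-m<d<m\}$, with $0$ removed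 if $m\in\{2,3\}$, and $$p_{\mathfrak t}=\prod_{m=1}^n\ \prod_{\substack{d\in\mathfrak C(m)\\ [d]_q\ne[c_m]_q}}\frac{J_m(q)-[d]_q}{[c_m]_q-[d]_q}\in\mathcal H_n(q).$$ The Specht module $S^\lambda$ is the right $\mathcal H_n(q)$-module spanned by the seminormal units $\mathrm{word}(\mathfrak t)\,p_{\mathfrak t}$, $\mathfrak t\in{\sf SYT}(\lambda)$. The element $p_\lambda$ is the central idempotent of $\mathcal H_n(q)$ such that right multiplication by it projects $\mathcal H_n(q)$ onto its $S^\lambda$-isotypic component as a right module. For $\mathfrak t\in{\sf SYT}(\lambda\setminus\mu)$ let $p_{\mathfrak t}=p_{\lambda^{(|\mu|+1)}}\cdots p_{\lambda^{(n)}}$, where $\lambda^{(k)}$ consists of $\mu$ and the boxes of $\mathfrak t$ with entries $\le k$, and let $\Phi_{\mathfrak t}$ be the linear map sending a word $w_1\cdots w_{|\mu|}$ to $w_1\cdots w_n$, where $w_i$ for $i>|\mu|$ is the row of $\mathfrak t$ containing $i$. Maps and algebra elements are written on the right of vectors. If $\lambda'\subset\lambda$ and $|\lambda'|=|\lambda|-1$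 (written $\lambda'\lessdot\lambda$), then $\Phi_{\lambda\setminus\lambda'}$ is $\Phi_{\mathfrak t}$ for the only $\mathfrak t\in{\sf SYT}(\lambda\setminus\lambda')$. Theorem. Let $q\ne 0$ and let $\mathcal H_n(q)$ be semisimple. (1) Let $\lambda'\lessdot\lambda$ with $|\lambda|=n$, and let $u'\in S^{\lambda'}$ be an eigenvector for $\mathcal R_{n-1}(q)$ with eigenvalue $\mathcal E$. Then $u=u'\,\Phi_{\lambda\setminus\lambda'}\,\mathcal B_n(q)\,p_\lambda$ belongs to $S^\lambda$, and is either zero or an eigenvector for $\mathcal R_n(q)$ with eigenvalue $$q\,\mathcal E+[n]_q+q^n\,\mathfrak c_{\lambda\setminus\lambda'}(q).$$ (2) Let $\mu\subseteq\lambda$ with $|\mu|=j$ and $|\lambda|=n$, let $u\in S^\mu$ with $u\,\mathcal R_j(q)=0$, and let $\mathfrak t\in{\sf SYT}(\lambda\setminus\mu)$. Then $u\,\Phi_{\mathfrak t}\,p_{\mathfrak t}\,\mathcal C_j^{(n)}$ belongs to $S^\lambda$, and is either zero or an eigenvector for $\mathcal R_n(q)$ with eigenvalue $$\mathcal E_{\lambda\setminus\mu}(q)=q^n\,\mathfrak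 c_{\lambda\setminus\mu}(q)+\sum_{k=j+1}^n q^{n-k}[k]_q.$$ -/

import Mathlib

open scoped RightActions

namespace QShuffle

section Iso
variable {R S : Type*} [Ring R] [AddCommGroup S] [Module Rᵐᵒᵖ S]

/-- For a right `R`-module `S`, the element `p` of `R` is the isotypic projector of type `S`: a central
idempotent such that right multiplication by `p` maps `R` onto the `S`-isotypic component of the
right regular module, i.e. the sum of all right ideals isomorphic to `S`. -/
structure IsIsotypicProjector (R S : Type*) [Ring R] [AddCommGroup S] [Module Rᵐᵒᵖ S] (p : R) :
    Prop where
  idem : p * p = p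
  central : ∀ x : R, p * x = x * p
  range_eq : Set.range (fun x : R => x * p) = (isotypicComponent Rᵐᵒᵖ R S : Set R)

theorem isIsotypicProjector_unique {p p' : R} (h : IsIsotypicProjector R S p)
    (h' : IsIsotypicProjector R S p') : p = p' := by
  have h1 : p ∈ Set.range (fun x : R => x * p') := by
    rw [h'.range_eq, ← h.range_eq]; exact ⟨1, one_mul p⟩
  have h2 : p' ∈ Set.range (fun x : R => x * p) := by
    rw [h.range_eq, ← h'.range_eq]; exact ⟨1, one_mul p'⟩
  obtain ⟨x, hx⟩ := h1
  obtain ⟨y, hy⟩ := h2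
  have e1 : p * p' = p := by rw [← hx]; simp only [mul_assoc, h'.idem]
  have e2 : p' * p = p' := by rw [← hy]; simp only [mul_assoc, h.idem]
  rw [← e1, h.central, e2]

/-- In a semisimple ring every simple right module has an isotypic projector. -/
theorem exists_isIsotypicProjector [IsSemisimpleRing R] [IsSimpleModule Rᵐᵒᵖ S] :
    ∃ p : R, IsIsotypicProjector R S p := by
  have : IsSemisimpleModule Rᵐᵒᵖ R :=
    IsSemisimpleModule.congr (MulOpposite.opLinearEquiv Rᵐᵒᵖ : R ≃ₗ[Rᵐᵒᵖ] Rᵐᵒᵖ)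
  let I := isotypicComponent Rᵐᵒᵖ R S
  have hI : I.IsFullyInvariant := Submodule.IsFullyInvariant.isotypicComponent Rᵐᵒᵖ R S
  have : ComplementedLattice (fullyInvariantSubmodule Rᵐᵒᵖ R) :=
    (OrderIso.setIsotypicComponents (R := Rᵐᵒᵖ) (M := R)).complementedLattice
  obtain ⟨⟨J, hJ⟩, hIJ⟩ := exists_isCompl (⟨I, hI⟩ : fullyInvariantSubmodule Rᵐᵒᵖ R)
  have hdis : I ⊓ J = ⊥ := congrArg Subtype.val hIJ.inf_eq_bot
  have hsup : I ⊔ J = ⊤ := congrArg Subtype.val hIJ.sup_eq_top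
  have left : ∀ {K : Submodule Rᵐᵒᵖ R}, K.IsFullyInvariant → ∀ r x : R, x ∈ K → r * x ∈ K :=
    fun hK r x hx => hK
      ({  toFun := fun y => r * y
          map_add' := mul_add r
          map_smul' := fun s y => by simp [MulOpposite.smul_eq_mul_unop, mul_assoc] } :
        Module.End Rᵐᵒᵖ R) hx
  have right : ∀ {K : Submodule Rᵐᵒᵖ R} (r x : R), x ∈ K → x * r ∈ K :=
    fun {K} r x hx => K.smul_mem (MulOpposite.op r) hx
  obtain ⟨e, he, f, hf, hef⟩ := Submodule.mem_sup.1 (hsup ▸ Submodule.mem_top : (1 : R) ∈ I ⊔ J)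
  have zero : ∀ x : R, x ∈ I → x ∈ J → x = 0 := fun x h h' => by
    have : x ∈ I ⊓ J := ⟨h, h'⟩
    simpa [hdis] using this
  have unit : ∀ x ∈ I, x * e = x := fun x hx => by
    have : x * f = 0 := zero _ (right f x hx) (left hJ x f hf)
    have h := congrArg (x * ·) hef
    simpa [mul_add, this] using h
  have comm : ∀ x : R, e * x = x * e := fun x => by
    have h1 : e * x + f * x = x * e + x * f := by rw [← add_mul, ← mul_add, hef, one_mul, mul_one]
    have h2 : e * x - x * e = x * f - f * x := by
      rw [sub_eq_sub_iff_add_eq_add, h1, add_comm]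
    refine sub_eq_zero.1 (zero _ (I.sub_mem (right x e he) (left hI x e he)) ?_)
    rw [h2]
    exact J.sub_mem (left hJ x f hf) (right x f hf)
  refine ⟨e, unit e he, comm, Set.ext fun x => ⟨?_, fun hx => ⟨x, unit x hx⟩⟩⟩
  rintro ⟨y, rfl⟩
  exact left hI y e he

open Classical in
/-- The isotypic projector of type `S` in `R`. It is unique when it exists, and it exists whenever `R`
is semisimple and `S` is simple; the value `0` in the remaining cases is a convention. -/
noncomputable def isotypicProjector (R S : Type*) [Ring R] [AddCommGroup S] [Module Rᵐᵒᵖ S] : R :=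
  if h : ∃ p : R, IsIsotypicProjector R S p then h.choose else 0

theorem isotypicProjector_spec [IsSemisimpleRing R] [IsSimpleModule Rᵐᵒᵖ S] :
    IsIsotypicProjector R S (isotypicProjector R S) := by
  rw [isotypicProjector, dif_pos exists_isIsotypicProjector]
  exact Exists.choose_spec _
end Iso
/-- Indices `1 ≤ i ≤ n - 1` of the generators. -/
abbrev Gen (n : ℕ) : Type := {i : ℕ // 1 ≤ i ∧ i < n}

/-- The defining relations of the Iwahori-Hecke algebra of type A with parameter `q`. -/
inductive HeckeRel (n : ℕ) (q : ℂ) : FreeAlgebra ℂ (Gen n) → FreeAlgebra ℂ (Gen n) → Prop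
  | quadratic (i : Gen n) :
      HeckeRel n q (FreeAlgebra.ι ℂ i * FreeAlgebra.ι ℂ i)
        ((q - 1) • FreeAlgebra.ι ℂ i + q • 1)
  | comm (i j : Gen n) (h : i.1 + 2 ≤ j.1) :
      HeckeRel n q (FreeAlgebra.ι ℂ i * FreeAlgebra.ι ℂ j) (FreeAlgebra.ι ℂ j * FreeAlgebra.ι ℂ i)
  | braid (i j : Gen n) (h : i.1 + 1 = j.1) :
      HeckeRel n q (FreeAlgebra.ι ℂ i * FreeAlgebra.ι ℂ j * FreeAlgebra.ι ℂ i)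
        (FreeAlgebra.ι ℂ j * FreeAlgebra.ι ℂ i * FreeAlgebra.ι ℂ j)

/-- The Hecke algebra `H_n(q)`, presented by generators and relations. -/
def Hecke (n : ℕ) (q : ℂ) : Type := RingQuot (HeckeRel n q)

noncomputable instance (n : ℕ) (q : ℂ) : Ring (Hecke n q) :=
  inferInstanceAs (Ring (RingQuot (HeckeRel n q)))

noncomputable instance (n : ℕ) (q : ℂ) : Algebra ℂ (Hecke n q) :=
  inferInstanceAs (Algebra ℂ (RingQuot (HeckeRel n q)))

/-- The generator `T_{s_i}`. -/
noncomputable def gen {n : ℕ} (q : ℂ) (i : Gen n) : Hecke n q :=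
  RingQuot.mkAlgHom ℂ (HeckeRel n q) (FreeAlgebra.ι ℂ i)

theorem gen_quadratic {n : ℕ} (q : ℂ) (i : Gen n) :
    gen q i * gen q i = (q - 1) • gen q i + q • (1 : Hecke n q) := by
  have h := RingQuot.mkAlgHom_rel ℂ (HeckeRel.quadratic (q := q) i)
  rw [map_mul, map_add, map_smul, map_smul, map_one] at h
  exact h

theorem gen_comm {n : ℕ} (q : ℂ) (i j : Gen n) (hij : i.1 + 2 ≤ j.1) :
    gen q i * gen q j = gen q j * gen q i := by
  have h := RingQuot.mkAlgHom_rel ℂ (HeckeRel.comm (q := q) i j hij)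
  rw [map_mul, map_mul] at h
  exact h

theorem gen_braid {n : ℕ} (q : ℂ) (i j : Gen n) (hij : i.1 + 1 = j.1) :
    gen q i * gen q j * gen q i = gen q j * gen q i * gen q j := by
  have h := RingQuot.mkAlgHom_rel ℂ (HeckeRel.braid (q := q) i j hij)
  simp only [map_mul] at h
  exact h

/-- The universal property of the presentation. -/
noncomputable def heckeLift {n : ℕ} {q : ℂ} {A : Type*} [Ring A] [Algebra ℂ A] (f : Gen n → A)
    (hquad : ∀ i, f i * f i = (q - 1) • f i + q • 1)
    (hcomm : ∀ i j, i.1 + 2 ≤ j.1 → f i * f j = f j * f i)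
    (hbraid : ∀ i j, i.1 + 1 = j.1 → f i * f j * f i = f j * f i * f j) :
    Hecke n q →ₐ[ℂ] A :=
  RingQuot.liftAlgHom ℂ ⟨FreeAlgebra.lift ℂ f, fun x y h => by
    cases h with
    | quadratic i => simpa using hquad i
    | comm i j h => simpa using hcomm i j h
    | braid i j h => simpa using hbraid i j h⟩

theorem heckeLift_gen {n : ℕ} {q : ℂ} {A : Type*} [Ring A] [Algebra ℂ A] (f : Gen n → A)
    (hquad : ∀ i, f i * f i = (q - 1) • f i + q • 1)
    (hcomm : ∀ i j, i.1 + 2 ≤ j.1 → f i * f j = f j * f i)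
    (hbraid : ∀ i j, i.1 + 1 = j.1 → f i * f j * f i = f j * f i * f j) (i : Gen n) :
    heckeLift (q := q) f hquad hcomm hbraid (gen q i) = f i := by
  simp only [heckeLift, gen]
  erw [RingQuot.liftAlgHom_mkAlgHom_apply]
  exact FreeAlgebra.lift_ι_apply f i

/-- The standard homomorphism `H_k(q) → H_n(q)` for `k ≤ n`, sending each `T_{s_i}` to `T_{s_i}`. -/
noncomputable def heckeIncl {k n : ℕ} (q : ℂ) (h : k ≤ n) : Hecke k q →ₐ[ℂ] Hecke n q :=
  heckeLift (fun i => gen q ⟨i.1, i.2.1, i.2.2.trans_le h⟩) (fun _ => gen_quadratic q _)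
    (fun _ _ hij => gen_comm q _ _ hij) (fun _ _ hij => gen_braid q _ _ hij)


/-- Formal complex combinations of words of length `n` with positive integer letters (all naturals are
allowed here). The span `W^ν` of the words of content `ν` is a subspace. The letter in position `i`
(counted from `1`) of the word `w` is the value of `w` at the index `i - 1`. -/
abbrev Words (n : ℕ) : Type := (Fin n → ℕ) →₀ ℂ

/-- The operator which, on the letters `x = w a` and `y = w b` of a word `w`, is: multiplication by `q`
if `x = y`; exchange of the two letters if `x < y`; and `q` times the exchange plus `q - 1` times
the identity if `x > y`. With `a`, `b` the positions `i`, `i + 1` this is the action of `T_{s_i}`. -/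
noncomputable def swapAct {n : ℕ} (q : ℂ) (a b : Fin n) : Words n →ₗ[ℂ] Words n :=
  Finsupp.linearCombination ℂ fun w =>
    if w a = w b then q • Finsupp.single w 1
    else if w a < w b then Finsupp.single (w ∘ Equiv.swap a b) 1
    else q • Finsupp.single (w ∘ Equiv.swap a b) 1 + (q - 1) • Finsupp.single w 1

theorem swapAct_eq {n : ℕ} (q : ℂ) (a b : Fin n) (w : Fin n → ℕ) (h : w a = w b) :
    swapAct q a b (Finsupp.single w 1) = q • Finsupp.single w 1 := by
  simp [swapAct, h]

theorem swapAct_lt {n : ℕ} (q : ℂ) (a b : Fin n) (w : Fin n → ℕ) (h : w a < w b) :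
    swapAct q a b (Finsupp.single w 1) = Finsupp.single (w ∘ Equiv.swap a b) 1 := by
  simp [swapAct, h, h.ne]

theorem swapAct_gt {n : ℕ} (q : ℂ) (a b : Fin n) (w : Fin n → ℕ) (h : w b < w a) :
    swapAct q a b (Finsupp.single w 1) =
      q • Finsupp.single (w ∘ Equiv.swap a b) 1 + (q - 1) • Finsupp.single w 1 := by
  rw [swapAct, Finsupp.linearCombination_single, one_smul, if_neg h.ne', if_neg h.not_gt]

theorem swapAct_quadratic {n : ℕ} (q : ℂ) (a b : Fin n) :
    swapAct q a b * swapAct q a b = (q - 1) • swapAct q a b + q • 1 := by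
  refine Finsupp.lhom_ext' fun w => LinearMap.ext_ring ?_
  have hww : (w ∘ Equiv.swap a b) ∘ Equiv.swap a b = w := by ext; simp
  have ha : (w ∘ Equiv.swap a b) a = w b := by simp
  have hb : (w ∘ Equiv.swap a b) b = w a := by simp
  simp only [LinearMap.coe_comp, Function.comp_apply, Finsupp.lsingle_apply, Module.End.mul_apply,
    LinearMap.add_apply, LinearMap.smul_apply, Module.End.one_apply]
  rcases lt_trichotomy (w a) (w b) with h | h | h
  · rw [swapAct_lt q a b w h, swapAct_gt q a b _ (by rwa [ha, hb]), hww]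
    module
  · rw [swapAct_eq q a b w h, map_smul, swapAct_eq q a b w h]
    module
  · rw [swapAct_gt q a b w h, map_add, map_smul, map_smul, swapAct_gt q a b w h,
      swapAct_lt q a b _ (by rwa [ha, hb]), hww]
    module

theorem swapAct_comm {n : ℕ} (q : ℂ) {a b c d : Fin n} (hac : a ≠ c) (had : a ≠ d)
    (hbc : b ≠ c) (hbd : b ≠ d) : swapAct q a b * swapAct q c d = swapAct q c d * swapAct q a b := by
  refine Finsupp.lhom_ext' fun w => LinearMap.ext_ring ?_
  have e : (w ∘ Equiv.swap a b) ∘ Equiv.swap c d = (w ∘ Equiv.swap c d) ∘ Equiv.swap a b := by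
    ext x
    simp only [Function.comp_apply, Equiv.swap_apply_def]
    grind
  have s1 : (w ∘ Equiv.swap a b) c = w c := by
    rw [Function.comp_apply, Equiv.swap_apply_of_ne_of_ne hac.symm hbc.symm]
  have s2 : (w ∘ Equiv.swap a b) d = w d := by
    rw [Function.comp_apply, Equiv.swap_apply_of_ne_of_ne had.symm hbd.symm]
  have s3 : (w ∘ Equiv.swap c d) a = w a := by
    rw [Function.comp_apply, Equiv.swap_apply_of_ne_of_ne hac had]
  have s4 : (w ∘ Equiv.swap c d) b = w b := by
    rw [Function.comp_apply, Equiv.swap_apply_of_ne_of_ne hbc hbd]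
  simp only [LinearMap.coe_comp, Function.comp_apply, Finsupp.lsingle_apply, Module.End.mul_apply]
  rcases lt_trichotomy (w a) (w b) with h | h | h <;>
  rcases lt_trichotomy (w c) (w d) with h' | h' | h' <;>
  simp only [swapAct_eq, swapAct_lt, swapAct_gt, h, h', e, s1, s2, s3, s4, map_add, map_smul] <;>
  module

set_option linter.unusedSimpArgs false in
set_option linter.unnecessarySeqFocus false in
theorem swapAct_braid {n : ℕ} (q : ℂ) {a b c : Fin n} (hab : a ≠ b) (hac : a ≠ c)
    (hbc : b ≠ c) : swapAct q a b * swapAct q b c * swapAct q a b =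
      swapAct q b c * swapAct q a b * swapAct q b c := by
  refine Finsupp.lhom_ext' fun w => LinearMap.ext_ring ?_
  simp only [LinearMap.coe_comp, Function.comp_apply, Finsupp.lsingle_apply, Module.End.mul_apply]
  let F : ℕ → ℕ → ℕ → Fin n → ℕ := fun x y z k =>
    if k = a then x else if k = b then y else if k = c then z else w k
  have hw : w = F (w a) (w b) (w c) := by ext k; simp only [F]; grind
  have Fa : ∀ x y z, F x y z a = x := by intros; simp [F]
  have Fb : ∀ x y z, F x y z b = y := by intros; simp [F, hab.symm]
  have Fc : ∀ x y z, F x y z c = z := by intros; simp [F, hac.symm, hbc.symm]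
  have sab : ∀ x y z, F x y z ∘ Equiv.swap a b = F y x z := by
    intro x y z; ext k; simp only [F, Function.comp_apply, Equiv.swap_apply_def]; grind
  have sbc : ∀ x y z, F x y z ∘ Equiv.swap b c = F x z y := by
    intro x y z; ext k; simp only [F, Function.comp_apply, Equiv.swap_apply_def]; grind
  rw [hw]
  generalize w a = x
  generalize w b = y
  generalize w c = z
  clear_value F
  rcases lt_trichotomy x y with h | h | h <;>
  rcases lt_trichotomy y z with h' | h' | h' <;>
  rcases lt_trichotomy x z with h'' | h'' | h'' <;>
  first
  | (exfalso; omega)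
  | ((try subst h) <;> (try subst h') <;> (try subst h'') <;>
      simp only [swapAct_eq, swapAct_lt, swapAct_gt, Fa, Fb, Fc, sab, sbc, map_add, map_smul, *] <;>
      module)

/-- The right action of `H_n(q)` on words, as an algebra homomorphism into the opposite of the
endomorphism algebra. -/
noncomputable def wordRep (n : ℕ) (q : ℂ) : Hecke n q →ₐ[ℂ] (Module.End ℂ (Words n))ᵐᵒᵖ :=
  heckeLift
    (fun i => MulOpposite.op (swapAct q ⟨i.1 - 1, by have := i.2; omega⟩ ⟨i.1, i.2.2⟩))
    (fun i => by
      rw [← MulOpposite.op_mul, swapAct_quadratic]; rfl)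
    (fun i j h => by
      have := i.2
      have := j.2
      rw [← MulOpposite.op_mul, ← MulOpposite.op_mul, swapAct_comm] <;>
        (rw [Ne, Fin.mk.injEq]; omega))
    (fun i j h => by
      obtain ⟨i, hi⟩ := i
      obtain ⟨j, hj⟩ := j
      obtain rfl : i + 1 = j := h
      simp only [← MulOpposite.op_mul, ← mul_assoc, Nat.add_sub_cancel]
      rw [swapAct_braid] <;> (rw [Ne, Fin.mk.injEq]; omega))

/-- The right `H_n(q)`-module structure on words; `u <• x` is the image of `u` under `x`. -/
noncomputable instance instRightModuleWords (n : ℕ) (q : ℂ) : Module (Hecke n q)ᵐᵒᵖ (Words n) where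
  smul x u := (wordRep n q x.unop).unop u
  one_smul u := by
    change (wordRep n q 1).unop u = u
    rw [map_one]; rfl
  mul_smul x y u := by
    change (wordRep n q (y.unop * x.unop)).unop u = _
    rw [map_mul]; rfl
  smul_zero x := map_zero (wordRep n q x.unop).unop
  smul_add x := map_add (wordRep n q x.unop).unop
  add_smul x y u := by
    change (wordRep n q (x.unop + y.unop)).unop u = _
    rw [map_add]; rfl
  zero_smul u := by
    change (wordRep n q 0).unop u = 0
    rw [map_zero]; rfl

/-- The linear operator `u ↦ u <• x` on words. -/
noncomputable def rightAct (n : ℕ) (q : ℂ) (x : Hecke n q) : Module.End ℂ (Words n) :=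
  (wordRep n q x).unop

theorem rightAct_apply (n : ℕ) (q : ℂ) (x : Hecke n q) (u : Words n) :
    rightAct n q x u = u <• x := rfl

theorem word_smul_gen {n : ℕ} (q : ℂ) (i : Gen n) (w : Fin n → ℕ) :
    (Finsupp.single w 1 : Words n) <• gen q i =
      swapAct q ⟨i.1 - 1, by have := i.2; omega⟩ ⟨i.1, i.2.2⟩ (Finsupp.single w 1) := by
  rw [← rightAct_apply, rightAct, wordRep, heckeLift_gen, MulOpposite.unop_op]

/-- `T_{s_i}` with a natural number index; only used for `1 ≤ i ≤ n - 1`. -/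
noncomputable def heckeT (n : ℕ) (q : ℂ) (i : ℕ) : Hecke n q :=
  if h : 1 ≤ i ∧ i < n then gen q ⟨i, h⟩ else 0

/-- `B_n(q) = ∑_{i=1}^n T_{s_{n-1}} T_{s_{n-2}} ⋯ T_{s_i}`. -/
noncomputable def bottomToRandom (n : ℕ) (q : ℂ) : Hecke n q :=
  ∑ i ∈ Finset.Icc 1 n, ((List.Ico i n).reverse.map (heckeT n q)).prod

/-- `B_n^*(q) = ∑_{j=1}^n T_{s_j} T_{s_{j+1}} ⋯ T_{s_{n-1}}`. -/
noncomputable def randomToBottom (n : ℕ) (q : ℂ) : Hecke n q :=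
  ∑ j ∈ Finset.Icc 1 n, ((List.Ico j n).map (heckeT n q)).prod

/-- `R_n(q) = B_n^*(q) B_n(q)`. -/
noncomputable def randomToRandom (n : ℕ) (q : ℂ) : Hecke n q :=
  randomToBottom n q * bottomToRandom n q

/-- `T_{(i,k)}` for `i < k`, from the reduced expression
`(i,k) = s_i s_{i+1} ⋯ s_{k-2} s_{k-1} s_{k-2} ⋯ s_{i+1} s_i`. -/
noncomputable def transpositionT (n : ℕ) (q : ℂ) (i k : ℕ) : Hecke n q :=
  ((List.Ico i k).map (heckeT n q)).prod * ((List.Ico i (k - 1)).reverse.map (heckeT n q)).prod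

/-- The Jucys-Murphy element `J_k(q) = ∑_{i=1}^{k-1} q^{i-k} T_{(i,k)}` in `H_n(q)`, for `k ≤ n`. -/
noncomputable def jucysMurphy (n : ℕ) (q : ℂ) (k : ℕ) : Hecke n q :=
  ∑ i ∈ Finset.Icc 1 (k - 1), q ^ ((i : ℤ) - (k : ℤ)) • transpositionT n q i k

open Classical in
/-- The image in `H_n(q)` of an element of `H_k(q)`; only used for `k ≤ n`. -/
noncomputable def heckeUp {k : ℕ} (n : ℕ) {q : ℂ} (x : Hecke k q) : Hecke n q :=
  if h : k ≤ n then heckeIncl q h x else 0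

/-- `C_j^{(n)} = B_{j+1}(q) B_{j+2}(q) ⋯ B_n(q)` in `H_n(q)`. -/
noncomputable def bottomProduct (j n : ℕ) (q : ℂ) : Hecke n q :=
  ((List.Ico (j + 1) (n + 1)).map fun k => heckeUp n (bottomToRandom k q)).prod

/-- The `q`-integer `[m]_q` for an integer `m`: it is `1 + q + ⋯ + q^{m-1}` for `m ≥ 0` and
`-q^{-1} - q^{-2} - ⋯ - q^{m}` for `m < 0`. -/
noncomputable def qInt (q : ℂ) : ℤ → ℂ
  | Int.ofNat m => ∑ i ∈ Finset.range m, q ^ i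
  | Int.negSucc m => -∑ i ∈ Finset.range (m + 1), (q ^ (i + 1))⁻¹

/-- The `q`-content `∑_{(i,j) ∈ ν ∖ μ} [j - i]_q`. -/
noncomputable def skewContent (q : ℂ) (μ ν : YoungDiagram) : ℂ :=
  ∑ c ∈ ν.cells \ μ.cells, qInt q ((c.2 : ℤ) - (c.1 : ℤ))

/-- Standard fillings of `ν ∖ μ` by the numbers `|μ| + 1, …, |ν|` (each used once), increasing along
rows and down columns. A cell `(i, j)` is in row `i` and column `j`, both counted from `0`. -/
structure SkewSYT (μ ν : YoungDiagram) where
  fill : {c : ℕ × ℕ // c ∈ ν.cells \ μ.cells} ≃ {k : ℕ // k ∈ Finset.Ioc μ.card ν.card}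
  row_lt : ∀ c d, c.1.1 = d.1.1 → c.1.2 < d.1.2 → (fill c).1 < (fill d).1
  col_lt : ∀ c d, c.1.2 = d.1.2 → c.1.1 < d.1.1 → (fill c).1 < (fill d).1

/-- Standard Young tableaux of shape `ν`, i.e. of shape `ν ∖ ∅`. -/
abbrev SYT (ν : YoungDiagram) : Type := SkewSYT ⊥ ν

namespace SkewSYT

variable {μ ν : YoungDiagram}

/-- The cell containing the entry `k`. -/
def cell (t : SkewSYT μ ν) (k : ℕ) : ℕ × ℕ :=
  if h : k ∈ Finset.Ioc μ.card ν.card then (t.fill.symm ⟨k, h⟩).1 else (0, 0)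

/-- The entry in the cell `c` (and `0` outside `ν ∖ μ`). -/
def entry (t : SkewSYT μ ν) (c : ℕ × ℕ) : ℕ :=
  if h : c ∈ ν.cells \ μ.cells then (t.fill ⟨c, h⟩).1 else 0

/-- The row, counted from `1`, containing the entry `k`. -/
def row (t : SkewSYT μ ν) (k : ℕ) : ℕ := (t.cell k).1 + 1

/-- The content (column minus row) of the cell containing `k`. -/
def content (t : SkewSYT μ ν) (k : ℕ) : ℤ := ((t.cell k).2 : ℤ) - ((t.cell k).1 : ℤ)

theorem fill_le (t : SkewSYT μ ν) (c d : {c : ℕ × ℕ // c ∈ ν.cells \ μ.cells}) (h : c.1 ≤ d.1) :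
    (t.fill c).1 ≤ (t.fill d).1 := by
  obtain ⟨⟨a, b⟩, hc⟩ := c
  obtain ⟨⟨a', b'⟩, hd⟩ := d
  obtain ⟨h1, h2⟩ : a ≤ a' ∧ b ≤ b' := h
  have hc' := Finset.mem_sdiff.1 hc
  have hd' := Finset.mem_sdiff.1 hd
  have he : (a, b') ∈ ν.cells \ μ.cells := Finset.mem_sdiff.2
    ⟨ν.up_left_mem h1 le_rfl hd'.1, fun hμ => hc'.2 (μ.up_left_mem le_rfl h2 hμ)⟩
  have e1 : (t.fill ⟨(a, b), hc⟩).1 ≤ (t.fill ⟨(a, b'), he⟩).1 := by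
    rcases h2.eq_or_lt with rfl | h2
    · rfl
    · exact (t.row_lt ⟨(a, b), hc⟩ ⟨(a, b'), he⟩ rfl h2).le
  have e2 : (t.fill ⟨(a, b'), he⟩).1 ≤ (t.fill ⟨(a', b'), hd⟩).1 := by
    rcases h1.eq_or_lt with rfl | h1
    · rfl
    · exact (t.col_lt ⟨(a, b'), he⟩ ⟨(a', b'), hd⟩ rfl h1).le
  exact e1.trans e2

/-- The shape of `t|_k`: the diagram formed by `μ` and the cells of `t` with entry at most `k`. -/
def shape (t : SkewSYT μ ν) (k : ℕ) : YoungDiagram where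
  cells := μ.cells ∪ (ν.cells \ μ.cells).filter fun c => t.entry c ≤ k
  isLowerSet := by
    intro d c hcd hd
    rw [Finset.mem_coe, Finset.mem_union] at hd ⊢
    by_cases hc : c ∈ μ.cells
    · exact Or.inl hc
    · rcases hd with hd | hd
      · exact absurd (μ.isLowerSet hcd hd) hc
      · rw [Finset.mem_filter] at hd
        have hcν : c ∈ ν.cells \ μ.cells :=
          Finset.mem_sdiff.2 ⟨ν.isLowerSet hcd (Finset.mem_sdiff.1 hd.1).1, hc⟩
        have hle := t.fill_le ⟨c, hcν⟩ ⟨d, hd.1⟩ hcd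
        refine Or.inr (Finset.mem_filter.2 ⟨hcν, ?_⟩)
        have hd2 := hd.2
        rw [entry, dif_pos hd.1] at hd2
        rw [entry, dif_pos hcν]
        exact hle.trans hd2

end SkewSYT

/-- `μ ⋖ ν`: `μ` is obtained from `ν` by removing a single box. -/
def IsCover (μ ν : YoungDiagram) : Prop := μ ≤ ν ∧ ν.card = μ.card + 1

/-- The tableau of shape `ν ∖ μ` when this shape is a single box; it is the only one, and so in
particular the dominance-maximal one. -/
noncomputable def boxTableau {μ ν : YoungDiagram} (h : IsCover μ ν) : SkewSYT μ ν :=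
  have h1 : (ν.cells \ μ.cells).card = 1 := by
    have e := h.2
    rw [Finset.card_sdiff_of_subset h.1]
    simp only [YoungDiagram.card] at e
    omega
  have hs : ∀ c d : {c : ℕ × ℕ // c ∈ ν.cells \ μ.cells}, c = d := fun c d =>
    Subtype.ext (Finset.card_le_one.1 h1.le _ c.2 _ d.2)
  { fill := Fintype.equivOfCardEq (by
      rw [Fintype.card_coe, Fintype.card_coe, h1, Nat.card_Ioc, h.2]; omega)
    row_lt := fun c d _ hlt => absurd (hs c d) (by rintro rfl; exact lt_irrefl _ hlt)
    col_lt := fun c d _ hlt => absurd (hs c d) (by rintro rfl; exact lt_irrefl _ hlt) }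

theorem eq_boxTableau {μ ν : YoungDiagram} (h : IsCover μ ν) (t : SkewSYT μ ν) :
    t = boxTableau h := by
  have hs : ∀ k l : {k : ℕ // k ∈ Finset.Ioc μ.card ν.card}, k = l := fun k l => by
    have hk := Finset.mem_Ioc.1 k.2
    have hl := Finset.mem_Ioc.1 l.2
    have := h.2
    exact Subtype.ext (by omega)
  have hf : t.fill = (boxTableau h).fill := Equiv.ext fun c => hs _ _
  cases t
  cases hb : boxTableau h
  simp only [hb] at hf
  simp only [hf]

/-- The possible contents of the entry `m` in a standard Young tableau. -/
noncomputable def contentSet (m : ℕ) : Finset ℤ :=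
  if m = 2 ∨ m = 3 then (Finset.Ioo (-(m : ℤ)) m).erase 0 else Finset.Ioo (-(m : ℤ)) m

open Classical Polynomial in
/-- The Young idempotent
`p_t = ∏_{m=1}^n ∏_d (J_m(q) - [d]_q) / ([c_m(t)]_q - [d]_q)`, where `c_m(t)` is the content of `m`
in `t` and `d` runs over the possible contents of `m` with `[d]_q ≠ [c_m(t)]_q`. If
`[d]_q ≠ [c_m(t)]_q` for all `d ≠ c_m(t)` this is the product over all `d ≠ c_m(t)`. A coincidence
`[d]_q = [c_m(t)]_q` can occur with `H_n(q)` semisimple, when `q` is a root of unity of order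
greater than `n`; the product is then over the values different from `[c_m(t)]_q`, as Lagrange
interpolation demands. -/
noncomputable def youngIdempotent (n : ℕ) (q : ℂ) {ν : YoungDiagram} (t : SYT ν) : Hecke n q :=
  ((List.Ico 1 (n + 1)).map fun m => aeval (jucysMurphy n q m)
    (∏ d ∈ (contentSet m).filter fun d => qInt q d ≠ qInt q (t.content m),
      C (qInt q (t.content m) - qInt q d)⁻¹ * (X - C (qInt q d)))).prod

/-- The word of `t`: its `i`-th letter is the row of `t` containing `i`. -/
noncomputable def word (n : ℕ) {ν : YoungDiagram} (t : SYT ν) : Words n :=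
  Finsupp.single (fun i : Fin n => t.row (i.1 + 1)) 1

/-- The Young seminormal unit `w_t = word(t) p_t`. -/
noncomputable def seminormalUnit (n : ℕ) (q : ℂ) {ν : YoungDiagram} (t : SYT ν) : Words n :=
  word n t <• youngIdempotent n q t

/-- The Specht module `S^ν` (for `|ν| = n`): the right `H_n(q)`-module spanned by the seminormal units
`w_t`, where `t` runs over the standard Young tableaux of shape `ν`. -/
noncomputable def specht (n : ℕ) (q : ℂ) (ν : YoungDiagram) :
    Submodule (Hecke n q)ᵐᵒᵖ (Words n) :=
  Submodule.span _ (Set.range fun t : SYT ν => seminormalUnit n q t)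

/-- `p_ν`, the projector of `H_n(q)` onto its `S^ν`-isotypic component (for `|ν| = n`). -/
noncomputable def shapeProjector (n : ℕ) (q : ℂ) (ν : YoungDiagram) : Hecke n q :=
  isotypicProjector (Hecke n q) (specht n q ν)

/-- `p_t = p_{shape(t|_{|μ|+1})} p_{shape(t|_{|μ|+2})} ⋯ p_{shape(t|_n)}` in `H_n(q)`, for a tableau
`t` of shape `ν ∖ μ` with `|ν| = n`. -/
noncomputable def skewProjector (n : ℕ) (q : ℂ) {μ ν : YoungDiagram} (t : SkewSYT μ ν) :
    Hecke n q :=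
  ((List.Ico (μ.card + 1) (n + 1)).map fun k => heckeUp n (shapeProjector k q (t.shape k))).prod

/-- The map `Φ_t` for a tableau `t` of shape `ν ∖ μ`, with `j = |μ|` and `n = |ν|`: it extends a word of
length `j` by the letters `w_i`, `j < i ≤ n`, where `w_i` is the row of `t` containing `i`. -/
noncomputable def Phi (j n : ℕ) {μ ν : YoungDiagram} (t : SkewSYT μ ν) : Words j →ₗ[ℂ] Words n :=
  Finsupp.lmapDomain ℂ ℂ fun (w : Fin j → ℕ) (i : Fin n) =>
    if h : i.1 < j then w ⟨i.1, h⟩ else t.row (i.1 + 1)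

end QShuffle

open QShuffle

namespace QShuffle

/-! ### Hecke algebra relations, Jucys-Murphy elements and the shuffle recursion -/

section Relations
variable {n : ℕ} {q : ℂ}

/-! The engine is an identity in the Hecke algebra, `botT_mul_randomToRandom`: B_{k+1} R_{k+1} = (q
R_k + [k+1]_q + q^{k+1} J_{k+1}) B_{k+1}. It comes from expanding B_{k+1} B*_{k+1}
(`botT_mul_topT`); the remainder B*_k T_k B_k turns into q R_k in front of B_{k+1}, because T_k B_k
B_{k+1} = q B_k B_{k+1} (`heckeT_mul_botT_mul_botT`). Write J_{k+1} = Z_{k+1} - Z_k with Z_m = J_1 +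
... + J_m. The element Z_{k+1} is central in H_{k+1} and acts after p_λ by the total q-content of λ,
while Z_k acts on the extended vector u'Φ by the total q-content of λ'. The difference is the
q-content of the added box, and this gives the eigenvalue in (1). Part (2) repeats this box by box
from the eigenvalue 0, with the projectors collected by centrality (`lift_eigenvector`,
`lift_kernel`).

It remains to see that p_λ sends words of content λ into S^λ itself and not merely into an
isomorphic copy. The image of such a vector under a right ideal isomorphic to S^λ is generated by
vectors fixed by tableau idempotents, so it suffices that every tableau of shape λ has an at most
one-dimensional weight space in the span of these words (`exists_smul_of_weight`). Neither the
simplicity of S^λ nor the nonvanishing of seminormal units is needed.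

Multiplicity one rests on the seminormal theory, derived from the relations without dimension
counts. The joint eigenvalues of the Jucys-Murphy elements are the content sequences of standard
tableaux (`isComplete`); Lagrange interpolation then gives idempotents whose span contains 1, and
these are primitive (`tableauIdempotent_mul_mul_self`). The coefficient of the increasing word is a
functional that kills the weight spaces of all tableaux of the shape except the row sorted one
(`eq_zero_of_ne_isRowSorted`), and it detects every nonzero vector. Semisimplicity enters only
through the nonvanishing of [1]_q, ..., [n]_q (`isGeneric_of_isSemisimpleRing`). -/

theorem heckeT_quadratic {i : ℕ} (h : 1 ≤ i ∧ i < n) :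
    heckeT n q i * heckeT n q i = (q - 1) • heckeT n q i + q • 1 := by
  simp only [heckeT, dif_pos h]
  exact gen_quadratic q _

theorem heckeT_comm_of_le {i j : ℕ} (h : i + 2 ≤ j) :
    heckeT n q i * heckeT n q j = heckeT n q j * heckeT n q i := by
  unfold heckeT
  split_ifs with h1 h2
  · exact gen_comm q _ _ h
  all_goals simp

theorem heckeT_comm {i j : ℕ} (h : i + 2 ≤ j ∨ j + 2 ≤ i) :
    heckeT n q i * heckeT n q j = heckeT n q j * heckeT n q i := by
  rcases h with h | h
  · exact heckeT_comm_of_le h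
  · exact (heckeT_comm_of_le h).symm

/-- No bound on the index is needed: outside the range a generator is 0 by convention and both sides
vanish. -/
theorem heckeT_braid (i : ℕ) :
    heckeT n q i * heckeT n q (i + 1) * heckeT n q i =
      heckeT n q (i + 1) * heckeT n q i * heckeT n q (i + 1) := by
  unfold heckeT
  split_ifs with h1 h2
  · exact gen_braid q _ _ rfl
  all_goals simp

theorem transpositionT_self_succ (k : ℕ) : transpositionT n q k (k + 1) = heckeT n q k := by
  simp [transpositionT, List.Ico.succ_singleton]

theorem transpositionT_eq_left {i k : ℕ} (h : i < k) :
    transpositionT n q i (k + 1) = heckeT n q i * transpositionT n q (i + 1) (k + 1) * heckeT n q i := by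
  simp only [transpositionT, Nat.add_sub_cancel]
  rw [List.Ico.eq_cons (show i < k + 1 by omega), List.Ico.eq_cons h]
  simp [mul_assoc]

/-- The reduced word is sandwiched between two copies of T_i; the braid relation trades this for a
sandwich by T_k, which is the form needed for a recursion in the upper index. -/
theorem transpositionT_succ {i k : ℕ} (h : i < k) :
    transpositionT n q i (k + 1) = heckeT n q k * transpositionT n q i k * heckeT n q k := by
  obtain ⟨d, rfl⟩ := Nat.exists_eq_add_of_lt h
  induction d generalizing i with
  | zero =>
    rw [transpositionT_eq_left (by omega), Nat.add_zero, transpositionT_self_succ,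
      transpositionT_self_succ, heckeT_braid]
  | succ d ih =>
    have ih := ih (i := i + 1) (by omega)
    rw [show i + 1 + d + 1 = i + (d + 1) + 1 by omega] at ih
    rw [transpositionT_eq_left (by omega), ih, transpositionT_eq_left (i := i) (by omega)]
    have hc : heckeT n q i * heckeT n q (i + (d + 1) + 1) =
      heckeT n q (i + (d + 1) + 1) * heckeT n q i := heckeT_comm (by omega)
    calc _ = (heckeT n q i * heckeT n q (i + (d + 1) + 1)) *
        transpositionT n q (i + 1) (i + (d + 1) + 1) *
          (heckeT n q (i + (d + 1) + 1) * heckeT n q i) := by simp only [mul_assoc]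
      _ = _ := by rw [hc, ← hc]; rw [hc]; simp only [mul_assoc]; rw [hc]

theorem jucysMurphy_one : jucysMurphy n q 1 = 0 := by simp [jucysMurphy]

theorem jucysMurphy_zero : jucysMurphy n q 0 = 0 := by simp [jucysMurphy]

/-- Apart from J_0 = J_1 = 0, this recursion is all that is used about Jucys-Murphy elements from
here on. -/
theorem jucysMurphy_succ (hq : q ≠ 0) {k : ℕ} (hk : 1 ≤ k) :
    jucysMurphy n q (k + 1) =
      q⁻¹ • (heckeT n q k * jucysMurphy n q k * heckeT n q k) + q⁻¹ • heckeT n q k := by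
  obtain ⟨k, rfl⟩ := Nat.exists_eq_add_of_le' hk
  simp only [jucysMurphy, Nat.add_sub_cancel]
  rw [Finset.sum_Icc_succ_top (by omega), transpositionT_self_succ, Finset.mul_sum, Finset.sum_mul,
    Finset.smul_sum]
  congr 1
  · refine Finset.sum_congr rfl fun i hi => ?_
    have := Finset.mem_Icc.1 hi
    rw [transpositionT_succ (by omega), mul_smul_comm, smul_mul_assoc, smul_smul]
    congr 1
    rw [← zpow_neg_one, ← zpow_add₀ hq]
    congr 1
    push_cast
    ring
  · congr 1
    rw [← zpow_neg_one]
    congr 1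
    push_cast
    ring

/-- The relation of the affine Hecke algebra: multiply the recursion for J_{k+1} by T_k and reduce
with the quadratic relation. The next lemma is its mirror image. -/
theorem jucysMurphy_succ_mul (hq : q ≠ 0) {k : ℕ} (hk : 1 ≤ k ∧ k < n) :
    jucysMurphy n q (k + 1) * heckeT n q k =
      heckeT n q k * jucysMurphy n q k + (q - 1) • jucysMurphy n q (k + 1) + 1 := by
  have hT := heckeT_quadratic (q := q) hk
  rw [jucysMurphy_succ hq hk.1, add_mul, smul_mul_assoc, smul_mul_assoc, mul_assoc _ (heckeT n q k), hT]
  simp only [mul_add, mul_smul_comm, mul_one, smul_add, smul_smul, inv_mul_cancel₀ hq, one_smul]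
  rw [mul_comm q⁻¹ (q - 1)]
  abel

theorem heckeT_mul_jucysMurphy_succ (hq : q ≠ 0) {k : ℕ} (hk : 1 ≤ k ∧ k < n) :
    heckeT n q k * jucysMurphy n q (k + 1) =
      jucysMurphy n q k * heckeT n q k + (q - 1) • jucysMurphy n q (k + 1) + 1 := by
  have hT := heckeT_quadratic (q := q) hk
  rw [jucysMurphy_succ hq hk.1, mul_add, mul_smul_comm, mul_smul_comm, mul_assoc _ (jucysMurphy n q k),
    ← mul_assoc (heckeT n q k) (heckeT n q k), hT]
  simp only [add_mul, smul_mul_assoc, one_mul, smul_add, smul_smul, inv_mul_cancel₀ hq, one_smul]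
  rw [mul_comm q⁻¹ (q - 1)]
  abel

theorem heckeT_commute_jucysMurphy_of_le (hq : q ≠ 0) {i k : ℕ} (h : k < i) :
    Commute (heckeT n q i) (jucysMurphy n q k) := by
  induction k with
  | zero => rw [jucysMurphy_zero]; exact Commute.zero_right _
  | succ k ih =>
    rcases Nat.eq_zero_or_pos k with rfl | hk
    · rw [jucysMurphy_one]; exact Commute.zero_right _
    · have hT : Commute (heckeT n q i) (heckeT n q k) := heckeT_comm (by omega)
      rw [jucysMurphy_succ hq hk]
      exact (((hT.mul_right (ih (by omega))).mul_right hT).smul_right _).add_right (hT.smul_right _)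

/-- Only J_{i+2} takes work; later elements follow from the recursion, since T_i commutes with every
T_m for m ≥ i + 2. Two applications of the recursion split J_{i+2} into a multiple of T_{i+1} T_i
J_i T_i T_{i+1} and a multiple of T_{i+1} T_i T_{i+1} + q T_{i+1}, and each of these commutes with
T_i by the braid relation. -/
theorem heckeT_commute_jucysMurphy_of_lt (hq : q ≠ 0) {i k : ℕ} (hi : 1 ≤ i ∧ i < n) (h : i + 1 < k) :
    Commute (heckeT n q i) (jucysMurphy n q k) := by
  obtain ⟨d, rfl⟩ := Nat.exists_eq_add_of_lt h
  induction d with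
  | zero =>
    rw [Nat.add_zero, jucysMurphy_succ hq (by omega), jucysMurphy_succ hq hi.1]
    have hc : Commute (heckeT n q (i + 1)) (jucysMurphy n q i) :=
      heckeT_commute_jucysMurphy_of_le hq (by omega)
    have hb := heckeT_braid (n := n) (q := q) i
    have hT := heckeT_quadratic (q := q) hi
    have hc := hc.eq
    generalize jucysMurphy n q i = J at *
    generalize heckeT n q i = a at *
    generalize heckeT n q (i + 1) = b at *
    have h1 : Commute a (b * (a * J * a) * b) := by
      change a * (b * (a * J * a) * b) = b * (a * J * a) * b * a
      calc a * (b * (a * J * a) * b) = (a * b * a) * J * a * b := by simp only [mul_assoc]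
        _ = b * a * (b * J) * a * b := by rw [hb]; simp only [mul_assoc]
        _ = b * a * J * (b * a * b) := by rw [hc]; simp only [mul_assoc]
        _ = _ := by rw [← hb]; simp only [mul_assoc]
    have h2 : Commute a (b * a * b + q • b) := by
      change a * (b * a * b + q • b) = (b * a * b + q • b) * a
      rw [← hb, mul_add, add_mul, ← mul_assoc, ← mul_assoc, hT, mul_assoc (a * b), hT]
      simp only [add_mul, mul_add, smul_mul_assoc, mul_smul_comm, one_mul, mul_one, mul_assoc]
      abel
    have h3 : q⁻¹ • (b * (q⁻¹ • (a * J * a) + q⁻¹ • a) * b) + q⁻¹ • b =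
        (q⁻¹ * q⁻¹) • (b * (a * J * a) * b) + (q⁻¹ * q⁻¹) • (b * a * b + q • b) := by
      simp only [mul_add, add_mul, mul_smul_comm, smul_mul_assoc, smul_add, smul_smul]
      rw [mul_assoc q⁻¹ q⁻¹ q, inv_mul_cancel₀ hq, mul_one, add_assoc]
    rw [h3]
    exact (h1.smul_right _).add_right (h2.smul_right _)
  | succ d ih =>
    have hT : Commute (heckeT n q i) (heckeT n q (i + 1 + (d + 1))) := heckeT_comm (by omega)
    rw [jucysMurphy_succ hq (by omega)]
    exact (((hT.mul_right (ih (by omega))).mul_right hT).smul_right _).add_right (hT.smul_right _)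

/-- The subalgebra of `H_n(q)` generated by the `T_{s_i}` with `1 ≤ i < k`. -/
noncomputable def parabolic (n : ℕ) (q : ℂ) (k : ℕ) : Subalgebra ℂ (Hecke n q) :=
  Algebra.adjoin ℂ {x | ∃ i, 1 ≤ i ∧ i < k ∧ x = heckeT n q i}

theorem heckeT_mem_parabolic {i k : ℕ} (hi : 1 ≤ i) (h : i < k) : heckeT n q i ∈ parabolic n q k :=
  Algebra.subset_adjoin ⟨i, hi, h, rfl⟩

theorem parabolic_mono {k l : ℕ} (h : k ≤ l) : parabolic n q k ≤ parabolic n q l :=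
  Algebra.adjoin_mono fun _ ⟨i, h1, h2, hx⟩ => ⟨i, h1, by omega, hx⟩

theorem commute_of_mem_parabolic {k : ℕ} {y : Hecke n q}
    (hy : ∀ i, 1 ≤ i → i < k → Commute (heckeT n q i) y) {x : Hecke n q}
    (hx : x ∈ parabolic n q k) : Commute x y := by
  induction hx using Algebra.adjoin_induction with
  | mem x hx => obtain ⟨i, h1, h2, rfl⟩ := hx; exact hy i h1 h2
  | algebraMap r => exact Algebra.commute_algebraMap_left r y
  | add a b _ _ ha hb => exact ha.add_left hb
  | mul a b _ _ ha hb => exact ha.mul_left hb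

theorem commute_heckeT_of_mem_parabolic {k m : ℕ} (h : k < m) {x : Hecke n q}
    (hx : x ∈ parabolic n q k) : Commute x (heckeT n q m) :=
  commute_of_mem_parabolic (fun _ _ _ => heckeT_comm (by omega)) hx

theorem commute_jucysMurphy_of_mem_parabolic (hq : q ≠ 0) {k m : ℕ} (hk : k ≤ n) (h : k < m)
    {x : Hecke n q} (hx : x ∈ parabolic n q k) : Commute x (jucysMurphy n q m) :=
  commute_of_mem_parabolic
    (fun _ h1 h2 => heckeT_commute_jucysMurphy_of_lt hq (by omega) (by omega)) hx

theorem jucysMurphy_mem_parabolic (hq : q ≠ 0) (k : ℕ) : jucysMurphy n q k ∈ parabolic n q k := by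
  induction k with
  | zero => rw [jucysMurphy_zero]; exact zero_mem _
  | succ k ih =>
    rcases Nat.eq_zero_or_pos k with rfl | hk
    · rw [jucysMurphy_one]; exact zero_mem _
    · have hT : heckeT n q k ∈ parabolic n q (k + 1) := heckeT_mem_parabolic hk (by omega)
      rw [jucysMurphy_succ hq hk]
      exact add_mem (Subalgebra.smul_mem _ (mul_mem (mul_mem hT (parabolic_mono (by omega) ih)) hT) _)
        (Subalgebra.smul_mem _ hT _)

theorem jucysMurphy_commute_of_lt (hq : q ≠ 0) {k m : ℕ} (hk : k ≤ n) (h : k < m) :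
    Commute (jucysMurphy n q k) (jucysMurphy n q m) :=
  commute_jucysMurphy_of_mem_parabolic hq hk h (jucysMurphy_mem_parabolic hq k)

theorem parabolic_eq_top : parabolic n q n = ⊤ := by
  rw [eq_top_iff]
  let π : FreeAlgebra ℂ (Gen n) →ₐ[ℂ] Hecke n q := RingQuot.mkAlgHom ℂ (HeckeRel n q)
  have hs : Function.Surjective π := RingQuot.mkAlgHom_surjective ℂ (HeckeRel n q)
  rintro x -
  obtain ⟨y, rfl⟩ := hs x
  induction y using FreeAlgebra.induction with
  | grade0 r => rw [AlgHom.commutes]; exact Subalgebra.algebraMap_mem _ r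
  | grade1 i =>
    refine Algebra.subset_adjoin ⟨i.1, i.2.1, i.2.2, ?_⟩
    rw [heckeT, dif_pos i.2]; rfl
  | mul a b ha hb => rw [map_mul]; exact mul_mem ha hb
  | add a b ha hb => rw [map_add]; exact add_mem ha hb

theorem mem_parabolic (x : Hecke n q) : x ∈ parabolic n q n := by
  rw [parabolic_eq_top]; trivial

/-- The sum of the Jucys-Murphy elements `J_1(q), …, J_n(q)`. -/
noncomputable def jucysMurphySum (n : ℕ) (q : ℂ) (k : ℕ) : Hecke n q :=
  ∑ m ∈ Finset.Icc 1 k, jucysMurphy n q m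

/-- The two forms of the affine Hecke relation show that T_i commutes with J_i + J_{i+1}; the other
summands commute with T_i one by one. -/
theorem heckeT_commute_jucysMurphySum (hq : q ≠ 0) {i k : ℕ} (hi : 1 ≤ i) (hik : i < k) (hk : k ≤ n) :
    Commute (heckeT n q i) (jucysMurphySum n q k) := by
  induction k, hik using Nat.le_induction with
  | base =>
    obtain ⟨i, rfl⟩ := Nat.exists_eq_add_of_le' hi
    rw [jucysMurphySum, Finset.sum_Icc_succ_top (by omega), Finset.sum_Icc_succ_top (by omega), add_assoc]
    refine Commute.add_right (Commute.sum_right _ _ _ fun m hm =>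
      heckeT_commute_jucysMurphy_of_le hq (by have := Finset.mem_Icc.1 hm; omega)) ?_
    have h1 := heckeT_mul_jucysMurphy_succ hq (n := n) (q := q) (k := i + 1) (by omega)
    have h2 := jucysMurphy_succ_mul hq (n := n) (q := q) (k := i + 1) (by omega)
    change _ * _ = _ * _
    rw [mul_add, add_mul, h1, h2]
    abel
  | succ k h ih =>
    rw [jucysMurphySum, Finset.sum_Icc_succ_top (by omega)]
    exact (ih (by omega)).add_right (heckeT_commute_jucysMurphy_of_lt hq (by omega) (by omega))

theorem jucysMurphySum_commute (hq : q ≠ 0) {k : ℕ} (hk : k ≤ n) {x : Hecke n q}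
    (hx : x ∈ parabolic n q k) : Commute x (jucysMurphySum n q k) :=
  commute_of_mem_parabolic (fun _ h1 h2 => heckeT_commute_jucysMurphySum hq h1 h2 hk) hx

/-- The image of `B_k(q)` in `H_n(q)`. -/
noncomputable def botT (n : ℕ) (q : ℂ) (k : ℕ) : Hecke n q :=
  ∑ i ∈ Finset.Icc 1 k, ((List.Ico i k).reverse.map (heckeT n q)).prod

/-- The image of `B_k^*(q)` in `H_n(q)`. -/
noncomputable def topT (n : ℕ) (q : ℂ) (k : ℕ) : Hecke n q :=
  ∑ j ∈ Finset.Icc 1 k, ((List.Ico j k).map (heckeT n q)).prod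

theorem botT_zero : botT n q 0 = 0 := by simp [botT]

theorem topT_zero : topT n q 0 = 0 := by simp [topT]

theorem botT_succ (k : ℕ) : botT n q (k + 1) = 1 + heckeT n q k * botT n q k := by
  rw [botT, Finset.sum_Icc_succ_top (by omega), botT, Finset.mul_sum, add_comm]
  congr 1
  · simp
  · refine Finset.sum_congr rfl fun i hi => ?_
    rw [List.Ico.succ_top (Finset.mem_Icc.1 hi).2]
    simp

theorem topT_succ (k : ℕ) : topT n q (k + 1) = 1 + topT n q k * heckeT n q k := by
  rw [topT, Finset.sum_Icc_succ_top (by omega), topT, Finset.sum_mul, add_comm]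
  congr 1
  · simp
  · refine Finset.sum_congr rfl fun i hi => ?_
    rw [List.Ico.succ_top (Finset.mem_Icc.1 hi).2]
    simp

theorem botT_mem_parabolic (k : ℕ) : botT n q k ∈ parabolic n q k := by
  induction k with
  | zero => rw [botT_zero]; exact zero_mem _
  | succ k ih =>
    rw [botT_succ]
    rcases Nat.eq_zero_or_pos k with rfl | hk
    · rw [botT_zero, mul_zero, add_zero]; exact one_mem _
    · exact add_mem (one_mem _)
        (mul_mem (heckeT_mem_parabolic hk (by omega)) (parabolic_mono (by omega) ih))

theorem topT_mem_parabolic (k : ℕ) : topT n q k ∈ parabolic n q k := by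
  induction k with
  | zero => rw [topT_zero]; exact zero_mem _
  | succ k ih =>
    rw [topT_succ]
    rcases Nat.eq_zero_or_pos k with rfl | hk
    · rw [topT_zero, zero_mul, add_zero]; exact one_mem _
    · exact add_mem (one_mem _)
        (mul_mem (parabolic_mono (by omega) ih) (heckeT_mem_parabolic hk (by omega)))

/-- In a symmetrizer, T_k would be absorbed with the factor q; the two factors B_k B_{k+1} already
suffice for this. In the induction the product splits into (1 + T_{k+1}) B_{k+1}, where the
quadratic relation applies, and a term where the braid relation passes T_{k+1} through as T_k. -/
theorem heckeT_mul_botT_mul_botT {k : ℕ} (h : k < n) :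
    heckeT n q k * (botT n q k * botT n q (k + 1)) = q • (botT n q k * botT n q (k + 1)) := by
  induction k with
  | zero => simp [botT_zero]
  | succ k ih =>
    have ih := ih (by omega)
    have hc : heckeT n q (k + 1) * botT n q k = botT n q k * heckeT n q (k + 1) :=
      (commute_heckeT_of_mem_parabolic (by omega) (botT_mem_parabolic k)).symm.eq
    have hb := heckeT_braid (n := n) (q := q) k
    have hT := heckeT_quadratic (n := n) (q := q) (i := k + 1) (by omega)
    rw [botT_succ (k + 1), botT_succ k] at *
    generalize heckeT n q k = a at *
    generalize heckeT n q (k + 1) = b at *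
    generalize botT n q k = c at *
    have e : (1 + a * c) * (1 + b * (1 + a * c)) =
        (1 + b) * (1 + a * c) + a * b * (c * (1 + a * c)) := by
      calc _ = (1 + b) * (1 + a * c) + a * (c * b) * (1 + a * c) := by noncomm_ring
        _ = _ := by rw [← hc]; noncomm_ring
    rw [e, mul_add, smul_add]
    congr 1
    · rw [← mul_assoc, mul_add b, mul_one, hT, ← smul_mul_assoc]
      congr 1
      module
    · calc b * (a * b * (c * (1 + a * c))) = (b * a * b) * (c * (1 + a * c)) := by
            simp only [mul_assoc]
        _ = a * b * (a * (c * (1 + a * c))) := by rw [← hb]; simp only [mul_assoc]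
        _ = _ := by rw [ih, mul_smul_comm]

/-- Induction by sandwiching the previous identity between copies of T_{k+1}: this nearly produces
the next Jucys-Murphy element, and the braid relation turns the remainder into the new remainder. -/
theorem botT_mul_topT (hq : q ≠ 0) {k : ℕ} (h : k < n) :
    botT n q (k + 1) * topT n q (k + 1) = (∑ i ∈ Finset.range (k + 1), q ^ i) • 1 +
      q ^ (k + 1) • jucysMurphy n q (k + 1) + topT n q k * heckeT n q k * botT n q k := by
  induction k with
  | zero => simp [botT_succ, topT_succ, botT_zero, topT_zero, jucysMurphy_one]
  | succ k ih =>
    have ih := ih (by omega)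
    have hJ := jucysMurphy_succ (n := n) hq (k := k + 1) (by omega)
    have hT := heckeT_quadratic (n := n) (q := q) (i := k + 1) (by omega)
    have hc : heckeT n q (k + 1) * botT n q k = botT n q k * heckeT n q (k + 1) :=
      (commute_heckeT_of_mem_parabolic (by omega) (botT_mem_parabolic k)).symm.eq
    have hc' : heckeT n q (k + 1) * topT n q k = topT n q k * heckeT n q (k + 1) :=
      (commute_heckeT_of_mem_parabolic (by omega) (topT_mem_parabolic k)).symm.eq
    have hb := heckeT_braid (n := n) (q := q) k
    have hs : (∑ i ∈ Finset.range (k + 1 + 1), q ^ i) = 1 + q * ∑ i ∈ Finset.range (k + 1), q ^ i := by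
      rw [Finset.sum_range_succ', Finset.mul_sum]; simp [pow_succ', add_comm]
    have hs' : (q - 1) * (∑ i ∈ Finset.range (k + 1), q ^ i) = q ^ (k + 1) - 1 :=
      mul_geom_sum q (k + 1)
    have hJ' : q ^ (k + 1 + 1) • jucysMurphy n q (k + 1 + 1) = q ^ (k + 1) • (heckeT n q (k + 1) *
        jucysMurphy n q (k + 1) * heckeT n q (k + 1)) + q ^ (k + 1) • heckeT n q (k + 1) := by
      rw [hJ, smul_add, smul_smul, smul_smul, pow_succ q (k + 1), mul_assoc, mul_inv_cancel₀ hq, mul_one]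
    rw [hJ', hs, botT_succ (k + 1), topT_succ (k + 1)]
    have e : (1 + heckeT n q (k + 1) * botT n q (k + 1)) *
        (1 + topT n q (k + 1) * heckeT n q (k + 1)) = 1 + heckeT n q (k + 1) * botT n q (k + 1) +
          topT n q (k + 1) * heckeT n q (k + 1) + heckeT n q (k + 1) *
            (botT n q (k + 1) * topT n q (k + 1)) * heckeT n q (k + 1) := by noncomm_ring
    rw [e, ih, botT_succ k, topT_succ k]
    generalize heckeT n q k = a at *
    generalize heckeT n q (k + 1) = b at *
    generalize botT n q k = c at *
    generalize topT n q k = d at *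
    generalize jucysMurphy n q (k + 1) = J at *
    generalize (∑ i ∈ Finset.range (k + 1), q ^ i) = s at *
    have e1 : b * (d * a * c) * b = d * (a * b * a) * c := by
      calc b * (d * a * c) * b = (b * d) * a * (c * b) := by simp only [mul_assoc]
        _ = d * (b * a * b) * c := by rw [hc', ← hc]; simp only [mul_assoc]
        _ = _ := by rw [hb]
    have e2 : b * (s • 1 + q ^ (k + 1) • J + d * a * c) * b =
        s • (b * b) + q ^ (k + 1) • (b * J * b) + d * (a * b * a) * c := by
      rw [← e1]
      simp only [mul_add, add_mul, mul_smul_comm, smul_mul_assoc, mul_one]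
    have e3 : (1 + d * a) * b * (1 + a * c) = b + b * (a * c) + d * a * b + d * (a * b * a) * c := by
      noncomm_ring
    -- The quadratic relation leaves (q - 1)[k+1]_q = q^{k+1} - 1 as the coefficient of T_{k+1}: the
    -- q^{k+1} completes the new Jucys-Murphy element and the -1 cancels a surplus T_{k+1} in the
    -- new remainder.
    have e4 : s • (b * b) = (q ^ (k + 1) - 1) • b + (q * s) • 1 := by
      rw [hT, smul_add, smul_smul, smul_smul, mul_comm s, hs', mul_comm s]
    rw [e2, e3, e4]
    simp only [mul_add, add_mul, mul_one, one_mul]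
    module

/-- Multiplication of the previous identity by B_{k+1} lets the remainder absorb its T_k as q, so
that R_k appears. This is the recursion behind all eigenvalues. -/
theorem botT_mul_randomToRandom (hq : q ≠ 0) {k : ℕ} (h : k < n) :
    botT n q (k + 1) * (topT n q (k + 1) * botT n q (k + 1)) =
      (q • (topT n q k * botT n q k) + (∑ i ∈ Finset.range (k + 1), q ^ i) • 1 +
        q ^ (k + 1) • jucysMurphy n q (k + 1)) * botT n q (k + 1) := by
  rw [← mul_assoc, botT_mul_topT hq h, add_mul, mul_assoc, mul_assoc, heckeT_mul_botT_mul_botT h]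
  simp only [add_mul, mul_smul_comm, smul_mul_assoc, one_mul, mul_assoc]
  abel

end Relations

/-! ### Injectivity of q-integers on short ranges -/

section QNumbers

theorem qInt_natCast (q : ℂ) (m : ℕ) : qInt q m = ∑ i ∈ Finset.range m, q ^ i := rfl

theorem qInt_add_one {q : ℂ} (hq : q ≠ 0) (m : ℤ) : qInt q (m + 1) = q * qInt q m + 1 := by
  obtain ⟨m, rfl | rfl⟩ : ∃ k : ℕ, m = k ∨ m = Int.negSucc k := by
    cases m with
    | ofNat k => exact ⟨k, Or.inl rfl⟩
    | negSucc k => exact ⟨k, Or.inr rfl⟩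
  · rw [← Nat.cast_succ, qInt_natCast, qInt_natCast, Finset.sum_range_succ', Finset.mul_sum]
    simp [pow_succ']
  · cases m with
    | zero => simp [qInt, hq]
    | succ m =>
      change -∑ i ∈ Finset.range (m + 1), (q ^ (i + 1))⁻¹ =
        q * -∑ i ∈ Finset.range (m + 1 + 1), (q ^ (i + 1))⁻¹ + 1
      rw [Finset.sum_range_succ' (n := m + 1), mul_neg, mul_add, Finset.mul_sum]
      have : ∀ i : ℕ, q * (q ^ (i + 1 + 1))⁻¹ = (q ^ (i + 1))⁻¹ := fun i => by
        rw [pow_succ q (i + 1), mul_inv, mul_comm, mul_assoc, inv_mul_cancel₀ hq, mul_one]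
      simp [this, hq]

theorem qInt_zero (q : ℂ) : qInt q 0 = 0 := by
  simpa using qInt_natCast q 0

/-- The number `q ^ m`, expressed through `[m]_q`, is nonzero. -/
theorem qInt_pow_ne_zero {q : ℂ} (hq : q ≠ 0) (m : ℤ) : (q - 1) * qInt q m + 1 ≠ 0 := by
  have key : (q - 1) * qInt q m + 1 = q ^ m := by
    have step : ∀ m : ℤ, (q - 1) * qInt q m + 1 = q ^ m ↔
        (q - 1) * qInt q (m + 1) + 1 = q ^ (m + 1) := fun m => by
      rw [qInt_add_one hq, zpow_add_one₀ hq]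
      constructor
      · intro h; rw [← h]; ring
      · intro h; refine mul_right_cancel₀ hq ?_; rw [← h]; ring
    induction m using Int.induction_on with
    | zero => simp [qInt_zero]
    | succ i ih => exact (step _).1 ih
    | pred i ih => exact (step _).2 (by simpa using ih)
  rw [key]
  exact zpow_ne_zero _ hq

/-- `q` is nonzero and the `q`-integers `[1]_q, …, [n]_q` are nonzero. -/
structure IsGeneric (n : ℕ) (q : ℂ) : Prop where
  ne_zero : q ≠ 0
  sum_ne_zero : ∀ m, 1 ≤ m → m ≤ n → ∑ i ∈ Finset.range m, q ^ i ≠ 0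

theorem IsGeneric.mono {k n : ℕ} {q : ℂ} (h : IsGeneric n q) (hk : k ≤ n) : IsGeneric k q :=
  ⟨h.1, fun m h1 h2 => h.2 m h1 (h2.trans hk)⟩

/-- This is [a+k] = [a] + q^a [k], with q^a written as (q-1)[a] + 1 to stay polynomial in [a]. -/
theorem qInt_add_natCast {q : ℂ} (hq : q ≠ 0) (a : ℤ) (k : ℕ) :
    qInt q (a + k) = qInt q a + ((q - 1) * qInt q a + 1) * qInt q k := by
  induction k with
  | zero => simp [qInt_zero]
  | succ k ih =>
    rw [Nat.cast_succ, ← add_assoc, qInt_add_one hq, qInt_add_one hq, ih]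
    ring

/-- Here [a] - [b] = q^b [a-b], so contents at distance at most n are separated by their q-integers
even when q is a root of unity of larger order. -/
theorem IsGeneric.qInt_ne {n : ℕ} {q : ℂ} (h : IsGeneric n q) {a b : ℤ} (hab : a ≠ b)
    (hn : |a - b| ≤ n) : qInt q a ≠ qInt q b := by
  wlog hlt : b < a generalizing a b
  · exact (this hab.symm (by rwa [abs_sub_comm]) (by omega)).symm
  obtain ⟨k, hk⟩ := Int.eq_ofNat_of_zero_le (show 0 ≤ a - b by omega)
  obtain rfl : a = b + k := by omega
  have hk1 : 1 ≤ k := by omega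
  have hkn : k ≤ n := by rw [hk, Nat.abs_cast] at hn; exact_mod_cast hn
  rw [qInt_add_natCast h.1, Ne, add_eq_left]
  exact mul_ne_zero (qInt_pow_ne_zero h.1 b) (by rw [qInt_natCast]; exact h.2 k hk1 hkn)

theorem IsGeneric.add_one_ne_zero {n : ℕ} {q : ℂ} (h : IsGeneric n q) (hn : 2 ≤ n) : q + 1 ≠ 0 := by
  have := h.2 2 (by norm_num) hn
  simpa [Finset.sum_range_succ, add_comm] using this

end QNumbers

/-! ### Standard tableaux as lists of cells, and the combinatorics of addable cells -/

section Tableaux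

/-- The content (column minus row) of a cell. -/
def cellContent (c : ℕ × ℕ) : ℤ := (c.2 : ℤ) - (c.1 : ℤ)

/-- The cell `b` may be added to the cells listed in `t`. -/
def IsAddable (b : ℕ × ℕ) (t : List (ℕ × ℕ)) : Prop := b ∉ t ∧ ∀ c, c < b → c ∈ t

/-- A standard Young tableau, given as the list of its cells, the cell with the largest entry first. -/
def IsTableau : List (ℕ × ℕ) → Prop
  | [] => True
  | b :: t => IsAddable b t ∧ IsTableau t

variable {t s r u : List (ℕ × ℕ)} {a b c : ℕ × ℕ}

theorem IsTableau.mem_of_le (h : IsTableau t) (hb : b ∈ t) (hc : c ≤ b) : c ∈ t := by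
  induction t with
  | nil => simp at hb
  | cons a t ih =>
    rcases List.mem_cons.1 hb with rfl | hb
    · rcases hc.eq_or_lt with rfl | hc
      · exact hb
      · exact List.mem_cons_of_mem _ (h.1.2 c hc)
    · exact List.mem_cons_of_mem _ (ih h.2 hb)

theorem IsTableau.nodup (h : IsTableau t) : t.Nodup := by
  induction t with
  | nil => simp
  | cons a t ih => exact List.nodup_cons.2 ⟨h.1.1, ih h.2⟩

theorem IsTableau.of_append (h : IsTableau (u ++ t)) : IsTableau t := by
  induction u with
  | nil => exact h
  | cons a u ih => exact ih h.2

theorem IsAddable.perm (h : IsAddable b t) (hts : t.Perm s) : IsAddable b s :=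
  ⟨fun hb => h.1 (hts.mem_iff.2 hb), fun c hc => hts.mem_iff.1 (h.2 c hc)⟩

theorem IsTableau.append_of_perm (h : IsTableau (u ++ t)) (hs : IsTableau s) (hts : t.Perm s) :
    IsTableau (u ++ s) := by
  induction u with
  | nil => exact hs
  | cons a u ih => exact ⟨h.1.perm (hts.append_left u), ih h.2⟩

/-- A maximal cell of a tableau can be removed. -/
theorem IsTableau.erase (h : IsTableau t) (hb : ∀ a ∈ t, b ≤ a → a = b) : IsTableau (t.erase b) := by
  induction t with
  | nil => trivial
  | cons a t ih =>
    by_cases hab : a = b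
    · subst hab; simpa using h.2
    · rw [List.erase_cons_tail (by simpa using hab)]
      refine ⟨⟨fun ha => h.1.1 (List.mem_of_mem_erase ha), fun c hc => ?_⟩,
        ih h.2 fun a ha => hb a (List.mem_cons_of_mem _ ha)⟩
      have hcb : c ≠ b := fun e => hab (hb a (by simp) (e ▸ hc.le))
      exact (List.mem_erase_of_ne hcb).2 (h.1.2 c hc)

theorem IsTableau.cons_erase (h : IsTableau t) (hbt : b ∈ t) (hb : ∀ a ∈ t, b ≤ a → a = b) :
    IsTableau (b :: t.erase b) := by
  refine ⟨⟨h.nodup.not_mem_erase, fun c hc => ?_⟩, h.erase hb⟩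
  exact (List.mem_erase_of_ne hc.ne).2 (h.mem_of_le hbt hc.le)

/-- The initial parts of the first row and first column share at most the corner cell. All bounds on
contents come from this count. -/
theorem hook_le_length {p m : ℕ} (h1 : ∀ y < p, (0, y) ∈ t) (h2 : ∀ x < m, (x, 0) ∈ t) :
    p + m ≤ t.length + 1 := by
  classical
  have hd : Disjoint ((Finset.range p).image fun y => (0, y))
      ((Finset.Ico 1 m).image fun x => (x, 0)) := by
    rw [Finset.disjoint_left]
    simp only [Finset.mem_image, Finset.mem_range, Finset.mem_Ico]
    rintro _ ⟨y, hy, rfl⟩ ⟨x, hx, e⟩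
    have := congrArg Prod.fst e
    simp at this
    omega
  have hsub : ((Finset.range p).image fun y => (0, y)) ∪ ((Finset.Ico 1 m).image fun x => (x, 0)) ⊆
      t.toFinset := by
    intro c hc
    simp only [Finset.mem_union, Finset.mem_image, Finset.mem_range, Finset.mem_Ico] at hc
    rw [List.mem_toFinset]
    rcases hc with ⟨y, hy, rfl⟩ | ⟨x, hx, rfl⟩
    · exact h1 y hy
    · exact h2 x hx.2
  have := (Finset.card_le_card hsub).trans (List.toFinset_card_le t)
  rw [Finset.card_union_of_disjoint hd,
    Finset.card_image_of_injective _ (fun _ _ e => congrArg Prod.snd e),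
    Finset.card_image_of_injective _ (fun _ _ e => congrArg Prod.fst e), Finset.card_range,
    Nat.card_Ico] at this
  omega

theorem cell_lt_iff {a b : ℕ × ℕ} : a < b ↔ a.1 ≤ b.1 ∧ a.2 ≤ b.2 ∧ (a.1 < b.1 ∨ a.2 < b.2) := by
  rw [Prod.lt_iff]; omega

theorem IsAddable.hook_le (ha : IsAddable a t) (hb : IsAddable b t) : a.2 + b.1 ≤ t.length + 1 :=
  hook_le_length (fun y hy => ha.2 _ (cell_lt_iff.2 (by simp; omega)))
    (fun x hx => hb.2 _ (cell_lt_iff.2 (by simp; omega)))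

/-- Distinct addable cells are incomparable, so one lies strictly above and strictly to the right of
the other; this gives the gap 2. The upper bound is a hook inside the diagram. -/
theorem IsAddable.content_sub (ha : IsAddable a t) (hb : IsAddable b t) (hab : a ≠ b) :
    2 ≤ |cellContent a - cellContent b| ∧ |cellContent a - cellContent b| ≤ t.length + 1 := by
  have h1 : ¬ a < b := fun h => ha.1 (hb.2 a h)
  have h2 : ¬ b < a := fun h => hb.1 (ha.2 b h)
  have h3 : ¬ (a.1 = b.1 ∧ a.2 = b.2) := fun h => hab (Prod.ext h.1 h.2)
  rw [cell_lt_iff] at h1 h2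
  have h4 := ha.hook_le hb
  have h5 := hb.hook_le ha
  unfold cellContent
  rw [le_abs, abs_le]
  omega

theorem IsAddable.content_le (hb : IsAddable b t) : |cellContent b| ≤ t.length := by
  have h := hb.hook_le hb
  unfold cellContent
  rw [abs_le]
  have h1 : b.2 ≤ t.length := by
    by_contra hlt
    have : b.2 + 1 ≤ t.length + 1 := by
      rcases Nat.eq_zero_or_pos b.1 with h0 | h0
      · have := hook_le_length (t := t) (p := b.2) (m := 1)
          (fun y hy => hb.2 _ (cell_lt_iff.2 (by simp; omega)))
          (fun x hx => hb.2 _ (cell_lt_iff.2 (by simp; omega)))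
        omega
      · omega
    omega
  have h2 : b.1 ≤ t.length := by
    by_contra hlt
    have : b.1 + 1 ≤ t.length + 1 := by
      rcases Nat.eq_zero_or_pos b.2 with h0 | h0
      · have := hook_le_length (t := t) (p := 1) (m := b.1)
          (fun y hy => hb.2 _ (cell_lt_iff.2 (by simp; omega)))
          (fun x hx => hb.2 _ (cell_lt_iff.2 (by simp; omega)))
        omega
      · omega
    omega
  omega

/-- The cell following `b` in its row. -/
def rightCell (b : ℕ × ℕ) : ℕ × ℕ := (b.1, b.2 + 1)

/-- The cell following `b` in its column. -/
def belowCell (b : ℕ × ℕ) : ℕ × ℕ := (b.1 + 1, b.2)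

theorem cellContent_rightCell (b : ℕ × ℕ) : cellContent (rightCell b) = cellContent b + 1 := by
  simp [cellContent, rightCell]; ring

theorem cellContent_belowCell (b : ℕ × ℕ) : cellContent (belowCell b) = cellContent b - 1 := by
  simp [cellContent, belowCell]; ring

/-- A cell which may be added after `b` but not before is a neighbour of `b`. -/
theorem IsAddable.eq_neighbour (ht : IsTableau (b :: t)) (hc : IsAddable c (b :: t))
    (hn : ¬ IsAddable c t) : c = rightCell b ∨ c = belowCell b := by
  have hct : c ∉ t := fun h => hc.1 (List.mem_cons_of_mem _ h)
  have hbc : b < c := by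
    by_contra h
    refine hn ⟨hct, fun d hd => ?_⟩
    rcases List.mem_cons.1 (hc.2 d hd) with rfl | h'
    · exact absurd hd h
    · exact h'
  have key : ∀ d, b < d → ¬ d < c := fun d h1 h2 => by
    rcases List.mem_cons.1 (hc.2 d h2) with rfl | h'
    · exact h1.false
    · exact ht.1.1 (ht.2.mem_of_le h' h1.le)
  have k1 := key (rightCell b) (cell_lt_iff.2 (by simp [rightCell]))
  have k2 := key (belowCell b) (cell_lt_iff.2 (by simp [belowCell]))
  rw [cell_lt_iff] at hbc k1 k2
  simp only [rightCell, belowCell] at *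
  rw [Prod.ext_iff, Prod.ext_iff]
  simp only
  omega

theorem IsAddable.cons (hc : IsAddable c t) (hcb : c ≠ b) : IsAddable c (b :: t) :=
  ⟨by simpa [hcb] using hc.1, fun d hd => List.mem_cons_of_mem _ (hc.2 d hd)⟩

/-- The content of the last cell of a tableau differs from those of all addable cells. -/
theorem IsAddable.content_ne_head (ht : IsTableau (b :: t)) (hc : IsAddable c (b :: t)) :
    cellContent c ≠ cellContent b ∧ |cellContent c - cellContent b| ≤ t.length + 1 := by
  by_cases h : IsAddable c t
  · have hne : c ≠ b := fun e => hc.1 (by simp [e])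
    have := h.content_sub ht.1 hne
    refine ⟨fun e => ?_, this.2⟩
    rw [e, sub_self, abs_zero] at this
    omega
  · rcases hc.eq_neighbour ht h with rfl | rfl
    · rw [cellContent_rightCell]; refine ⟨by omega, ?_⟩; rw [abs_le]; omega
    · rw [cellContent_belowCell]; refine ⟨by omega, ?_⟩; rw [abs_le]; omega

open Classical in
/-- The cells which may be added to `t`. -/
noncomputable def addables (t : List (ℕ × ℕ)) : Finset (ℕ × ℕ) :=
  (Finset.range (t.length + 2) ×ˢ Finset.range (t.length + 2)).filter fun b => IsAddable b t

theorem mem_addables : b ∈ addables t ↔ IsAddable b t := by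
  simp only [addables, Finset.mem_filter, Finset.mem_product, Finset.mem_range]
  refine ⟨fun h => h.2, fun h => ⟨?_, h⟩⟩
  have := h.hook_le h
  omega

theorem addables_nonempty (t : List (ℕ × ℕ)) : (addables t).Nonempty := by
  classical
  have hex : ∃ y, (0, y) ∉ t := by
    by_contra h
    push Not at h
    have := hook_le_length (t := t) (p := t.length + 2) (m := 0) (fun y _ => h y) (by simp)
    omega
  refine ⟨(0, Nat.find hex), mem_addables.2 ⟨Nat.find_spec hex, fun c hc => ?_⟩⟩
  rw [cell_lt_iff] at hc
  obtain ⟨x, y⟩ := c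
  simp only at hc
  obtain rfl : x = 0 := by omega
  exact not_not.1 (Nat.find_min hex (show y < _ by omega))

theorem IsGeneric.injOn_content {n : ℕ} {q : ℂ} (h : IsGeneric n q) (ht : t.length < n) :
    Set.InjOn (fun b => qInt q (cellContent b)) (addables t : Set (ℕ × ℕ)) := by
  intro a ha b hb hab
  by_contra hne
  have := (mem_addables.1 ha).content_sub (mem_addables.1 hb) hne
  refine h.qInt_ne (fun e => ?_) (this.2.trans (by exact_mod_cast ht)) hab
  rw [e, sub_self, abs_zero] at this
  omega

end Tableaux

/-! ### Weight spaces of the Jucys-Murphy elements and intertwiners -/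

section Weights
variable {n : ℕ} {q : ℂ} {t s r u : List (ℕ × ℕ)} {a b c : ℕ × ℕ} {x y : Hecke n q}

/-- The elements of `H_n(q)` on which each `J_m(q)`, `m ≤ |t|`, acts from the right by `[c]_q` with `c`
the content of the `m`-th cell of `t`. -/
noncomputable def weightSpace (n : ℕ) (q : ℂ) : List (ℕ × ℕ) → Submodule ℂ (Hecke n q)
  | [] => ⊤
  | b :: t => weightSpace n q t ⊓ LinearMap.eqLocus
      (LinearMap.mulRight ℂ (jucysMurphy n q (t.length + 1))) (qInt q (cellContent b) • LinearMap.id)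

theorem mem_weightSpace_cons : x ∈ weightSpace n q (b :: t) ↔ x ∈ weightSpace n q t ∧
    x * jucysMurphy n q (t.length + 1) = qInt q (cellContent b) • x := Iff.rfl

theorem weightSpace_append (h : x ∈ weightSpace n q (u ++ t)) : x ∈ weightSpace n q t := by
  induction u with
  | nil => exact h
  | cons a u ih => exact ih h.1

theorem mul_mem_weightSpace (y : Hecke n q) (h : x ∈ weightSpace n q t) : y * x ∈ weightSpace n q t := by
  induction t with
  | nil => trivial
  | cons a t ih =>
    rw [mem_weightSpace_cons] at h ⊢
    exact ⟨ih h.1, by rw [mul_assoc, h.2, mul_smul_comm]⟩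

theorem mul_mem_weightSpace_of_commute (h : x ∈ weightSpace n q t)
    (hy : ∀ m, 1 ≤ m → m ≤ t.length → Commute y (jucysMurphy n q m)) : x * y ∈ weightSpace n q t := by
  induction t with
  | nil => trivial
  | cons a t ih =>
    rw [mem_weightSpace_cons] at h ⊢
    refine ⟨ih h.1 fun m h1 h2 => hy m h1 (by simp; omega), ?_⟩
    rw [mul_assoc, (hy _ (by omega) (by simp)).eq, ← mul_assoc, h.2, smul_mul_assoc]

theorem mul_aeval_mem_weightSpace (hq : q ≠ 0) (hn : t.length < n) (h : x ∈ weightSpace n q t)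
    (P : Polynomial ℂ) : x * Polynomial.aeval (jucysMurphy n q (t.length + 1)) P ∈ weightSpace n q t :=
  mul_mem_weightSpace_of_commute h fun m _ h2 => by
    have hc : Commute (jucysMurphy n q m) (jucysMurphy n q (t.length + 1)) :=
      jucysMurphy_commute_of_lt hq (by omega) (by omega)
    induction P using Polynomial.induction_on with
    | C a => rw [Polynomial.aeval_C]; exact Algebra.commute_algebraMap_left _ _
    | add P Q hP hQ => rw [map_add]; exact hP.add_left hQ
    | monomial k a _ =>
      rw [map_mul, Polynomial.aeval_C, map_pow, Polynomial.aeval_X]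
      exact (Algebra.commute_algebraMap_left _ _).mul_left (hc.symm.pow_left _)

theorem mul_heckeT_mem_weightSpace (hq : q ≠ 0) {k : ℕ} (hk : t.length < k)
    (h : x ∈ weightSpace n q t) : x * heckeT n q k ∈ weightSpace n q t :=
  mul_mem_weightSpace_of_commute h fun _ _ h2 => heckeT_commute_jucysMurphy_of_le hq (by omega)

theorem mul_aeval_of_mul_eq {A : Type*} [Ring A] [Algebra ℂ A] {x J : A} {l : ℂ} (h : x * J = l • x)
    (P : Polynomial ℂ) : x * Polynomial.aeval J P = P.eval l • x := by
  induction P using Polynomial.induction_on with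
  | C a => rw [Polynomial.aeval_C, Polynomial.eval_C, ← Algebra.commutes, ← Algebra.smul_def]
  | add P Q hP hQ => rw [map_add, mul_add, hP, hQ, Polynomial.eval_add, add_smul]
  | monomial k a ih =>
    rw [pow_succ, ← mul_assoc, map_mul, ← mul_assoc, ih, Polynomial.aeval_X, smul_mul_assoc, h,
      smul_smul, Polynomial.eval_mul_X]

/-- Exchange of two consecutive entries: the intertwining operator. -/
theorem swap_mem_weightSpace (hq : q ≠ 0) (hn : (u ++ b :: a :: r).length ≤ n)
    (hx : x ∈ weightSpace n q (u ++ b :: a :: r)) {γ : ℂ}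
    (hγ : γ * (qInt q (cellContent b) - qInt q (cellContent a)) =
      (q - 1) * qInt q (cellContent b) + 1) :
    x * heckeT n q (r.length + 1) - γ • x ∈ weightSpace n q (u ++ a :: b :: r) := by
  induction u with
  | nil =>
    simp only [List.nil_append] at hn hx ⊢
    rw [mem_weightSpace_cons, mem_weightSpace_cons] at hx ⊢
    simp only [List.length_cons] at hx hn ⊢
    obtain ⟨⟨h1, h2⟩, h3⟩ := hx
    have hk : 1 ≤ r.length + 1 ∧ r.length + 1 < n := by omega
    have e1 := heckeT_mul_jucysMurphy_succ hq hk
    have e2 := jucysMurphy_succ_mul hq hk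
    refine ⟨⟨sub_mem (mul_heckeT_mem_weightSpace hq (by omega) h1)
      (Submodule.smul_mem _ _ h1), ?_⟩, ?_⟩
    · have e2' : heckeT n q (r.length + 1) * jucysMurphy n q (r.length + 1) =
          jucysMurphy n q (r.length + 1 + 1) * heckeT n q (r.length + 1) -
            (q - 1) • jucysMurphy n q (r.length + 1 + 1) - 1 := by rw [e2]; abel
      rw [sub_mul, mul_assoc, e2', smul_mul_assoc, h2, mul_sub, mul_sub, mul_one, ← mul_assoc, h3,
        mul_smul_comm, h3, smul_mul_assoc]
      -- The mixed term of the affine Hecke relation is a multiple of x, and γ is the value that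
      -- makes it cancel.
      have := congrArg (· • x) hγ
      linear_combination (norm := module) this
    · rw [sub_mul, mul_assoc, e1, smul_mul_assoc, h3, mul_add, mul_add, mul_one, ← mul_assoc, h2,
        mul_smul_comm, h3, smul_mul_assoc]
      have := congrArg (· • x) hγ
      linear_combination (norm := module) -this
  | cons c u ih =>
    simp only [List.cons_append, List.length_cons] at hn hx ⊢
    rw [mem_weightSpace_cons] at hx ⊢
    refine ⟨ih (by omega) hx.1, ?_⟩
    have hl : (u ++ a :: b :: r).length = (u ++ b :: a :: r).length := by simp
    -- Entries above the exchanged pair keep their weights because their Jucys-Murphy elements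
    -- commute with this generator.
    have hc : Commute (heckeT n q (r.length + 1)) (jucysMurphy n q ((u ++ b :: a :: r).length + 1)) := by
      simp only [List.length_append, List.length_cons] at hn ⊢
      exact heckeT_commute_jucysMurphy_of_lt hq (by omega) (by omega)
    rw [hl, sub_mul, mul_assoc, hc.eq, ← mul_assoc, hx.2, smul_mul_assoc, smul_mul_assoc, hx.2,
      smul_sub, smul_comm γ]

/-- The coefficient in the exchange of the entries of the cells `a` and `b`. -/
noncomputable def swapCoeff (q : ℂ) (a b : ℕ × ℕ) : ℂ :=
  ((q - 1) * qInt q (cellContent b) + 1) / (qInt q (cellContent b) - qInt q (cellContent a))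

theorem qInt_content_ne_of_addable (h : IsGeneric n q) (hr : r.length < n) (ha : IsAddable a r)
    (hb : IsAddable b r) (hab : a ≠ b) : qInt q (cellContent b) ≠ qInt q (cellContent a) := fun e =>
  hab (h.injOn_content hr (mem_addables.2 ha) (mem_addables.2 hb) e.symm)

theorem swapCoeff_spec (h : IsGeneric n q) (hr : r.length < n) (ha : IsAddable a r)
    (hb : IsAddable b r) (hab : a ≠ b) :
    swapCoeff q a b * (qInt q (cellContent b) - qInt q (cellContent a)) =
      (q - 1) * qInt q (cellContent b) + 1 :=
  div_mul_cancel₀ _ (sub_ne_zero.2 (qInt_content_ne_of_addable h hr ha hb hab))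

/-- The values q and -1 would mean [c(b)] = [c(a)+1] and [c(b)+1] = [c(a)], that is, adjacent
contents; addable cells have contents at least 2 apart. These are the eigenvalues allowed by the
quadratic relation, so the intertwiner is then invertible. -/
theorem swapCoeff_ne (h : IsGeneric n q) (hr : r.length + 1 < n) (ha : IsAddable a r)
    (hb : IsAddable b r) (hab : a ≠ b) : swapCoeff q a b ≠ q ∧ swapCoeff q a b ≠ -1 := by
  have hs := swapCoeff_spec h (by omega) ha hb hab
  have hc := ha.content_sub hb hab
  have hl : (r.length : ℤ) + 2 ≤ n := by omega
  constructor
  · intro e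
    rw [e] at hs
    refine h.qInt_ne (a := cellContent b) (b := cellContent a + 1) (fun e' => ?_) ?_ ?_
    · rw [e'] at hc
      rw [le_abs] at hc; omega
    · rw [le_abs, abs_le] at hc; rw [abs_le]; omega
    · rw [qInt_add_one h.1]; linear_combination hs
  · intro e
    rw [e] at hs
    refine h.qInt_ne (a := cellContent b + 1) (b := cellContent a) (fun e' => ?_) ?_ ?_
    · rw [← e'] at hc
      rw [le_abs] at hc; omega
    · rw [le_abs, abs_le] at hc; rw [abs_le]; omega
    · rw [qInt_add_one h.1]; linear_combination -hs

/-- The exchange of entries is invertible. -/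
theorem swap_inverse (h : IsGeneric n q) (hr : r.length + 1 < n) (ha : IsAddable a r)
    (hb : IsAddable b r) (hab : a ≠ b) : ∃ κ δ : ℂ, ∀ x : Hecke n q,
      (x * heckeT n q (r.length + 1) - swapCoeff q a b • x) *
        (κ • heckeT n q (r.length + 1) + δ • 1) = x := by
  obtain ⟨h1, h2⟩ := swapCoeff_ne h hr ha hb hab
  generalize swapCoeff q a b = γ at *
  have hT := heckeT_quadratic (n := n) (q := q) (i := r.length + 1) (by omega)
  have hκ : (q - γ) * (γ + 1) ≠ 0 :=
    mul_ne_zero (sub_ne_zero.2 h1.symm) (fun e => h2 (by linear_combination e))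
  -- The quadratic relation gives (T - γ)(T + γ + 1 - q) = (q - γ)(γ + 1).
  refine ⟨((q - γ) * (γ + 1))⁻¹, ((q - γ) * (γ + 1))⁻¹ * (γ + 1 - q), fun x => ?_⟩
  have hxT : x * heckeT n q (r.length + 1) * heckeT n q (r.length + 1) =
      (q - 1) • (x * heckeT n q (r.length + 1)) + q • x := by
    rw [mul_assoc, hT, mul_add, mul_smul_comm, mul_smul_comm, mul_one]
  generalize heckeT n q (r.length + 1) = T at *
  have : ((q - γ) * (γ + 1)) • ((x * T - γ • x) * (((q - γ) * (γ + 1))⁻¹ • T +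
      (((q - γ) * (γ + 1))⁻¹ * (γ + 1 - q)) • 1)) = ((q - γ) * (γ + 1)) • x := by
    rw [mul_smul (_ : ℂ)⁻¹, ← smul_add, mul_smul_comm, smul_smul, mul_inv_cancel₀ hκ, one_smul, mul_add,
      sub_mul, hxT, mul_smul_comm, mul_one, smul_mul_assoc]
    module
  exact (smul_right_injective _ hκ) this

/-- Right multiplication carries the weight space of `t` isomorphically into that of `s`. -/
def IsLinked (n : ℕ) (q : ℂ) (k : ℕ) (t s : List (ℕ × ℕ)) : Prop :=
  ∃ h ∈ parabolic n q k, ∃ h' ∈ parabolic n q k,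
    ∀ x ∈ weightSpace n q t, x * h ∈ weightSpace n q s ∧ x * h * h' = x

theorem IsLinked.refl (k : ℕ) (t : List (ℕ × ℕ)) : IsLinked n q k t t :=
  ⟨1, one_mem _, 1, one_mem _, fun x hx => by simpa using hx⟩

theorem IsLinked.trans {k : ℕ} (h1 : IsLinked n q k t s) (h2 : IsLinked n q k s r) :
    IsLinked n q k t r := by
  obtain ⟨g, hg, g', hg', H⟩ := h1
  obtain ⟨f, hf, f', hf', F⟩ := h2
  refine ⟨g * f, mul_mem hg hf, f' * g', mul_mem hf' hg', fun x hx => ?_⟩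
  obtain ⟨h1, h2⟩ := H x hx
  obtain ⟨h3, h4⟩ := F _ h1
  refine ⟨by rwa [← mul_assoc], ?_⟩
  rw [← mul_assoc, ← mul_assoc, h4, h2]

/-- The link lies in the parabolic subalgebra of the smaller entries, hence commutes with the
Jucys-Murphy element of the new one. This is why links record the subalgebra they come from. -/
theorem IsLinked.cons (hq : q ≠ 0) (ht : t.length < n) (hts : t.length = s.length)
    (h : IsLinked n q t.length t s) : IsLinked n q (t.length + 1) (b :: t) (b :: s) := by
  obtain ⟨g, hg, g', hg', H⟩ := h
  refine ⟨g, parabolic_mono (by omega) hg, g', parabolic_mono (by omega) hg', fun x hx => ?_⟩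
  rw [mem_weightSpace_cons] at hx
  refine ⟨?_, (H x hx.1).2⟩
  rw [mem_weightSpace_cons]
  refine ⟨(H x hx.1).1, ?_⟩
  have hc := commute_jucysMurphy_of_mem_parabolic hq ht.le (show t.length < t.length + 1 by omega) hg
  rw [← hts, mul_assoc, hc.eq, ← mul_assoc, hx.2, smul_mul_assoc]

theorem isLinked_swap (h : IsGeneric n q) (hr : r.length + 1 < n) (ha : IsAddable a r)
    (hb : IsAddable b r) (hab : a ≠ b) : IsLinked n q (r.length + 2) (b :: a :: r) (a :: b :: r) := by
  obtain ⟨κ, δ, H⟩ := swap_inverse h hr ha hb hab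
  have hT : heckeT n q (r.length + 1) ∈ parabolic n q (r.length + 2) :=
    heckeT_mem_parabolic (by omega) (by omega)
  refine ⟨heckeT n q (r.length + 1) - swapCoeff q a b • 1, sub_mem hT (Subalgebra.smul_mem _ (one_mem _) _),
    κ • heckeT n q (r.length + 1) + δ • 1, add_mem (Subalgebra.smul_mem _ hT _)
      (Subalgebra.smul_mem _ (one_mem _) _), fun x hx => ?_⟩
  have e : x * (heckeT n q (r.length + 1) - swapCoeff q a b • 1) =
      x * heckeT n q (r.length + 1) - swapCoeff q a b • x := by
    rw [mul_sub, mul_smul_comm, mul_one]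
  rw [e]
  exact ⟨swap_mem_weightSpace (u := []) h.1 (by simpa using hr) hx
    (swapCoeff_spec h (by omega) ha hb hab), H x⟩

/-- Tableaux of the same shape are linked. -/
theorem isLinked_of_perm (h : IsGeneric n q) (ht : IsTableau t) (hs : IsTableau s) (hts : t.Perm s)
    (hn : t.length ≤ n) : IsLinked n q t.length t s := by
  induction hk : t.length generalizing t s with
  | zero =>
    obtain rfl : t = [] := List.length_eq_zero_iff.1 hk
    obtain rfl := hts.nil_eq
    exact IsLinked.refl _ _
  | succ k ih =>
    cases t with
    | nil => simp at hk
    | cons b t =>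
    cases s with
    | nil => simpa using hts.length_eq
    | cons b' s =>
    have hk' : t.length = k := by simpa using hk
    have hlt : t.length < n := by simpa using hn
    subst hk'
    by_cases hbb : b = b'
    · subst hbb
      have hp := (List.perm_cons b).1 hts
      exact (ih ht.2 hs.2 hp hlt.le rfl).cons h.1 hlt hp.length_eq
    -- The last cell b' of s is a corner of the common shape. It can be moved to the next to last
    -- place of the first tableau by induction, exchanged there with b by one intertwiner, and the
    -- rest is again induction.
    · have hmax : ∀ a ∈ b :: t, b' ≤ a → a = b' := fun a ha hle => by
        rcases List.mem_cons.1 (hts.mem_iff.1 ha) with rfl | ha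
        · rfl
        · exact absurd (hs.2.mem_of_le ha hle) hs.1.1
      have hb't : b' ∈ t := by
        have : b' ∈ b :: t := hts.mem_iff.2 (by simp)
        exact (List.mem_cons.1 this).resolve_left (Ne.symm hbb)
      have hmax' : ∀ a ∈ t, b' ≤ a → a = b' := fun a ha => hmax a (List.mem_cons_of_mem _ ha)
      have hp1 : t.Perm (b' :: t.erase b') := List.perm_cons_erase hb't
      have hr := ht.2.cons_erase hb't hmax'
      generalize t.erase b' = r at *
      have hbr : IsAddable b (b' :: r) := ht.1.perm hp1
      have hnlt : ¬ b' < b := fun hlt => hbb (hmax b (by simp) hlt.le)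
      have hbr' : IsAddable b r := ⟨fun hm => hbr.1 (List.mem_cons_of_mem _ hm), fun c hc => by
        rcases List.mem_cons.1 (hbr.2 c hc) with rfl | hm
        · exact absurd hc hnlt
        · exact hm⟩
      have hlen : t.length = r.length + 1 := by simpa using hp1.length_eq
      have hb'r : IsAddable b' (b :: r) := hr.1.cons (Ne.symm hbb)
      have hp2 : (b :: r).Perm s := by
        have : (b' :: b :: r).Perm (b' :: s) :=
          (List.Perm.swap _ _ _).trans ((hp1.symm.cons b).trans hts)
        exact (List.perm_cons b').1 this
      have l1 : IsLinked n q (t.length + 1) (b :: t) (b :: b' :: r) :=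
        (ih ht.2 hr hp1 hlt.le rfl).cons h.1 hlt hp1.length_eq
      have l2 : IsLinked n q (t.length + 1) (b :: b' :: r) (b' :: b :: r) := by
        rw [hlen]
        exact isLinked_swap h (by omega) hr.1 hbr' (Ne.symm hbb)
      have l3 : IsLinked n q (t.length + 1) (b' :: b :: r) (b' :: s) := by
        have hl : (b :: r).length = t.length := by simp [hlen]
        have := (ih (t := b :: r) (s := s) ⟨hbr', hr.2⟩ hs.2 hp2 (by omega) hl)
        rw [← hl] at this ⊢
        exact this.cons h.1 (by omega) hp2.length_eq
      exact (l1.trans l2).trans l3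

end Weights

end QShuffle

namespace QShuffle

open Polynomial

/-! ### The spectrum of the next Jucys-Murphy element on a weight space -/

section Completeness
variable {n : ℕ} {q : ℂ} {t s r u : List (ℕ × ℕ)} {a b c : ℕ × ℕ} {x y : Hecke n q}

/-- The monic polynomial whose roots are the `q`-contents of the cells which may be added to `t`. -/
noncomputable def addablePoly (q : ℂ) (t : List (ℕ × ℕ)) : ℂ[X] :=
  Lagrange.nodal (addables t) fun b => qInt q (cellContent b)

/-- On the weight spaces of tableaux of size `k`, the eigenvalues of `J_{k+1}(q)` are the `q`-contents of
the addable cells, and `J_{k+1}(q)` is diagonalizable there. -/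
def IsComplete (n : ℕ) (q : ℂ) (k : ℕ) : Prop :=
  ∀ t, IsTableau t → t.length = k → ∀ x ∈ weightSpace n q t,
    x * aeval (jucysMurphy n q (k + 1)) (addablePoly q t) = 0

theorem IsComplete.eq_zero (hC : IsComplete n q t.length) (ht : IsTableau t)
    (hx : x ∈ weightSpace n q t) {l : ℂ} (hl : x * jucysMurphy n q (t.length + 1) = l • x)
    (hne : ∀ a, IsAddable a t → l ≠ qInt q (cellContent a)) : x = 0 := by
  have := hC t ht rfl x hx
  rw [mul_aeval_of_mul_eq hl] at this
  refine (smul_eq_zero.1 this).resolve_left ?_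
  rw [addablePoly, Lagrange.eval_nodal]
  exact Finset.prod_ne_zero_iff.2 fun a ha => sub_ne_zero.2 (hne a (mem_addables.1 ha))

/-- The intertwined vector would be a weight vector in which b directly follows r. The content of b
is off by 1 from that of the addable cell a, while the other addable cells of r are at least 2 away
from a, so completeness forces the vector to be zero. -/
theorem heckeT_eq_smul_of_neighbour (h : IsGeneric n q) (hC : IsComplete n q r.length)
    (hr : IsTableau (a :: r)) (hn : (u ++ b :: a :: r).length ≤ n) (hb : b = rightCell a ∨ b = belowCell a)
    (hx : x ∈ weightSpace n q (u ++ b :: a :: r)) {γ : ℂ}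
    (hγ : γ * (qInt q (cellContent b) - qInt q (cellContent a)) =
      (q - 1) * qInt q (cellContent b) + 1) : x * heckeT n q (r.length + 1) = γ • x := by
  have hy := weightSpace_append (u := u ++ [a]) (t := b :: r) (by
    simpa using swap_mem_weightSpace h.1 hn hx hγ)
  rw [mem_weightSpace_cons] at hy
  simp only [List.length_append, List.length_cons] at hn
  refine sub_eq_zero.1 (hC.eq_zero hr.2 hy.1 hy.2 fun c hc => ?_)
  have hd : |cellContent b - cellContent a| = 1 := by
    rcases hb with rfl | rfl
    · rw [cellContent_rightCell]; simp
    · rw [cellContent_belowCell]; simp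
  by_cases hca : c = a
  · subst hca
    exact h.qInt_ne (fun e => by simp [e] at hd) (by rw [hd]; omega)
  · have := hc.content_sub hr.1 hca
    generalize cellContent a = x at *
    generalize cellContent b = y at *
    generalize cellContent c = z at *
    rw [abs_eq (by norm_num)] at hd
    rw [le_abs, abs_le] at this
    refine h.qInt_ne (fun e => by omega) ?_
    rw [abs_le]
    omega

theorem swapCoeff_right (hq : q ≠ 0) (a : ℕ × ℕ) :
    q * (qInt q (cellContent (rightCell a)) - qInt q (cellContent a)) =
      (q - 1) * qInt q (cellContent (rightCell a)) + 1 := by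
  rw [cellContent_rightCell, qInt_add_one hq]; ring

theorem qInt_belowCell (hq : q ≠ 0) (a : ℕ × ℕ) :
    qInt q (cellContent a) = q * qInt q (cellContent (belowCell a)) + 1 := by
  rw [cellContent_belowCell, ← qInt_add_one hq, sub_add_cancel]

theorem swapCoeff_below (hq : q ≠ 0) (a : ℕ × ℕ) :
    -1 * (qInt q (cellContent (belowCell a)) - qInt q (cellContent a)) =
      (q - 1) * qInt q (cellContent (belowCell a)) + 1 := by
  rw [qInt_belowCell hq a]; ring

/-- The obstruction can only be a missing cell diagonally above and to the right of b; then the cell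
directly above b is a corner of the smaller diagram. The companion below exchanges rows and columns.
-/
theorem exists_corner_of_not_addable_right (hr : IsTableau (b :: r))
    (hn : ¬ IsAddable (rightCell b) (b :: r)) :
    ∃ d ∈ r, b = belowCell d ∧ ∀ a ∈ r, d ≤ a → a = d := by
  have hlow : ∀ c, c ≤ b → c ∈ b :: r := fun c hc => hr.mem_of_le (by simp) hc
  obtain ⟨i, j⟩ := b
  have hc : (i, j + 1) ∉ (i, j) :: r := fun hm => by
    rcases List.mem_cons.1 hm with e | hm
    · simp at e
    · exact hr.1.1 (hr.2.mem_of_le hm ⟨le_rfl, by simp⟩)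
  obtain ⟨⟨x, y⟩, hd, hdt⟩ : ∃ d, d < (i, j + 1) ∧ d ∉ (i, j) :: r := by
    by_contra hcon
    push Not at hcon
    exact hn ⟨hc, hcon⟩
  rw [cell_lt_iff] at hd
  simp only at hd
  have hy : y = j + 1 := by
    by_contra hne
    exact hdt (hlow _ ⟨hd.1, by simp; omega⟩)
  subst hy
  obtain ⟨i, rfl⟩ : ∃ k, i = k + 1 := Nat.exists_eq_succ_of_ne_zero (by omega)
  refine ⟨(i, j), hr.1.2 _ (cell_lt_iff.2 (by simp)), rfl, ?_⟩
  rintro ⟨x', y'⟩ ha ⟨h1, h2⟩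
  simp only at h1 h2
  have h3 : ¬ j + 1 ≤ y' := fun h => hdt (List.mem_cons_of_mem _
    (hr.2.mem_of_le ha ⟨by simp; omega, h⟩))
  have h4 : ¬ i + 1 ≤ x' := fun h => hr.1.1 (hr.2.mem_of_le ha ⟨h, h2⟩)
  rw [Prod.mk.injEq]
  omega

theorem exists_corner_of_not_addable_below (hr : IsTableau (b :: r))
    (hn : ¬ IsAddable (belowCell b) (b :: r)) :
    ∃ d ∈ r, b = rightCell d ∧ ∀ a ∈ r, d ≤ a → a = d := by
  have hlow : ∀ c, c ≤ b → c ∈ b :: r := fun c hc => hr.mem_of_le (by simp) hc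
  obtain ⟨i, j⟩ := b
  have hc : (i + 1, j) ∉ (i, j) :: r := fun hm => by
    rcases List.mem_cons.1 hm with e | hm
    · simp at e
    · exact hr.1.1 (hr.2.mem_of_le hm ⟨by simp, le_rfl⟩)
  obtain ⟨⟨x, y⟩, hd, hdt⟩ : ∃ d, d < (i + 1, j) ∧ d ∉ (i, j) :: r := by
    by_contra hcon
    push Not at hcon
    exact hn ⟨hc, hcon⟩
  rw [cell_lt_iff] at hd
  simp only at hd
  have hx : x = i + 1 := by
    by_contra hne
    exact hdt (hlow _ ⟨by simp; omega, hd.2.1⟩)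
  subst hx
  obtain ⟨j, rfl⟩ : ∃ k, j = k + 1 := Nat.exists_eq_succ_of_ne_zero (by omega)
  refine ⟨(i, j), hr.1.2 _ (cell_lt_iff.2 (by simp)), rfl, ?_⟩
  rintro ⟨x', y'⟩ ha ⟨h1, h2⟩
  simp only at h1 h2
  have h3 : ¬ i + 1 ≤ x' := fun h => hdt (List.mem_cons_of_mem _
    (hr.2.mem_of_le ha ⟨h, by simp; omega⟩))
  have h4 : ¬ j + 1 ≤ y' := fun h => hr.1.1 (hr.2.mem_of_le ha ⟨h1, h⟩)
  rw [Prod.mk.injEq]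
  omega

/-- There are no weight vectors whose contents end in `d, d ± 1, d`. -/
theorem eq_zero_of_content_eq (h : IsGeneric n q) (hC : ∀ m, m < r.length + 2 → IsComplete n q m)
    (hr : IsTableau (b :: a :: r)) (hn : r.length + 3 ≤ n)
    (hca : cellContent c = cellContent a) {γ₁ γ₂ : ℂ} (h12 : γ₁ ≠ γ₂) (h1 : γ₁ ≠ 0) (h2 : γ₂ ≠ 0)
    (hb : b = rightCell a ∨ b = belowCell a)
    (hγ₁ : γ₁ * (qInt q (cellContent b) - qInt q (cellContent a)) =
      (q - 1) * qInt q (cellContent b) + 1)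
    (hγ₂ : γ₂ * (qInt q (cellContent c) - qInt q (cellContent b)) =
      (q - 1) * qInt q (cellContent c) + 1)
    (hx : x ∈ weightSpace n q (c :: b :: a :: r)) : x = 0 := by
  have e1 : x * heckeT n q (r.length + 1) = γ₁ • x :=
    heckeT_eq_smul_of_neighbour (u := []) h (hC _ (by omega)) hr.2 (by simp; omega) hb
      (weightSpace_append (u := [c]) hx) hγ₁
  have hy := weightSpace_append (u := [b]) (t := c :: a :: r) (by
    simpa using swap_mem_weightSpace (u := []) h.1 (by simp; omega) hx hγ₂)
  rw [mem_weightSpace_cons] at hy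
  -- The intertwined vector would carry the content of a twice in a row, which no addable cell of a
  -- :: r can do.
  have e2 : x * heckeT n q (r.length + 1 + 1) = γ₂ • x := by
    refine sub_eq_zero.1 ((hC (r.length + 1) (by omega)).eq_zero (t := a :: r) hr.2 hy.1 hy.2
      fun d hd => ?_)
    have := IsAddable.content_ne_head hr.2 hd
    rw [hca]
    refine (h.qInt_ne this.1 (this.2.trans ?_)).symm
    push_cast [← Nat.cast_le (α := ℤ)] at hn
    linarith
  -- Two consecutive generators act on x by scalars, and the braid relation forces the scalars to
  -- agree unless x = 0.
  have hbr := congrArg (x * ·) (heckeT_braid (n := n) (q := q) (r.length + 1))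
  simp only [← mul_assoc, e1, e2, smul_mul_assoc, smul_smul] at hbr
  have : (γ₁ * γ₂ * (γ₁ - γ₂)) • x = 0 := by
    linear_combination (norm := module) hbr
  exact (smul_eq_zero.1 this).resolve_left (mul_ne_zero (mul_ne_zero h1 h2) (sub_ne_zero.2 h12))

/-- When a neighbour of b is not addable, the cell d on the opposite side of b is a corner. A link
makes d the entry just before b, and the contents then end in the forbidden pattern; the two scalars
are q and -1, which differ because [2]_q ≠ 0. -/
theorem eq_zero_of_not_addable (h : IsGeneric n q) (hC : ∀ m, m < r.length + 1 → IsComplete n q m)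
    (hr : IsTableau (b :: r)) (hn : r.length + 1 < n) (hc : c = rightCell b ∨ c = belowCell b)
    (hcb : ¬ IsAddable c (b :: r)) (hx : x ∈ weightSpace n q (c :: b :: r)) : x = 0 := by
  have key : ∃ d ∈ r, (∀ a ∈ r, d ≤ a → a = d) ∧
      (c = rightCell b ∧ b = belowCell d ∨ c = belowCell b ∧ b = rightCell d) := by
    rcases hc with rfl | rfl
    · obtain ⟨d, h1, h2, h3⟩ := exists_corner_of_not_addable_right hr hcb
      exact ⟨d, h1, h3, Or.inl ⟨rfl, h2⟩⟩
    · obtain ⟨d, h1, h2, h3⟩ := exists_corner_of_not_addable_below hr hcb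
      exact ⟨d, h1, h3, Or.inr ⟨rfl, h2⟩⟩
  obtain ⟨d, hd, hmax, hcase⟩ := key
  have hp : r.Perm (d :: r.erase d) := List.perm_cons_erase hd
  have hs := hr.2.cons_erase hd hmax
  generalize r.erase d = s at *
  have hlen : r.length = s.length + 1 := by simpa using hp.length_eq
  obtain ⟨g, hg, g', hg', H⟩ := isLinked_of_perm h hr.2 hs hp (by omega)
  have h0 := (H x hx.1.1)
  have hmem : x * g ∈ weightSpace n q (c :: b :: d :: s) := by
    rw [mem_weightSpace_cons, mem_weightSpace_cons] at hx ⊢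
    obtain ⟨⟨h1, h2⟩, h3⟩ := hx
    have c1 := commute_jucysMurphy_of_mem_parabolic h.1 (by omega)
      (show r.length < r.length + 1 by omega) hg
    have c2 := commute_jucysMurphy_of_mem_parabolic h.1 (by omega)
      (show r.length < r.length + 1 + 1 by omega) hg
    simp only [List.length_cons, ← hlen] at h3 ⊢
    exact ⟨⟨h0.1, by rw [mul_assoc, c1.eq, ← mul_assoc, h2, smul_mul_assoc]⟩,
      by rw [mul_assoc, c2.eq, ← mul_assoc, h3, smul_mul_assoc]⟩
  have hbs : IsTableau (b :: d :: s) := ⟨hr.1.perm hp, hs⟩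
  have hq1 : q ≠ -1 := fun e => h.add_one_ne_zero (by omega) (by rw [e]; ring)
  have hzero : x * g = 0 := by
    rcases hcase with ⟨hcr, hbd⟩ | ⟨hcr, hbd⟩
    · exact eq_zero_of_content_eq h (fun m hm => hC m (by omega)) hbs (by omega)
        (by rw [hcr, cellContent_rightCell, hbd, cellContent_belowCell, sub_add_cancel])
        hq1.symm (by norm_num) h.1 (Or.inr hbd)
        (by rw [hbd]; exact swapCoeff_below h.1 d) (by rw [hcr]; exact swapCoeff_right h.1 b) hmem
    · exact eq_zero_of_content_eq h (fun m hm => hC m (by omega)) hbs (by omega)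
        (by rw [hcr, cellContent_belowCell, hbd, cellContent_rightCell, add_sub_cancel_right])
        hq1 h.1 (by norm_num) (Or.inl hbd)
        (by rw [hbd]; exact swapCoeff_right h.1 d) (by rw [hcr]; exact swapCoeff_below h.1 b) hmem
  rw [← h0.2, hzero, zero_mul]

/-- Passing T across J_k replaces it by J_{k+1} up to terms in J_{k+1} alone, and on x such terms
are killed by J_k - l. A polynomial in J_k thus becomes the same polynomial in J_{k+1}. -/
theorem heckeT_mul_aeval (hq : q ≠ 0) {k : ℕ} (hk : 1 ≤ k ∧ k < n) {l : ℂ}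
    (hx : x * jucysMurphy n q k = l • x) (P : ℂ[X]) :
    x * heckeT n q k * aeval (jucysMurphy n q k) P * (jucysMurphy n q k - l • 1) =
      x * aeval (jucysMurphy n q (k + 1)) P * heckeT n q k * (jucysMurphy n q k - l • 1) := by
  have hc : Commute (jucysMurphy n q k) (jucysMurphy n q (k + 1)) :=
    jucysMurphy_commute_of_lt hq (by omega) (by omega)
  have e2 := jucysMurphy_succ_mul hq hk
  have e2' : heckeT n q k * jucysMurphy n q k = jucysMurphy n q (k + 1) * heckeT n q k -
      (q - 1) • jucysMurphy n q (k + 1) - 1 := by rw [e2]; abel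
  have hx0 : x * (jucysMurphy n q k - l • 1) = 0 := by rw [mul_sub, hx, mul_smul_comm, mul_one, sub_self]
  generalize jucysMurphy n q k = J at *
  generalize jucysMurphy n q (k + 1) = K at *
  generalize heckeT n q k = T at *
  have hJ : ∀ P : ℂ[X], Commute (aeval J P) (J - l • 1) := fun P => by
    have h1 : J - l • 1 = aeval J (X - C l) := by
      rw [map_sub, aeval_X, aeval_C, Algebra.algebraMap_eq_smul_one]
    rw [h1, Commute, SemiconjBy, ← map_mul, ← map_mul, mul_comm]
  have step : ∀ x : Hecke n q, x * J = l • x →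
      x * T * J * (J - l • 1) = x * K * T * (J - l • 1) := fun x hx => by
    have hx0 : x * (J - l • 1) = 0 := by rw [mul_sub, hx, mul_smul_comm, mul_one, sub_self]
    have hK0 : x * K * (J - l • 1) = 0 := by
      have : Commute K (J - l • 1) := hc.symm.sub_right ((Commute.one_right K).smul_right l)
      rw [mul_assoc, this.eq, ← mul_assoc, hx0, zero_mul]
    rw [mul_assoc x T J, e2']
    generalize J - l • 1 = D at *
    rw [mul_sub, mul_sub, sub_mul, sub_mul, mul_one, hx0, mul_smul_comm, smul_mul_assoc, hK0, ← mul_assoc]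
    simp
  induction P using Polynomial.induction_on with
  | C a =>
    rw [aeval_C, aeval_C, mul_assoc x T, ← Algebra.commutes a T, ← mul_assoc]
  | add P Q hP hQ => simp only [map_add, mul_add, add_mul, hP, hQ]
  | monomial m a ih =>
    have hxm : x * aeval K (C a * X ^ m) * J = l • (x * aeval K (C a * X ^ m)) := by
      have : Commute J (aeval K (C a * X ^ m)) := by
        rw [map_mul, aeval_C, map_pow, aeval_X]
        exact (Algebra.commute_algebraMap_right _ _).mul_right (hc.pow_right _)
      rw [mul_assoc, ← this.eq, ← mul_assoc, hx, smul_mul_assoc]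
    rw [pow_succ, ← mul_assoc (C a), map_mul (aeval J) (C a * X ^ m), map_mul (aeval K) (C a * X ^ m),
      aeval_X, aeval_X, ← mul_assoc x, ← step _ hxm]
    have hJJ : Commute J (J - l • 1) := by simpa using hJ X
    calc x * T * (aeval J (C a * X ^ m) * J) * (J - l • 1)
        = x * T * aeval J (C a * X ^ m) * (J - l • 1) * J := by
          rw [mul_assoc _ (J - l • 1) J, ← hJJ.eq]; simp only [mul_assoc]
      _ = _ := by rw [ih, mul_assoc _ (J - l • 1) J, ← hJJ.eq]; simp only [mul_assoc]

/-- The quadratic relation for an eigenvector of the intertwining operator with eigenvalue zero. -/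
theorem quadratic_of_intertwiner_eq_zero {A : Type*} [Ring A] [Algebra ℂ A] {y K T : A} {q l : ℂ}
    (hT : T * T = (q - 1) • T + q • 1)
    (h1 : y * (K - l • 1) * T = y * ((q - 1) • K + 1))
    (h2 : y * K * (K - l • 1) * T = y * K * ((q - 1) • K + 1)) :
    y * ((q • K + (1 - l) • 1) * (K - (q * l + 1) • 1)) = 0 := by
  have e1 : y * (K - l • 1) * (K - l • 1) * T = y * (K - l • 1) * ((q - 1) • K + 1) := by
    have : y * (K - l • 1) * (K - l • 1) * T =
        y * K * (K - l • 1) * T - l • (y * (K - l • 1) * T) := by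
      simp only [mul_sub, sub_mul, mul_smul_comm, smul_mul_assoc, mul_one]
    rw [this, h1, h2]
    simp only [mul_sub, sub_mul, mul_add, mul_smul_comm, smul_mul_assoc, mul_one]
    module
  have e2 : y * (K - l • 1) * ((q - 1) • K + 1) * T = y * ((q - 1) • K + 1) * ((q - 1) • K + 1) := by
    have : y * (K - l • 1) * ((q - 1) • K + 1) * T =
        (q - 1) • (y * K * (K - l • 1) * T) + y * (K - l • 1) * T := by
      simp only [mul_sub, sub_mul, mul_add, add_mul, mul_smul_comm, smul_mul_assoc, mul_one,
        smul_sub, mul_assoc]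
    rw [this, h1, h2]
    simp only [mul_add, add_mul, mul_smul_comm, smul_mul_assoc, mul_one, smul_add, mul_assoc]
  -- The value of T² on y(K - l)² is now known twice: from the action of T on the vectors above, and
  -- from the quadratic relation. Equating the two gives the claim up to sign.
  have e3 := congrArg (y * (K - l • 1) * (K - l • 1) * ·) hT
  simp only [mul_add, mul_smul_comm, mul_one] at e3
  rw [← mul_assoc, e1, e2] at e3
  simp only [mul_sub, sub_mul, mul_add, add_mul, mul_smul_comm, smul_mul_assoc, mul_one, one_mul,
    smul_sub, smul_add, mul_assoc, smul_smul] at e3 ⊢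
  linear_combination (norm := module) -e3

theorem isComplete_zero : IsComplete n q 0 := by
  intro t _ hlen x _
  obtain rfl := List.length_eq_zero_iff.1 hlen
  have h0 : ((0, 0) : ℕ × ℕ) ∈ addables [] :=
    mem_addables.2 ⟨by simp, fun c hc => by rw [cell_lt_iff] at hc; simp at hc⟩
  have := Lagrange.eval_nodal_at_node (v := fun b => qInt q (cellContent b)) h0
  rw [mul_aeval_of_mul_eq (l := qInt q (cellContent (0, 0))), addablePoly, this, zero_smul]
  simp [jucysMurphy_one, cellContent, qInt_zero]

/-- Apply completeness for r to xT: its annihilating polynomial has the factor J - [c(b)], and the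
rest G can be moved to the next element K. On x G(K) the intertwiner with b then vanishes, which
leaves only the contents c(b) ± 1 for K. -/
theorem mul_aeval_addable_neighbours (h : IsGeneric n q) (hk : r.length + 1 < n)
    (hC : IsComplete n q r.length) (ht : IsTableau (b :: r)) (hx : x ∈ weightSpace n q (b :: r)) :
    x * aeval (jucysMurphy n q (r.length + 1 + 1))
      (Lagrange.nodal ((addables r).erase b) (fun b => qInt q (cellContent b)) *
        (X - C (qInt q (cellContent (belowCell b)))) *
          (X - C (qInt q (cellContent (rightCell b))))) = 0 := by
  have hbA : b ∈ addables r := mem_addables.2 ht.1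
  have hx' := mem_weightSpace_cons.1 hx
  have hfac : addablePoly q r = (X - C (qInt q (cellContent b))) *
      Lagrange.nodal ((addables r).erase b) (fun b => qInt q (cellContent b)) := by
    rw [addablePoly, Lagrange.nodal_eq_mul_nodal_erase hbA]
  generalize Lagrange.nodal ((addables r).erase b) (fun b => qInt q (cellContent b)) = G at *
  have hmemP : ∀ P : ℂ[X], x * aeval (jucysMurphy n q (r.length + 1 + 1)) P ∈ weightSpace n q (b :: r) :=
    fun P => mul_aeval_mem_weightSpace h.1 (by simpa using hk) hx P
  have hkr : 1 ≤ r.length + 1 ∧ r.length + 1 < n := by omega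
  have h0 : ∀ P : ℂ[X], x * aeval (jucysMurphy n q (r.length + 1 + 1)) (G * P) *
      heckeT n q (r.length + 1) *
        (jucysMurphy n q (r.length + 1) - qInt q (cellContent b) • 1) = 0 := fun P => by
    have := hC r ht.2 rfl _
      (mul_heckeT_mem_weightSpace h.1 (show r.length < r.length + 1 by omega) hx'.1)
    rw [← heckeT_mul_aeval h.1 hkr hx'.2]
    have hfac' : G * P * (X - C (qInt q (cellContent b))) = addablePoly q r * P := by
      rw [hfac]; ring
    have h1 : jucysMurphy n q (r.length + 1) - qInt q (cellContent b) • 1 =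
        aeval (jucysMurphy n q (r.length + 1)) (X - C (qInt q (cellContent b))) := by
      rw [map_sub, aeval_X, aeval_C, Algebra.algebraMap_eq_smul_one]
    rw [h1, mul_assoc _ (aeval _ _) (aeval _ _), ← map_mul, hfac', map_mul, ← mul_assoc, this, zero_mul]
  have e1 : qInt q (cellContent (rightCell b)) = q * qInt q (cellContent b) + 1 := by
    rw [cellContent_rightCell, qInt_add_one h.1]
  have e2 : 1 - qInt q (cellContent b) = q * -qInt q (cellContent (belowCell b)) := by
    rw [qInt_belowCell h.1 b]; ring
  have e3 := jucysMurphy_succ_mul h.1 hkr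
  have hT := heckeT_quadratic (n := n) (q := q) hkr
  rw [e1]
  generalize qInt q (cellContent (belowCell b)) = l' at *
  generalize qInt q (cellContent b) = l at *
  generalize jucysMurphy n q (r.length + 1 + 1) = K at *
  generalize jucysMurphy n q (r.length + 1) = J at *
  generalize heckeT n q (r.length + 1) = T at *
  have hE : ∀ y, y * T * (J - l • 1) = 0 → y * (K - l • 1) * T = y * ((q - 1) • K + 1) := fun y h0 => by
    have e4 : T * J = K * T - (q - 1) • K - 1 := by rw [e3]; abel
    rw [mul_sub, mul_assoc, e4, mul_smul_comm, mul_one, sub_eq_zero] at h0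
    rw [mul_sub, sub_mul, mul_smul_comm, mul_one, smul_mul_assoc, ← h0]
    simp only [mul_sub, mul_add, mul_one, mul_assoc]
    abel
  -- The quadratic lemma needs the relation for y and for yK, hence the use of G and of G X.
  have hquad := quadratic_of_intertwiner_eq_zero (y := x * aeval K G) hT
    (hE _ (by simpa using h0 1))
    (by
      have := hE (x * aeval K (G * X)) (h0 X)
      simpa [map_mul, ← mul_assoc] using this)
  have e5 : q • K + (1 - l) • (1 : Hecke n q) = q • (K - l' • 1) := by rw [e2]; module
  rw [e5, smul_mul_assoc, mul_smul_comm] at hquad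
  have := (smul_eq_zero.1 hquad).resolve_left h.1
  simpa only [map_mul, map_sub, aeval_X, aeval_C, Algebra.algebraMap_eq_smul_one, mul_assoc] using this

/-- The candidates are the old addable cells other than b and the two neighbours of b. A neighbour
that is not addable supports no weight vector, so its factor can be dropped from the annihilating
polynomial. -/
theorem isComplete_succ (h : IsGeneric n q) {k : ℕ} (hk : k + 1 < n)
    (hC : ∀ m, m < k + 1 → IsComplete n q m) : IsComplete n q (k + 1) := by
  classical
  intro t ht hlen x hx
  cases t with
  | nil => simp at hlen
  | cons b r =>
  obtain rfl : r.length = k := by simpa using hlen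
  have hroots := mul_aeval_addable_neighbours h hk (hC _ (by omega)) ht hx
  have hmemP : ∀ P : ℂ[X], x * aeval (jucysMurphy n q (r.length + 1 + 1)) P ∈ weightSpace n q (b :: r) :=
    fun P => mul_aeval_mem_weightSpace h.1 (by simpa using hk) hx P
  set v : ℕ × ℕ → ℂ := fun b => qInt q (cellContent b) with hv
  set K := jucysMurphy n q (r.length + 1 + 1) with hK
  change x * aeval K (Lagrange.nodal ((addables r).erase b) v * (X - C (v (belowCell b))) *
    (X - C (v (rightCell b)))) = 0 at hroots
  have hrem : ∀ (P : ℂ[X]) (c : ℕ × ℕ), (c = rightCell b ∨ c = belowCell b) → ¬ IsAddable c (b :: r) →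
      x * aeval K (P * (X - C (v c))) = 0 → x * aeval K P = 0 := fun P c hc hcb h0 => by
    refine eq_zero_of_not_addable h hC ht hk hc hcb (mem_weightSpace_cons.2 ⟨hmemP P, ?_⟩)
    rw [map_mul, ← mul_assoc, map_sub, mul_sub, aeval_X, aeval_C, sub_eq_zero,
      Algebra.algebraMap_eq_smul_one, mul_smul_comm, mul_one] at h0
    exact h0
  have hb1 : b ≠ rightCell b := fun e => by simpa [rightCell] using congrArg Prod.snd e
  have hb2 : b ≠ belowCell b := fun e => by simpa [belowCell] using congrArg Prod.fst e
  have hb3 : rightCell b ≠ belowCell b := fun e => by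
    simpa [belowCell, rightCell] using congrArg Prod.fst e
  have hlt1 : b < rightCell b := cell_lt_iff.2 (by simp [rightCell])
  have hlt2 : b < belowCell b := cell_lt_iff.2 (by simp [belowCell])
  have hn1 : rightCell b ∉ (addables r).erase b := fun hm =>
    ht.1.1 ((mem_addables.1 (Finset.mem_of_mem_erase hm)).2 _ hlt1)
  have hn2 : belowCell b ∉ (addables r).erase b := fun hm =>
    ht.1.1 ((mem_addables.1 (Finset.mem_of_mem_erase hm)).2 _ hlt2)
  have hfin : ∀ S : Finset (ℕ × ℕ), S ⊆ addables (b :: r) → x * aeval K (Lagrange.nodal S v) = 0 →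
      x * aeval K (addablePoly q (b :: r)) = 0 := fun S hS h0 => by
    obtain ⟨P, hP⟩ := Finset.prod_dvd_prod_of_subset _ _ (fun i => X - C (v i)) hS
    rw [addablePoly, Lagrange.nodal, hP, map_mul, ← mul_assoc]
    rw [Lagrange.nodal] at h0
    rw [h0, zero_mul]
  have hsub : (addables r).erase b ⊆ addables (b :: r) := fun c hc =>
    mem_addables.2 ((mem_addables.1 (Finset.mem_of_mem_erase hc)).cons (Finset.ne_of_mem_erase hc))
  have hnod : ∀ c ∉ (addables r).erase b, Lagrange.nodal (insert c ((addables r).erase b)) v =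
      Lagrange.nodal ((addables r).erase b) v * (X - C (v c)) := fun c hc => by
    rw [Lagrange.nodal_insert_eq_nodal hc, mul_comm]
  by_cases c1 : IsAddable (rightCell b) (b :: r) <;> by_cases c2 : IsAddable (belowCell b) (b :: r)
  · refine hfin (insert (rightCell b) (insert (belowCell b) ((addables r).erase b)))
      (Finset.insert_subset (mem_addables.2 c1) (Finset.insert_subset (mem_addables.2 c2) hsub)) ?_
    rw [Lagrange.nodal_insert_eq_nodal (by simp [hb3, hn1]), hnod _ hn2, mul_comm]
    exact hroots
  · refine hfin (insert (rightCell b) ((addables r).erase b))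
      (Finset.insert_subset (mem_addables.2 c1) hsub) (hrem _ _ (Or.inr rfl) c2 ?_)
    rw [hnod _ hn1, mul_right_comm]
    exact hroots
  · refine hfin (insert (belowCell b) ((addables r).erase b))
      (Finset.insert_subset (mem_addables.2 c2) hsub) (hrem _ _ (Or.inl rfl) c1 ?_)
    rw [hnod _ hn2]
    exact hroots
  · exact hfin _ hsub (hrem _ _ (Or.inr rfl) c2 (hrem _ _ (Or.inl rfl) c1 hroots))

theorem isComplete (h : IsGeneric n q) {k : ℕ} (hk : k < n) : IsComplete n q k := by
  induction k using Nat.strong_induction_on with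
  | _ k ih =>
    cases k with
    | zero => exact isComplete_zero
    | succ k => exact isComplete_succ h hk fun m hm => ih m hm (by omega)

end Completeness

/-! ### Primitive idempotents of tableaux -/

section Idempotents
variable {n : ℕ} {q : ℂ} {t s r u : List (ℕ × ℕ)} {a b c : ℕ × ℕ} {x y : Hecke n q}

/-- The Lagrange polynomial that is `1` at the `q`-content of `b` and `0` at those of the other cells
which may be added to `t`. -/
noncomputable def addableBasis (q : ℂ) (t : List (ℕ × ℕ)) (b : ℕ × ℕ) : ℂ[X] :=
  Lagrange.basis (addables t) (fun b => qInt q (cellContent b)) b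

/-- The primitive idempotent of a tableau. -/
noncomputable def tableauIdempotent (n : ℕ) (q : ℂ) : List (ℕ × ℕ) → Hecke n q
  | [] => 1
  | b :: t => tableauIdempotent n q t * aeval (jucysMurphy n q (t.length + 1)) (addableBasis q t b)

theorem aeval_mem_parabolic (hq : q ≠ 0) (k : ℕ) (P : ℂ[X]) :
    aeval (jucysMurphy n q k) P ∈ parabolic n q k := by
  have := (aeval (⟨_, jucysMurphy_mem_parabolic hq k⟩ : parabolic n q k) P).2
  rwa [← Subalgebra.coe_val, ← aeval_algHom_apply] at this

theorem commute_aeval {A : Type*} [Ring A] [Algebra ℂ A] {y J : A} (h : Commute y J) (P : ℂ[X]) :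
    Commute y (aeval J P) := by
  induction P using Polynomial.induction_on with
  | C a => rw [aeval_C]; exact Algebra.commute_algebraMap_right _ _
  | add P Q hP hQ => rw [map_add]; exact hP.add_right hQ
  | monomial k a _ =>
    rw [map_mul, aeval_C, map_pow, aeval_X]
    exact (Algebra.commute_algebraMap_right _ _).mul_right (h.pow_right _)

theorem tableauIdempotent_mem_parabolic (hq : q ≠ 0) (t : List (ℕ × ℕ)) :
    tableauIdempotent n q t ∈ parabolic n q t.length := by
  induction t with
  | nil => exact one_mem _
  | cons b t ih => exact mul_mem (parabolic_mono (by simp) ih) (aeval_mem_parabolic hq _ _)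

theorem tableauIdempotent_mem_weightSpace (h : IsGeneric n q) (ht : IsTableau t) (hn : t.length ≤ n) :
    tableauIdempotent n q t ∈ weightSpace n q t := by
  classical
  induction t with
  | nil => trivial
  | cons b t ih =>
    simp only [List.length_cons] at hn
    have hE := ih ht.2 (by omega)
    refine mem_weightSpace_cons.2 ⟨mul_aeval_mem_weightSpace h.1 (by omega) hE _, ?_⟩
    -- The basis polynomial contains, up to constants, every factor of the annihilating polynomial
    -- except the one of b, and this one is supplied.
    have hdvd : addablePoly q t ∣ addableBasis q t b * (X - C (qInt q (cellContent b))) := by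
      rw [addablePoly, Lagrange.nodal_eq_mul_nodal_erase (mem_addables.2 ht.1), mul_comm]
      refine mul_dvd_mul ?_ dvd_rfl
      rw [Lagrange.nodal, addableBasis, Lagrange.basis]
      exact Finset.prod_dvd_prod_of_dvd _ _ fun j _ => Dvd.intro_left _ rfl
    obtain ⟨P, hP⟩ := hdvd
    have h0 := isComplete h (show t.length < n by omega) t ht.2 rfl _ hE
    have h1 : tableauIdempotent n q t * aeval (jucysMurphy n q (t.length + 1)) (addableBasis q t b) *
        aeval (jucysMurphy n q (t.length + 1)) (X - C (qInt q (cellContent b))) = 0 := by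
      rw [mul_assoc, ← map_mul, hP, map_mul, ← mul_assoc, h0, zero_mul]
    rwa [map_sub, aeval_X, aeval_C, mul_sub, sub_eq_zero, Algebra.algebraMap_eq_smul_one, mul_smul_comm,
      mul_one] at h1

theorem mul_addableBasis_self (h : IsGeneric n q) (ht : IsTableau (b :: t)) (hn : t.length < n)
    (hx : x ∈ weightSpace n q (b :: t)) :
    x * aeval (jucysMurphy n q (t.length + 1)) (addableBasis q t b) = x := by
  rw [mul_aeval_of_mul_eq hx.2, addableBasis,
    Lagrange.eval_basis_self (h.injOn_content hn) (mem_addables.2 ht.1), one_smul]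

theorem mul_tableauIdempotent_self (h : IsGeneric n q) (ht : IsTableau t) (hn : t.length ≤ n)
    (hx : x ∈ weightSpace n q t) : x * tableauIdempotent n q t = x := by
  induction t with
  | nil => exact mul_one x
  | cons b t ih =>
    simp only [List.length_cons] at hn
    rw [tableauIdempotent, ← mul_assoc, ih ht.2 (by omega) hx.1, mul_addableBasis_self h ht (by omega) hx]

theorem mul_tableauIdempotent_of_ne (h : IsGeneric n q) (hn : t.length ≤ n) (ht : IsTableau t) (hs : IsTableau s)
    (hts : t.length = s.length) (hne : s ≠ t) (hx : x ∈ weightSpace n q s) :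
    x * tableauIdempotent n q t = 0 := by
  induction t generalizing s with
  | nil => exact absurd (List.length_eq_zero_iff.1 hts.symm) hne
  | cons b t ih =>
    cases s with
    | nil => simp at hts
    | cons b' s =>
    have hlen : t.length = s.length := by simpa using hts
    rw [tableauIdempotent, ← mul_assoc]
    by_cases hst : s = t
    · subst hst
      have hbb : b ≠ b' := fun e => hne (by rw [e])
      rw [mul_tableauIdempotent_self h hs.2 (by simp at hn; omega) hx.1, mul_aeval_of_mul_eq hx.2,
        addableBasis, Lagrange.eval_basis_of_ne (v := fun b => qInt q (cellContent b)) hbb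
          (mem_addables.2 hs.1), zero_smul]
    · rw [ih (by simp at hn; omega) ht.2 hs.2 hlen hst hx.1, zero_mul]

/-- The Lagrange basis polynomials sum to 1, so each idempotent is the sum of those of its one-box
extensions. This lets 1 be inserted anywhere as a combination of tableau idempotents. -/
theorem one_mem_span_tableauIdempotent (h : IsGeneric n q) {k : ℕ} (hk : k ≤ n) :
    (1 : Hecke n q) ∈ Submodule.span ℂ
      {x | ∃ t, IsTableau t ∧ t.length = k ∧ x = tableauIdempotent n q t} := by
  induction k with
  | zero => exact Submodule.subset_span ⟨[], trivial, rfl, rfl⟩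
  | succ k ih =>
    refine Submodule.span_le.2 ?_ (ih (by omega))
    rintro _ ⟨t, ht, rfl, rfl⟩
    have hsum := Lagrange.sum_basis (h.injOn_content (show t.length < n by omega)) (addables_nonempty t)
    have : tableauIdempotent n q t = ∑ b ∈ addables t, tableauIdempotent n q (b :: t) := by
      simp only [tableauIdempotent, addableBasis]
      rw [← Finset.mul_sum, ← map_sum, hsum, map_one, mul_one]
    rw [this]
    exact sum_mem fun b hb => Submodule.subset_span ⟨b :: t, ⟨mem_addables.1 hb, ht⟩, rfl, rfl⟩

/-- The sum of the weight spaces of the tableaux of the shape of `t`. -/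
noncomputable def shapeSpace (n : ℕ) (q : ℂ) (t : List (ℕ × ℕ)) : Submodule ℂ (Hecke n q) :=
  Submodule.span ℂ {y | ∃ s, IsTableau s ∧ t.Perm s ∧ y ∈ weightSpace n q s}

theorem exists_split {i : ℕ} (hi : 1 ≤ i) (ht : i < t.length) :
    ∃ u b a r, t = u ++ b :: a :: r ∧ r.length + 1 = i := by
  have h1 := List.take_append_drop (t.length - (i + 1)) t
  have h2 : (t.drop (t.length - (i + 1))).length = i + 1 := by rw [List.length_drop]; omega
  generalize t.drop (t.length - (i + 1)) = w at h1 h2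
  obtain ⟨b, a, r, rfl⟩ : ∃ b a r, w = b :: a :: r := by
    match w with
    | [] => simp at h2
    | [b] => simp at h2; omega
    | b :: a :: r => exact ⟨b, a, r, rfl⟩
  exact ⟨_, b, a, r, h1.symm, by simpa using h2⟩

theorem IsTableau.swap (ht : IsTableau (u ++ b :: a :: r)) (hb : IsAddable b r) :
    IsTableau (u ++ a :: b :: r) := by
  have h := ht.of_append
  refine ht.append_of_perm ⟨h.2.1.cons ?_, hb, h.2.2⟩ (List.Perm.swap _ _ _)
  rintro rfl
  exact h.1.1 (by simp)

/-- Either the two consecutive entries may be exchanged and the intertwiner applies, or the cells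
are neighbours and the generator acts by q or -1. The shape is kept in both cases. -/
theorem mul_heckeT_of_mem_weightSpace (h : IsGeneric n q) (ht : IsTableau t) (hn : t.length ≤ n) {i : ℕ}
    (hi : 1 ≤ i) (hit : i < t.length) (hx : x ∈ weightSpace n q t) :
    ∃ (γ : ℂ) (s : List (ℕ × ℕ)), IsTableau s ∧ t.Perm s ∧
      x * heckeT n q i - γ • x ∈ weightSpace n q s := by
  obtain ⟨u, b, a, r, rfl, rfl⟩ := exists_split hi hit
  have h' := ht.of_append
  have hl : r.length + 2 ≤ n := by simp at hn; omega
  by_cases hb : IsAddable b r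
  · have hab : a ≠ b := by rintro rfl; exact h'.1.1 (by simp)
    exact ⟨swapCoeff q a b, _, ht.swap hb, (List.Perm.swap _ _ _).append_left u,
      swap_mem_weightSpace h.1 hn hx (swapCoeff_spec h (by omega) h'.2.1 hb hab)⟩
  · have hnb := h'.1.eq_neighbour h'.2 hb
    rcases hnb with hb' | hb'
    · refine ⟨q, _, ht, List.Perm.refl _, ?_⟩
      rw [heckeT_eq_smul_of_neighbour h (isComplete h (by omega)) h'.2 hn (Or.inl hb') hx
        (by rw [hb']; exact swapCoeff_right h.1 a), sub_self]
      exact zero_mem _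
    · refine ⟨-1, _, ht, List.Perm.refl _, ?_⟩
      rw [heckeT_eq_smul_of_neighbour h (isComplete h (by omega)) h'.2 hn (Or.inr hb') hx
        (by rw [hb']; exact swapCoeff_below h.1 a), sub_self]
      exact zero_mem _

theorem mul_mem_shapeSpace (h : IsGeneric n q) (hn : t.length ≤ n) (hx : x ∈ shapeSpace n q t)
    (ha : y ∈ parabolic n q t.length) : x * y ∈ shapeSpace n q t := by
  induction ha using Algebra.adjoin_induction generalizing x with
  | mem z hz =>
    obtain ⟨i, h1, h2, rfl⟩ := hz
    induction hx using Submodule.span_induction with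
    | mem x hx =>
      obtain ⟨s, hs, hts, hx⟩ := hx
      obtain ⟨γ, s', hs', hss', hy⟩ := mul_heckeT_of_mem_weightSpace h hs (hts.length_eq ▸ hn) h1
        (hts.length_eq ▸ h2) hx
      rw [← sub_add_cancel (x * heckeT n q i) (γ • x)]
      exact add_mem (Submodule.subset_span ⟨s', hs', hts.trans hss', hy⟩)
        (Submodule.smul_mem _ _ (Submodule.subset_span ⟨s, hs, hts, hx⟩))
    | zero => rw [zero_mul]; exact zero_mem _
    | add x y _ _ hx hy => rw [add_mul]; exact add_mem hx hy
    | smul l x _ hx => rw [smul_mul_assoc]; exact Submodule.smul_mem _ _ hx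
  | algebraMap l =>
    rw [Algebra.algebraMap_eq_smul_one, mul_smul_comm, mul_one]; exact Submodule.smul_mem _ _ hx
  | add y z _ _ hy hz => rw [mul_add]; exact add_mem (hy hx) (hz hx)
  | mul y z _ _ hy hz => rw [← mul_assoc]; exact hz (hy hx)

/-- The algebra preserves the sum of the weight spaces of one shape, and the idempotent of a tableau
of another shape kills each of them. -/
theorem mul_mul_tableauIdempotent_eq_zero (h : IsGeneric n q) (ht : IsTableau t) (hn : t.length ≤ n)
    (hx : x ∈ weightSpace n q t) (ha : y ∈ parabolic n q t.length) (hs : IsTableau s)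
    (hlen : t.length = s.length) (hts : ¬ t.Perm s) : x * y * tableauIdempotent n q s = 0 := by
  have := mul_mem_shapeSpace h hn (Submodule.subset_span ⟨t, ht, List.Perm.refl _, hx⟩) ha
  generalize x * y = w at this
  induction this using Submodule.span_induction with
  | mem x hx =>
    obtain ⟨s', hs', hts', hx⟩ := hx
    refine mul_tableauIdempotent_of_ne h (hlen ▸ hn) hs hs' (hlen.symm.trans hts'.length_eq) ?_ hx
    rintro rfl
    exact hts hts'
  | zero => rw [zero_mul]
  | add x y _ _ hx hy => rw [add_mul, hx, hy, add_zero]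
  | smul l x _ hx => rw [smul_mul_assoc, hx, smul_zero]

/-- The double coset decomposition `H_{k+1} = H_k + H_k T_{s_k} H_k`. -/
theorem parabolic_succ_le {k : ℕ} (hk : k < n) : (parabolic n q (k + 1)).toSubmodule ≤
    (parabolic n q k).toSubmodule ⊔ Submodule.span ℂ
      {z | ∃ x ∈ parabolic n q k, ∃ y ∈ parabolic n q k, z = x * heckeT n q k * y} := by
  induction k with
  | zero =>
    refine le_trans ?_ le_sup_left
    refine Algebra.adjoin_mono ?_
    rintro _ ⟨i, h1, h2, rfl⟩
    omega
  | succ k ih =>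
    set D := (parabolic n q (k + 1)).toSubmodule ⊔ Submodule.span ℂ {z | ∃ x ∈ parabolic n q (k + 1),
      ∃ y ∈ parabolic n q (k + 1), z = x * heckeT n q (k + 1) * y} with hD
    have hP : ∀ x ∈ parabolic n q (k + 1), x ∈ D := fun x hx => Submodule.mem_sup_left hx
    have hPT : ∀ x ∈ parabolic n q (k + 1), ∀ y ∈ parabolic n q (k + 1),
        x * heckeT n q (k + 1) * y ∈ D := fun x hx y hy =>
      Submodule.mem_sup_right (Submodule.subset_span ⟨x, hx, y, hy, rfl⟩)
    have hT := heckeT_quadratic (n := n) (q := q) (i := k + 1) (by omega)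
    -- Reduction of T_{k+1} y T_{k+1}: split y by induction; a part in H_k commutes past and meets
    -- the quadratic relation, a part in H_k T_k H_k meets the braid relation.
    have hPTT : ∀ x ∈ parabolic n q (k + 1), ∀ y ∈ parabolic n q (k + 1),
        x * heckeT n q (k + 1) * y * heckeT n q (k + 1) ∈ D := by
      intro x hx y hy
      obtain ⟨y1, hy1, y2, hy2, rfl⟩ := Submodule.mem_sup.1 (ih (by omega) hy)
      clear hy
      rw [mul_add, add_mul]
      refine add_mem ?_ ?_
      · have hy1' : y1 ∈ parabolic n q k := hy1
        have hc := commute_heckeT_of_mem_parabolic (show k < k + 1 by omega) hy1'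
        rw [mul_assoc _ y1, hc.eq, mul_assoc x, ← mul_assoc _ (heckeT n q (k + 1)) y1, hT]
        have hxy := mul_mem hx (parabolic_mono (show k ≤ k + 1 by omega) hy1')
        have : x * (((q - 1) • heckeT n q (k + 1) + q • 1) * y1) =
            (q - 1) • (x * heckeT n q (k + 1) * y1) + q • (x * y1) := by
          simp only [add_mul, mul_add, smul_mul_assoc, mul_smul_comm, one_mul, mul_assoc]
        rw [this]
        exact add_mem (Submodule.smul_mem _ _ (hPT x hx y1 (parabolic_mono (by omega) hy1')))
          (Submodule.smul_mem _ _ (hP _ hxy))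
      · induction hy2 using Submodule.span_induction with
        | mem z hz =>
          obtain ⟨v, hv, w, hw, rfl⟩ := hz
          have hcv := commute_heckeT_of_mem_parabolic (show k < k + 1 by omega) hv
          have hcw := commute_heckeT_of_mem_parabolic (show k < k + 1 by omega) hw
          have e : x * heckeT n q (k + 1) * (v * heckeT n q k * w) * heckeT n q (k + 1) =
              x * v * heckeT n q k * heckeT n q (k + 1) * (heckeT n q k * w) := by
            calc _ = x * (heckeT n q (k + 1) * v) * heckeT n q k * (w * heckeT n q (k + 1)) := by
                  simp only [mul_assoc]
              _ = x * v * (heckeT n q (k + 1) * heckeT n q k * heckeT n q (k + 1)) * w := by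
                  rw [hcw.eq, ← hcv.eq]; simp only [mul_assoc]
              _ = _ := by rw [← heckeT_braid]; simp only [mul_assoc]
          rw [e]
          rcases Nat.eq_zero_or_pos k with rfl | hk0
          · have : heckeT n q 0 = 0 := by simp [heckeT]
            simp [this]
          · have hTk := heckeT_mem_parabolic (n := n) (q := q) hk0 (show k < k + 1 by omega)
            exact hPT _ (mul_mem (mul_mem hx (parabolic_mono (by omega) hv)) hTk) _
              (mul_mem hTk (parabolic_mono (by omega) hw))
        | zero => simp
        | add y z _ _ hy hz => rw [mul_add, add_mul]; exact add_mem hy hz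
        | smul l y _ hy => rw [mul_smul_comm, smul_mul_assoc]; exact Submodule.smul_mem _ _ hy
    have hstab : ∀ z ∈ D, ∀ i, 1 ≤ i → i < k + 1 + 1 → z * heckeT n q i ∈ D := by
      intro z hz i h1 h2
      obtain ⟨z1, hz1, z2, hz2, rfl⟩ := Submodule.mem_sup.1 hz
      have hz1' : z1 ∈ parabolic n q (k + 1) := hz1
      clear hz
      rw [add_mul]
      refine add_mem ?_ ?_
      · rcases Nat.lt_succ_iff_lt_or_eq.1 h2 with h2 | rfl
        · exact hP _ (mul_mem hz1' (heckeT_mem_parabolic h1 h2))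
        · simpa using hPT z1 hz1' 1 (one_mem _)
      · induction hz2 using Submodule.span_induction with
        | mem z hz =>
          obtain ⟨x, hx, y, hy, rfl⟩ := hz
          rcases Nat.lt_succ_iff_lt_or_eq.1 h2 with h2 | rfl
          · rw [mul_assoc]; exact hPT x hx _ (mul_mem hy (heckeT_mem_parabolic h1 h2))
          · exact hPTT x hx y hy
        | zero => simp
        | add y z _ _ hy hz => rw [add_mul]; exact add_mem hy hz
        | smul l y _ hy => rw [smul_mul_assoc]; exact Submodule.smul_mem _ _ hy
    intro a ha
    have key : ∀ z ∈ D, z * a ∈ D := by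
      induction (show a ∈ parabolic n q (k + 1 + 1) from ha) using Algebra.adjoin_induction with
      | mem x hx => obtain ⟨i, h1, h2, rfl⟩ := hx; exact fun z hz => hstab z hz i h1 h2
      | algebraMap l =>
        intro z hz
        rw [Algebra.algebraMap_eq_smul_one, mul_smul_comm, mul_one]; exact Submodule.smul_mem _ _ hz
      | add x y hx' hy' hx hy => intro z hz; rw [mul_add]; exact add_mem (hx hx' z hz) (hy hy' z hz)
      | mul x y hx' hy' hx hy => intro z hz; rw [← mul_assoc]; exact hy hy' _ (hx hx' z hz)
    simpa using key 1 (hP 1 (one_mem _))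

/-- The idempotent of a tableau is primitive. -/
theorem tableauIdempotent_mul_mul_self (h : IsGeneric n q) (ht : IsTableau t) (hn : t.length ≤ n)
    {a : Hecke n q} (ha : a ∈ parabolic n q t.length) :
    tableauIdempotent n q t * a * tableauIdempotent n q t ∈ Submodule.span ℂ {tableauIdempotent n q t} := by
  induction t generalizing a with
  | nil =>
    have : a ∈ (⊥ : Subalgebra ℂ (Hecke n q)) := by
      rw [← Algebra.adjoin_empty ℂ (Hecke n q)]
      refine Algebra.adjoin_mono ?_ ha
      rintro _ ⟨i, h1, h2, rfl⟩
      simp at h2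
    obtain ⟨l, rfl⟩ := Algebra.mem_bot.1 this
    rw [tableauIdempotent, mul_one, one_mul, Algebra.algebraMap_eq_smul_one]
    exact Submodule.smul_mem _ _ (Submodule.mem_span_singleton_self _)
  | cons b r ih =>
    simp only [List.length_cons] at hn ha
    have hEt := tableauIdempotent_mem_weightSpace h ht (by simpa using hn)
    have hEr := tableauIdempotent_mem_weightSpace h ht.2 (show r.length ≤ n by omega)
    have hLt := mul_addableBasis_self h ht (by omega) hEt
    set L := aeval (jucysMurphy n q (r.length + 1)) (addableBasis q r b) with hL
    set E := tableauIdempotent n q (b :: r) with hE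
    set F := tableauIdempotent n q r with hF
    have hFP : F ∈ parabolic n q r.length := tableauIdempotent_mem_parabolic h.1 r
    have hEFL : E = F * L := rfl
    have hcF : Commute F (jucysMurphy n q (r.length + 1)) :=
      commute_jucysMurphy_of_mem_parabolic h.1 (by omega) (by omega) hFP
    have hELF : E = L * F := by rw [hEFL]; exact commute_aeval hcF _
    have hJE : jucysMurphy n q (r.length + 1) * E = qInt q (cellContent b) • E := by
      have : Commute E (jucysMurphy n q (r.length + 1)) := by
        rw [hEFL]; exact hcF.mul_left (commute_aeval (Commute.refl _) _).symm
      rw [← this.eq, (mem_weightSpace_cons.1 hEt).2]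
    have case1 : ∀ a ∈ parabolic n q r.length, E * a * E ∈ Submodule.span ℂ {E} := fun a ha => by
      obtain ⟨l, hl⟩ := Submodule.mem_span_singleton.1 (ih ht.2 (by omega) ha)
      have : E * a * E = l • E := by
        calc E * a * E = L * (F * a * F) * L := by
              nth_rw 1 [hELF]; rw [hEFL]; simp only [mul_assoc]
          _ = l • (L * F * L) := by rw [← hl, mul_smul_comm, smul_mul_assoc]
          _ = l • E := by rw [← hELF, hLt]
      rw [this]
      exact Submodule.smul_mem _ _ (Submodule.mem_span_singleton_self _)
    -- On both sides of T_k, insert 1 as a combination of tableau idempotents of size k. Other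
    -- shapes contribute zero, distinct tableaux of the shape of r contribute zero, and the diagonal
    -- terms reduce to the case without T_k.
    have case2 : ∀ a₁ ∈ parabolic n q r.length, ∀ a₂ ∈ parabolic n q r.length,
        E * (a₁ * heckeT n q r.length * a₂) * E ∈ Submodule.span ℂ {E} := by
      intro a₁ ha₁ a₂ ha₂
      rcases Nat.eq_zero_or_pos r.length with h0 | hpos
      · have : heckeT n q r.length = 0 := by simp [heckeT, h0]
        rw [this]; simp
      have hone := one_mem_span_tableauIdempotent h (show r.length ≤ n by omega)
      have hzl : ∀ s, IsTableau s → s.length = r.length → ¬ r.Perm s →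
          E * a₁ * tableauIdempotent n q s = 0 := fun s hs hlen hp => by
        rw [hELF, mul_assoc L, mul_assoc L,
          mul_mul_tableauIdempotent_eq_zero h ht.2 (by omega) hEr ha₁ hs hlen.symm hp, mul_zero]
      have hzr : ∀ s, IsTableau s → s.length = r.length → ¬ r.Perm s →
          tableauIdempotent n q s * a₂ * E = 0 := fun s hs hlen hp => by
        rw [hEFL, ← mul_assoc, mul_mul_tableauIdempotent_eq_zero h hs (by omega)
          (tableauIdempotent_mem_weightSpace h hs (by omega)) (by rwa [hlen]) ht.2 hlen
          (fun e => hp e.symm), zero_mul]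
      have diag : ∀ s, IsTableau s → r.Perm s → E * a₁ * tableauIdempotent n q s *
          heckeT n q r.length * tableauIdempotent n q s * a₂ * E ∈ Submodule.span ℂ {E} := by
        intro s hs hp
        have hls : r.length = s.length := hp.length_eq
        cases s with
        | nil => rw [List.length_nil] at hls; omega
        | cons d s =>
        have hlen : r.length = s.length + 1 := by simpa using hls
        have hEs := tableauIdempotent_mem_weightSpace h hs (by omega)
        have hsP : tableauIdempotent n q (d :: s) ∈ parabolic n q r.length := by
          rw [hls]; exact tableauIdempotent_mem_parabolic h.1 _
        have hEsE := mul_tableauIdempotent_self h hs (by omega) hEs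
        have hcs := commute_jucysMurphy_of_mem_parabolic h.1 (show r.length ≤ n by omega)
          (show r.length < r.length + 1 by omega) (mul_mem hsP ha₂)
        have hne := IsAddable.content_ne_head hs (ht.1.perm hp)
        have hv : qInt q (cellContent b) ≠ qInt q (cellContent d) := h.qInt_ne hne.1
          (hne.2.trans (by exact_mod_cast (show s.length + 1 ≤ n by omega)))
        have hJs := (mem_weightSpace_cons.1 hEs).2
        rw [← hlen] at hJs
        have hTJ := heckeT_mul_jucysMurphy_succ h.1 (n := n) (k := r.length) (by omega)
        have c1 := case1 _ (mul_mem (mul_mem ha₁ hsP) ha₂)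
        generalize tableauIdempotent n q (d :: s) = S at *
        generalize jucysMurphy n q (r.length + 1) = K at *
        generalize jucysMurphy n q r.length = J at *
        generalize heckeT n q r.length = T at *
        have e1 : S * T * (S * a₂) * (K * E) = qInt q (cellContent b) • (S * T * (S * a₂) * E) := by
          rw [hJE, mul_smul_comm]
        -- J_{k+1} is evaluated on E at the right, and also by moving it left through T_k until J_k
        -- meets S. The two values have different coefficients, since b is addable to the tableau of
        -- S and its content differs from that of the last cell d; so S T S a₂ E is a multiple of S
        -- a₂ E.
        have e2 : S * T * (S * a₂) * (K * E) = qInt q (cellContent d) • (S * T * (S * a₂) * E) +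
            ((q - 1) * qInt q (cellContent b) + 1) • (S * a₂ * E) := by
          calc S * T * (S * a₂) * (K * E) = S * T * ((S * a₂) * K) * E := by simp only [mul_assoc]
            _ = S * (T * K) * (S * a₂) * E := by rw [hcs.eq]; simp only [mul_assoc]
            _ = (S * J) * T * (S * a₂) * E + (q - 1) • (S * (K * (S * a₂)) * E) +
                  S * S * a₂ * E := by
                rw [hTJ]
                simp only [mul_add, add_mul, mul_smul_comm, smul_mul_assoc, mul_one, mul_assoc]
            _ = qInt q (cellContent d) • (S * T * (S * a₂) * E) +
                  (q - 1) • (S * S * a₂ * (K * E)) + S * S * a₂ * E := by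
                rw [hJs, ← hcs.eq]
                simp only [smul_mul_assoc, mul_assoc]
            _ = _ := by rw [hJE, hEsE, mul_smul_comm]; module
        have e3 : S * T * (S * a₂) * E = (((q - 1) * qInt q (cellContent b) + 1) /
            (qInt q (cellContent b) - qInt q (cellContent d))) • (S * a₂ * E) := by
          have hv' := sub_ne_zero.2 hv
          refine smul_right_injective _ hv' ?_
          simp only
          rw [smul_smul, mul_div_cancel₀ _ hv']
          rw [e1] at e2
          linear_combination (norm := module) e2
        have e4 : E * a₁ * S * T * S * a₂ * E = E * a₁ * (S * T * (S * a₂) * E) := by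
          simp only [mul_assoc]
        rw [e4, e3, mul_smul_comm]
        refine Submodule.smul_mem _ _ ?_
        simpa only [mul_assoc] using c1
      have step1 : ∀ s, IsTableau s → s.length = r.length → E * a₁ * tableauIdempotent n q s *
          heckeT n q r.length * a₂ * E ∈ Submodule.span ℂ {E} := by
        intro s hs hlen
        by_cases hp : r.Perm s
        swap
        · rw [hzl s hs hlen hp]; simp
        have : ∀ y ∈ Submodule.span ℂ {x | ∃ t, IsTableau t ∧ t.length = r.length ∧
            x = tableauIdempotent n q t}, E * a₁ * tableauIdempotent n q s *
              heckeT n q r.length * y * a₂ * E ∈ Submodule.span ℂ {E} := fun y hy => by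
          induction hy using Submodule.span_induction with
          | mem y hy =>
            obtain ⟨s', hs', hlen', rfl⟩ := hy
            by_cases hss : s = s'
            · subst hss; exact diag s hs hp
            by_cases hp' : r.Perm s'
            · have hzero : tableauIdempotent n q s * heckeT n q r.length *
                  tableauIdempotent n q s' = 0 := by
                cases s with
                | nil => simp at hlen; omega
                | cons d s =>
                cases s' with
                | nil => simp at hlen'; omega
                | cons d' s' =>
                -- Two tableaux of equal shape that agree except possibly in the largest entry are
                -- equal. As T_k preserves the weight space of the tail, different tails give zero.
                have hne : s ≠ s' := by
                  rintro rfl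
                  have hmem : d' ∈ d :: s := (hp.symm.trans hp').mem_iff.2 (by simp)
                  rcases List.mem_cons.1 hmem with e | hm
                  · exact hss (by rw [e])
                  · exact hs'.1.1 hm
                have hEs := tableauIdempotent_mem_weightSpace h hs (by omega)
                simp only [List.length_cons] at hlen hlen'
                rw [tableauIdempotent.eq_def n q (d' :: s')]
                simp only
                rw [← mul_assoc, mul_tableauIdempotent_of_ne h (by omega) hs'.2 hs.2 (by omega) hne
                  (mul_heckeT_mem_weightSpace h.1 (by omega) hEs.1), zero_mul]
              have e : E * a₁ * tableauIdempotent n q s * heckeT n q r.length *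
                  tableauIdempotent n q s' * a₂ * E = E * a₁ * (tableauIdempotent n q s *
                    heckeT n q r.length * tableauIdempotent n q s') * a₂ * E := by
                simp only [mul_assoc]
              rw [e, hzero]; simp
            · have e : E * a₁ * tableauIdempotent n q s * heckeT n q r.length *
                  tableauIdempotent n q s' * a₂ * E = E * a₁ * tableauIdempotent n q s *
                    heckeT n q r.length * (tableauIdempotent n q s' * a₂ * E) := by
                simp only [mul_assoc]
              rw [e, hzr s' hs' hlen' hp']; simp
          | zero => simp
          | add y z _ _ hy hz => simp only [mul_add, add_mul]; exact add_mem hy hz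
          | smul l y _ hy =>
            simp only [mul_smul_comm, smul_mul_assoc]; exact Submodule.smul_mem _ _ hy
        simpa using this 1 hone
      have : ∀ y ∈ Submodule.span ℂ {x | ∃ t, IsTableau t ∧ t.length = r.length ∧
          x = tableauIdempotent n q t}, E * a₁ * y * heckeT n q r.length * a₂ * E ∈
            Submodule.span ℂ {E} := fun y hy => by
        induction hy using Submodule.span_induction with
        | mem y hy => obtain ⟨s, hs, hlen, rfl⟩ := hy; exact step1 s hs hlen
        | zero => simp
        | add y z _ _ hy hz => simp only [mul_add, add_mul]; exact add_mem hy hz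
        | smul l y _ hy => simp only [mul_smul_comm, smul_mul_assoc]; exact Submodule.smul_mem _ _ hy
      simpa [mul_assoc] using this 1 hone
    obtain ⟨a1, ha1, a2, ha2, rfl⟩ := Submodule.mem_sup.1 (parabolic_succ_le (show r.length < n by omega) ha)
    rw [mul_add, add_mul]
    refine add_mem (case1 a1 ha1) ?_
    clear ha
    induction ha2 using Submodule.span_induction with
    | mem z hz => obtain ⟨x, hx, y, hy, rfl⟩ := hz; exact case2 x hx y hy
    | zero => simp
    | add y z _ _ hy hz => rw [mul_add, add_mul]; exact add_mem hy hz
    | smul l y _ hy => rw [mul_smul_comm, smul_mul_assoc]; exact Submodule.smul_mem _ _ hy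

end Idempotents

/-! ### Functionals invariant under the row stabilizer -/

section RowSorted
variable {n : ℕ} {q : ℂ} {t s r u : List (ℕ × ℕ)} {a b c : ℕ × ℕ} {x y : Hecke n q}

/-- The entries of every row of the tableau `t` are smaller than those of the next rows. -/
def IsRowSorted (t : List (ℕ × ℕ)) : Prop := t.Pairwise fun b a => a.1 ≤ b.1

/-- The lexicographically largest cell, the end of the last row, is a corner; put the largest entry
there and recurse. -/
theorem exists_isRowSorted (ht : IsTableau t) :
    ∃ s, IsTableau s ∧ t.Perm s ∧ IsRowSorted s := by
  induction hk : t.length generalizing t with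
  | zero =>
    obtain rfl := List.length_eq_zero_iff.1 hk
    exact ⟨[], trivial, List.Perm.refl _, List.Pairwise.nil⟩
  | succ k ih =>
    have hne : t.toFinset.Nonempty := by
      rw [List.toFinset_nonempty_iff]; rintro rfl; simp at hk
    obtain ⟨b, hb, hmax⟩ := Finset.exists_max_image t.toFinset (fun c => toLex c) hne
    rw [List.mem_toFinset] at hb
    have hrow : ∀ a ∈ t, a.1 < b.1 ∨ a.1 = b.1 ∧ a.2 ≤ b.2 := fun a ha => by
      have := hmax a (List.mem_toFinset.2 ha)
      rwa [Prod.Lex.toLex_le_toLex] at this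
    have hcorner : ∀ a ∈ t, b ≤ a → a = b := fun a ha hle => by
      have h1 := hrow a ha
      obtain ⟨h2, h3⟩ := hle
      exact Prod.ext (by omega) (by omega)
    have hlen : (t.erase b).length = k := by rw [List.length_erase_of_mem hb, hk]; rfl
    obtain ⟨s, hs, hp, hsort⟩ := ih (ht.erase hcorner) hlen
    refine ⟨b :: s, ⟨(ht.cons_erase hb hcorner).1.perm hp, hs⟩,
      (List.perm_cons_erase hb).trans (hp.cons b), List.pairwise_cons.2 ⟨fun a ha => ?_, hsort⟩⟩
    have := hrow a (List.mem_of_mem_erase (hp.mem_iff.2 ha))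
    omega

theorem exists_first_difference (hlen : s.length = t.length) (hne : s ≠ t) :
    ∃ u b u' b' r, s = u ++ b :: r ∧ t = u' ++ b' :: r ∧ b ≠ b' := by
  induction s generalizing t with
  | nil => exact absurd (List.length_eq_zero_iff.1 hlen.symm).symm hne
  | cons b s ih =>
    cases t with
    | nil => simp at hlen
    | cons b' t =>
    by_cases hst : s = t
    · subst hst
      exact ⟨[], b, [], b', s, rfl, rfl, fun e => hne (by rw [e])⟩
    · obtain ⟨u, c, u', c', r, rfl, rfl, h⟩ := ih (by simpa using hlen) hst
      exact ⟨b :: u, c, b' :: u', c', r, rfl, rfl, h⟩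

/-- The cell opening row ρ + 1 is moved back past the entries of row ρ. Each exchange multiplies Ψ
by q - γ ≠ 0, until the cell directly follows (ρ, 0); there the generator acts by -1 while Ψ sees q,
and q + 1 ≠ 0. -/
theorem eq_zero_of_cell_below (h : IsGeneric n q) (Ψ : Hecke n q →ₗ[ℂ] ℂ) {ρ : ℕ}
    (hs : IsTableau (u ++ (ρ + 1, 0) :: r)) (hn : (u ++ (ρ + 1, 0) :: r).length ≤ n)
    (hsort : IsRowSorted r) (hrow : ∀ a ∈ r, a.1 ≤ ρ) (hmem : (ρ, 0) ∈ r)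
    (hΨ : ∀ w a r', r = w ++ a :: r' → a.1 = ρ → ∀ x, Ψ (x * heckeT n q (r'.length + 1)) = q * Ψ x)
    (hx : x ∈ weightSpace n q (u ++ (ρ + 1, 0) :: r)) : Ψ x = 0 := by
  induction r generalizing u x with
  | nil => simp at hmem
  | cons c r ih =>
    have hcρ : c.1 = ρ := by
      refine le_antisymm (hrow c (by simp)) ?_
      rcases List.mem_cons.1 hmem with e | hm
      · rw [← e]
      · exact (List.pairwise_cons.1 hsort).1 _ hm
    have hT := hΨ [] c r rfl hcρ
    have hl : r.length + 2 ≤ n := by simp at hn; omega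
    have hs' := hs.of_append
    obtain ⟨i, j⟩ := c
    simp only at hcρ
    subst hcρ
    rcases Nat.eq_zero_or_pos j with rfl | hj
    · have e := heckeT_eq_smul_of_neighbour h (isComplete h (by omega)) hs'.2 hn (Or.inr rfl) hx
        (swapCoeff_below h.1 (i, 0))
      have h1 := hT x
      rw [e, map_smul, smul_eq_mul] at h1
      have : (q + 1) * Ψ x = 0 := by linear_combination -h1
      exact (mul_eq_zero.1 this).resolve_left (h.add_one_ne_zero (by omega))
    · have hmem' : (i, 0) ∈ r := by
        rcases List.mem_cons.1 hmem with e | hm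
        · simp at e; omega
        · exact hm
      have hb : IsAddable (i + 1, 0) r := by
        refine ⟨fun hm => hs'.1.1 (List.mem_cons_of_mem _ hm), fun d hd => ?_⟩
        rw [cell_lt_iff] at hd
        simp only at hd
        exact hs'.2.2.mem_of_le hmem' ⟨by simp; omega, by simp; omega⟩
      have hab : ((i, j) : ℕ × ℕ) ≠ (i + 1, 0) := by simp
      have hy := swap_mem_weightSpace h.1 hn hx (swapCoeff_spec h (by omega) hs'.2.1 hb hab)
      have hsw := hs.swap hb
      have hzero := ih (u := u ++ [(i, j)]) (x := x * heckeT n q (r.length + 1) - swapCoeff q (i, j) (i + 1, 0) • x)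
        (by simpa using hsw) (by simpa using hn)
        (List.pairwise_cons.1 hsort).2 (fun a ha => hrow a (List.mem_cons_of_mem _ ha)) hmem'
        (fun w a r' e => hΨ ((i, j) :: w) a r' (by rw [e]; rfl)) (by simpa using hy)
      rw [map_sub, map_smul, hT x, smul_eq_mul, ← sub_mul] at hzero
      exact (mul_eq_zero.1 hzero).resolve_left
        (sub_ne_zero.2 (swapCoeff_ne h (by omega) hs'.2.1 hb hab).1.symm)

/-- A functional invariant under the row stabilizer of the row sorted tableau `t` vanishes on the weight
spaces of the other tableaux of the same shape. -/
theorem eq_zero_of_ne_isRowSorted (h : IsGeneric n q) (Ψ : Hecke n q →ₗ[ℂ] ℂ) (ht : IsTableau t)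
    (hsort : IsRowSorted t) (hs : IsTableau s) (hts : t.Perm s) (hne : s ≠ t) (hn : t.length ≤ n)
    (hΨ : ∀ u b a r, t = u ++ b :: a :: r → b.1 = a.1 →
      ∀ x, Ψ (x * heckeT n q (r.length + 1)) = q * Ψ x)
    (hx : x ∈ weightSpace n q s) : Ψ x = 0 := by
  obtain ⟨u, b, u', b', r, rfl, rfl, hbb⟩ := exists_first_difference hts.length_eq.symm hne
  have hb := hs.of_append.1
  have ht' := ht.of_append
  have hsr := (List.pairwise_append.1 hsort).2.1
  have hrow : ∀ a ∈ r, a.1 ≤ b'.1 := (List.pairwise_cons.1 hsr).1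
  have hrowb : b'.1 ≤ b.1 := by
    have : b ∈ u' ++ b' :: r := hts.mem_iff.2 (by simp)
    rcases List.mem_append.1 this with hm | hm
    · exact (List.pairwise_append.1 hsort).2.2 b hm b' (by simp)
    · rcases List.mem_cons.1 hm with e | hm
      · exact absurd e hbb
      · exact absurd hm hb.1
  have hlt1 : ¬ b < b' := fun hlt => hb.1 (ht'.1.2 b hlt)
  have hlt2 : ¬ b' < b := fun hlt => ht'.1.1 (hb.2 b' hlt)
  have hne : ¬ (b.1 = b'.1 ∧ b.2 = b'.2) := fun e => hbb (Prod.ext e.1 e.2)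
  rw [cell_lt_iff] at hlt1 hlt2
  -- At the first difference, b and b' are incomparable and b lies in a later row. All cells of r
  -- are in rows up to that of b', so b can only be the first cell of the next row.
  have hup : (b.1 - 1, b.2) ∈ r := hb.2 _ (cell_lt_iff.2 (by simp; omega))
  have h1 := hrow _ hup
  simp only at h1
  have hb2 : b.2 = 0 := by
    by_contra h0
    have := hrow _ (hb.2 (b.1, b.2 - 1) (cell_lt_iff.2 (by simp; omega)))
    simp only at this
    omega
  obtain ⟨i, j⟩ := b
  simp only at *
  obtain rfl : i = b'.1 + 1 := by omega
  subst hb2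
  refine eq_zero_of_cell_below h Ψ hs (hts.length_eq ▸ hn) (List.pairwise_cons.1 hsr).2 hrow
    (by simpa using hup) (fun w a r' e ha => ?_) hx
  subst e
  -- The entry after a in t is still no later than b', so it lies in the same row as a and the
  -- invariance of Ψ applies.
  obtain ⟨w', e, hw⟩ : ∃ w' e, b' :: w = w' ++ [e] :=
    ⟨_, _, (List.dropLast_append_getLast (List.cons_ne_nil b' w)).symm⟩
  have heq : u' ++ b' :: (w ++ a :: r') = (u' ++ w') ++ e :: a :: r' := by
    rw [← List.cons_append, hw]; simp
  refine hΨ _ e a r' heq ?_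
  have hem : e ∈ b' :: (w ++ a :: r') := by
    rw [← List.cons_append, hw]; simp
  have h2 : e.1 ≤ b'.1 := by
    rcases List.mem_cons.1 hem with rfl | hm
    · exact le_rfl
    · exact hrow _ hm
  have h3 : a.1 ≤ e.1 := by
    rw [heq] at hsort
    exact (List.pairwise_cons.1 (List.pairwise_append.1 hsort).2.1).1 a (by simp)
  omega

end RowSorted

/-! ### Coefficients of words under the right action -/

section WordModule
variable {n : ℕ} {q : ℂ}

theorem rightAct_mul (x y : Hecke n q) (u : Words n) :
    rightAct n q (x * y) u = rightAct n q y (rightAct n q x u) := by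
  rw [rightAct, map_mul]; rfl

theorem rightAct_one (u : Words n) : rightAct n q 1 u = u := by
  rw [rightAct, map_one]; rfl

/-- The right action on words, as a linear map of the algebra. -/
noncomputable def actOn (n : ℕ) (q : ℂ) (u : Words n) : Hecke n q →ₗ[ℂ] Words n where
  toFun x := rightAct n q x u
  map_add' x y := by rw [rightAct, map_add]; rfl
  map_smul' c x := by rw [rightAct, map_smul]; rfl

theorem rightAct_add (x y : Hecke n q) (u : Words n) :
    rightAct n q (x + y) u = rightAct n q x u + rightAct n q y u := map_add (actOn n q u) x y

theorem rightAct_smul (c : ℂ) (x : Hecke n q) (u : Words n) :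
    rightAct n q (c • x) u = c • rightAct n q x u := map_smul (actOn n q u) c x

theorem rightAct_zero (u : Words n) : rightAct n q 0 u = 0 := map_zero (actOn n q u)

theorem rightAct_heckeT {i : ℕ} (h : 1 ≤ i ∧ i < n) :
    rightAct n q (heckeT n q i) = swapAct q ⟨i - 1, by omega⟩ ⟨i, h.2⟩ := by
  rw [heckeT, dif_pos h, rightAct, wordRep, heckeLift_gen]; rfl

/-- The words in which the letters of the multiset `M` occur with their multiplicities. -/
noncomputable def wordSpace (n : ℕ) (M : Multiset ℕ) : Submodule ℂ (Words n) :=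
  Finsupp.supported ℂ ℂ {w | Finset.univ.val.map w = M}

theorem map_comp_perm (w : Fin n → ℕ) (σ : Equiv.Perm (Fin n)) :
    Finset.univ.val.map (w ∘ σ) = Finset.univ.val.map w := by
  rw [← Multiset.map_map]
  congr 1
  have := Finset.map_univ_equiv σ
  exact congrArg Finset.val this

theorem swapAct_mem_supported (a b : Fin n) {S : Set (Fin n → ℕ)}
    (hS : ∀ w ∈ S, w ∘ Equiv.swap a b ∈ S) {u : Words n} (hu : u ∈ Finsupp.supported ℂ ℂ S) :
    swapAct q a b u ∈ Finsupp.supported ℂ ℂ S := by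
  rw [Finsupp.supported_eq_span_single] at hu
  induction hu using Submodule.span_induction with
  | mem x hx =>
    obtain ⟨w, hw, rfl⟩ := hx
    have h1 : (Finsupp.single w 1 : Words n) ∈ Finsupp.supported ℂ ℂ S :=
      Finsupp.single_mem_supported ℂ 1 hw
    have h2 : (Finsupp.single (w ∘ Equiv.swap a b) 1 : Words n) ∈ Finsupp.supported ℂ ℂ S :=
      Finsupp.single_mem_supported ℂ 1 (hS w hw)
    rcases lt_trichotomy (w a) (w b) with h | h | h
    · rw [swapAct_lt q a b w h]; exact h2
    · rw [swapAct_eq q a b w h]; exact Submodule.smul_mem _ _ h1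
    · rw [swapAct_gt q a b w h]
      exact add_mem (Submodule.smul_mem _ _ h2) (Submodule.smul_mem _ _ h1)
  | zero => rw [map_zero]; exact zero_mem _
  | add u v _ _ hu hv => rw [map_add]; exact add_mem hu hv
  | smul c u _ hu => rw [map_smul]; exact Submodule.smul_mem _ _ hu

theorem swapAct_mem_wordSpace (a b : Fin n) {M : Multiset ℕ} {u : Words n} (hu : u ∈ wordSpace n M) :
    swapAct q a b u ∈ wordSpace n M :=
  swapAct_mem_supported a b (fun w hw => (map_comp_perm w _).trans hw) hu

theorem rightAct_mem_of_heckeT {W : Submodule ℂ (Words n)} {k : ℕ}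
    (hW : ∀ i, 1 ≤ i → i < k → ∀ u ∈ W, rightAct n q (heckeT n q i) u ∈ W) {x : Hecke n q}
    (hx : x ∈ parabolic n q k) {u : Words n} (hu : u ∈ W) : rightAct n q x u ∈ W := by
  induction hx using Algebra.adjoin_induction generalizing u with
  | mem x hx => obtain ⟨i, h1, h2, rfl⟩ := hx; exact hW i h1 h2 u hu
  | algebraMap c =>
    rw [Algebra.algebraMap_eq_smul_one, rightAct_smul, rightAct_one]; exact Submodule.smul_mem _ _ hu
  | add x y _ _ hx hy => rw [rightAct_add]; exact add_mem (hx hu) (hy hu)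
  | mul x y _ _ hx hy => rw [rightAct_mul]; exact hy (hx hu)

theorem rightAct_mem_wordSpace (x : Hecke n q) {M : Multiset ℕ} {u : Words n}
    (hu : u ∈ wordSpace n M) : rightAct n q x u ∈ wordSpace n M :=
  rightAct_mem_of_heckeT (fun _ h1 h2 u hu => by
    rw [rightAct_heckeT ⟨h1, h2⟩]; exact swapAct_mem_wordSpace _ _ hu) (mem_parabolic x) hu

/-- Among basis words only w itself contributes to the coefficient of w: every other word with
unequal letters at these places keeps them unequal. Thus the coefficient functional is invariant
under the row stabilizer. -/
theorem swapAct_apply_eq (a b : Fin n) (w : Fin n → ℕ) (hw : w a = w b) (u : Words n) :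
    swapAct q a b u w = q * u w := by
  have : (Finsupp.lapply w) ∘ₗ swapAct q a b = q • (Finsupp.lapply w : Words n →ₗ[ℂ] ℂ) := by
    refine Finsupp.lhom_ext' fun v => LinearMap.ext_ring ?_
    simp only [LinearMap.coe_comp, Function.comp_apply, Finsupp.lsingle_apply, LinearMap.smul_apply,
      Finsupp.lapply_apply, smul_eq_mul]
    have hne : v a ≠ v b → v ≠ w := by rintro h rfl; exact h hw
    have hne' : v a ≠ v b → v ∘ Equiv.swap a b ≠ w := by
      rintro h rfl
      simp at hw
      exact h hw.symm
    rcases lt_trichotomy (v a) (v b) with h | h | h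
    · rw [swapAct_lt q a b v h]
      simp [hne h.ne, hne' h.ne]
    · rw [swapAct_eq q a b v h, Finsupp.smul_apply, smul_eq_mul]
    · rw [swapAct_gt q a b v h]
      simp [hne h.ne', hne' h.ne']
  exact DFunLike.congr_fun this u

theorem swapAct_apply_lt (a b : Fin n) (w : Fin n → ℕ) (hw : w a < w b) (u : Words n) :
    swapAct q a b u w = q * u (w ∘ Equiv.swap a b) := by
  have : (Finsupp.lapply w) ∘ₗ swapAct q a b =
      q • (Finsupp.lapply (w ∘ Equiv.swap a b) : Words n →ₗ[ℂ] ℂ) := by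
    refine Finsupp.lhom_ext' fun v => LinearMap.ext_ring ?_
    simp only [LinearMap.coe_comp, Function.comp_apply, Finsupp.lsingle_apply, LinearMap.smul_apply,
      Finsupp.lapply_apply, smul_eq_mul]
    have hiff : v ∘ Equiv.swap a b = w ↔ v = w ∘ Equiv.swap a b := by
      constructor
      · rintro rfl; ext; simp
      · rintro rfl; ext; simp
    have h1 : v a ≤ v b → v ≠ w ∘ Equiv.swap a b := by
      rintro h rfl
      simp at h
      omega
    have h2 : v b ≤ v a → v ≠ w := by rintro h rfl; omega
    rcases lt_trichotomy (v a) (v b) with h | h | h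
    · rw [swapAct_lt q a b v h]
      have e1 := h1 h.le
      have e2 : v ∘ Equiv.swap a b ≠ w := fun e => e1 (hiff.1 e)
      simp [e1, e2]
    · rw [swapAct_eq q a b v h]
      simp [h1 h.le, h2 h.ge]
    · rw [swapAct_gt q a b v h]
      simp only [Finsupp.add_apply, Finsupp.smul_apply, Finsupp.single_apply, if_neg (h2 h.le), hiff,
        smul_eq_mul, mul_zero, add_zero]
  exact DFunLike.congr_fun this u

theorem eq_of_monotone {w w' : Fin n → ℕ} (hw : Monotone w) (hw' : Monotone w')
    (h : Finset.univ.val.map w = Finset.univ.val.map w') : w = w' := by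
  rw [Fin.univ_val_map, Fin.univ_val_map, Multiset.coe_eq_coe] at h
  exact List.ofFn_injective (h.eq_of_sortedLE hw.sortedLE_ofFn hw'.sortedLE_ofFn)

/-- A vector of words with the letters of the increasing word `w₀` is determined by the coefficients of
`w₀` in the vectors of the submodule generated by it. -/
theorem eq_zero_of_coeff_eq_zero (hq : q ≠ 0) {w₀ : Fin n → ℕ} (hw₀ : Monotone w₀) {u : Words n}
    (hu : u ∈ wordSpace n (Finset.univ.val.map w₀)) (h : ∀ x, rightAct n q x u w₀ = 0) : u = 0 := by
  have key : ∀ w : Lex (Fin n → ℕ), Finset.univ.val.map (ofLex w) = Finset.univ.val.map w₀ →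
      ∀ x, rightAct n q x u (ofLex w) = 0 := by
    intro w
    induction w using WellFoundedLT.induction with
    | _ w ih =>
      intro hM x
      by_cases hmono : Monotone (ofLex w)
      · rw [eq_of_monotone hmono hw₀ hM]; exact h x
      · obtain ⟨i, hi, hlt⟩ : ∃ i : ℕ, ∃ hi : i + 1 < n, ofLex w ⟨i + 1, hi⟩ < ofLex w ⟨i, by omega⟩ := by
          by_contra hcon
          push Not at hcon
          apply hmono
          cases n with
          | zero => exact fun a => a.elim0
          | succ n => exact Fin.monotone_iff_le_succ.2 fun i => hcon i.1 (by omega)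
        set a : Fin n := ⟨i, by omega⟩ with ha
        set b : Fin n := ⟨i + 1, hi⟩ with hb
        set v : Fin n → ℕ := ofLex w ∘ Equiv.swap a b with hv
        -- Sorting a descent lowers the word lexicographically, and the coefficient of w in a vector
        -- is, up to q, the coefficient of the sorted word after one generator; so induction reaches
        -- the increasing word.
        have hvw : toLex v < w := by
          refine ⟨a, fun j hj => ?_, ?_⟩
          · have h1 : j ≠ a := hj.ne
            have h2 : j ≠ b := by rintro rfl; rw [Fin.lt_def] at hj; simp [ha, hb] at hj
            change ofLex w (Equiv.swap a b j) = ofLex w j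
            rw [Equiv.swap_apply_of_ne_of_ne h1 h2]
          · change ofLex w (Equiv.swap a b a) < ofLex w a
            rw [Equiv.swap_apply_left]
            exact hlt
        have h1 := ih (toLex v) hvw ((map_comp_perm _ _).trans hM) (x * heckeT n q (i + 1))
        rw [rightAct_mul, rightAct_heckeT ⟨by omega, hi⟩] at h1
        change swapAct q a b (rightAct n q x u) v = 0 at h1
        rw [swapAct_apply_lt a b v (by simpa [hv] using hlt)] at h1
        have h2 : v ∘ Equiv.swap a b = ofLex w := by ext; simp [hv]
        rw [h2] at h1
        exact (mul_eq_zero.1 h1).resolve_left hq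
  ext w
  by_cases hw : Finset.univ.val.map w = Finset.univ.val.map w₀
  · have := key (toLex w) hw 1
    rwa [rightAct_one] at this
  · by_contra hne
    exact hw (hu (Finsupp.mem_support_iff.2 hne))

end WordModule

/-! ### Multiplicity one for weights in the permutation module -/

section WeightVectors
variable {n : ℕ} {q : ℂ} {t s r u : List (ℕ × ℕ)}

/-- The word of a tableau, given as the list of its cells. -/
def listWord (n : ℕ) (t : List (ℕ × ℕ)) (i : Fin n) : ℕ := (t.reverse.getD i (0, 0)).1 + 1

/-- The letters of the words of the tableaux of the shape of `t`. -/
def rowLetters (t : List (ℕ × ℕ)) : Multiset ℕ := (t : Multiset (ℕ × ℕ)).map fun c => c.1 + 1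

theorem rowLetters_perm (h : t.Perm s) : rowLetters t = rowLetters s := by
  rw [rowLetters, rowLetters, Multiset.coe_eq_coe.2 h]

theorem map_listWord (ht : t.length = n) : Finset.univ.val.map (listWord n t) = rowLetters t := by
  have : List.ofFn (listWord n t) = t.reverse.map fun c => c.1 + 1 := by
    refine List.ext_getElem (by simp [ht]) fun i h1 h2 => ?_
    have h3 : i < t.reverse.length := by simpa using h2
    simp only [List.getElem_ofFn, List.getElem_map, listWord]
    rw [List.getD_eq_getElem _ _ h3]
  rw [Fin.univ_val_map, this, rowLetters, Multiset.map_coe, Multiset.coe_eq_coe, List.map_reverse]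
  exact List.reverse_perm _

theorem monotone_listWord (ht : t.length = n) (hsort : IsRowSorted t) : Monotone (listWord n t) := by
  intro i j hij
  rcases hij.eq_or_lt with rfl | hij
  · exact le_rfl
  have h1 : (i : ℕ) < t.reverse.length := by simp [ht]
  have h2 : (j : ℕ) < t.reverse.length := by simp [ht]
  have hp : t.reverse.Pairwise fun a b => a.1 ≤ b.1 := List.pairwise_reverse.2 hsort
  have := List.pairwise_iff_getElem.1 hp i j h1 h2 hij
  simp only [listWord, List.getD_eq_getElem _ _ h1, List.getD_eq_getElem _ _ h2]
  omega

/-- It is enough that the coefficient of the increasing word vanishes in every u x. Since u is fixed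
by its idempotent E, write u x as a combination of u E x E_s. Other shapes give zero, other tableaux
of the shape are killed by row invariance, and for the tableau itself primitivity gives a multiple
of u, whose coefficient is zero by assumption. -/
theorem eq_zero_of_coeff_listWord_eq_zero (h : IsGeneric n q) (ht : IsTableau t) (hlen : t.length = n)
    (hsort : IsRowSorted t) {u : Words n} (hu : u ∈ wordSpace n (rowLetters t))
    (hE : rightAct n q (tableauIdempotent n q t) u = u) (h0 : u (listWord n t) = 0) : u = 0 := by
  rw [← map_listWord hlen] at hu
  refine eq_zero_of_coeff_eq_zero h.1 (monotone_listWord hlen hsort) hu fun x => ?_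
  set Ψ : Hecke n q →ₗ[ℂ] ℂ := Finsupp.lapply (listWord n t) ∘ₗ actOn n q u with hΨ
  have hinv : ∀ v b a r, t = v ++ b :: a :: r → b.1 = a.1 →
      ∀ x, Ψ (x * heckeT n q (r.length + 1)) = q * Ψ x := by
    rintro v b a r rfl hba x
    simp only [List.length_append, List.length_cons] at hlen
    change rightAct n q (x * heckeT n q (r.length + 1)) u _ = q * rightAct n q x u _
    rw [rightAct_mul, rightAct_heckeT (by omega), swapAct_apply_eq]
    simp [listWord, hba]
  have hEt := tableauIdempotent_mem_weightSpace h ht hlen.le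
  have key : ∀ y ∈ Submodule.span ℂ {x | ∃ s, IsTableau s ∧ s.length = n ∧ x = tableauIdempotent n q s},
      Ψ (tableauIdempotent n q t * x * y) = 0 := fun y hy => by
    induction hy using Submodule.span_induction with
    | mem y hy =>
      obtain ⟨s, hs, hlen', rfl⟩ := hy
      by_cases hp : t.Perm s
      · by_cases hst : s = t
        · subst hst
          obtain ⟨l, hl⟩ := Submodule.mem_span_singleton.1
            (tableauIdempotent_mul_mul_self h hs hlen.le (a := x) (by rw [hlen]; exact mem_parabolic x))
          rw [← hl, map_smul]
          change l • rightAct n q _ u _ = 0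
          rw [hE, h0, smul_zero]
        · exact eq_zero_of_ne_isRowSorted h Ψ ht hsort hs hp hst hlen.le hinv
            (mul_mem_weightSpace _ (tableauIdempotent_mem_weightSpace h hs hlen'.le))
      · rw [mul_mul_tableauIdempotent_eq_zero h ht hlen.le hEt (by rw [hlen]; exact mem_parabolic x) hs
          (hlen.trans hlen'.symm) hp, map_zero]
    | zero => simp
    | add y z _ _ hy hz => rw [mul_add, map_add, hy, hz, add_zero]
    | smul l y _ hy => rw [mul_smul_comm, map_smul, hy, smul_zero]
  have := key 1 (one_mem_span_tableauIdempotent h le_rfl)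
  rw [mul_one] at this
  change rightAct n q (tableauIdempotent n q t * x) u _ = 0 at this
  rwa [rightAct_mul, hE] at this

/-- The weight space of a tableau in the permutation module of its shape is at most one-dimensional. -/
theorem exists_smul_of_weight (h : IsGeneric n q) (ht : IsTableau t) (hlen : t.length = n)
    {u v : Words n} (hu : u ∈ wordSpace n (rowLetters t)) (hv : v ∈ wordSpace n (rowLetters t))
    (hEu : rightAct n q (tableauIdempotent n q t) u = u)
    (hEv : rightAct n q (tableauIdempotent n q t) v = v) (hu0 : u ≠ 0) : ∃ c : ℂ, v = c • u := by
  obtain ⟨s, hs, hp, hsort⟩ := exists_isRowSorted ht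
  have hlen' : s.length = n := hp.length_eq.symm.trans hlen
  obtain ⟨g, -, g', -, H⟩ := isLinked_of_perm h ht hs hp hlen.le
  obtain ⟨H1, H2⟩ := H _ (tableauIdempotent_mem_weightSpace h ht hlen.le)
  have hback : ∀ u : Words n, rightAct n q (tableauIdempotent n q t) u = u →
      rightAct n q g' (rightAct n q g u) = u := fun u hu => by
    have : rightAct n q (tableauIdempotent n q t * g * g') u = rightAct n q (tableauIdempotent n q t) u := by
      rw [H2]
    rw [rightAct_mul, rightAct_mul] at this
    simpa only [hu] using this
  have hfix : ∀ u : Words n, rightAct n q (tableauIdempotent n q t) u = u →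
      rightAct n q (tableauIdempotent n q s) (rightAct n q g u) = rightAct n q g u := fun u hu => by
    have : rightAct n q (tableauIdempotent n q t * g * tableauIdempotent n q s) u =
        rightAct n q (tableauIdempotent n q t * g) u := by
      rw [mul_tableauIdempotent_self h hs hlen'.le H1]
    rw [rightAct_mul, rightAct_mul] at this
    simpa only [hu] using this
  have hdet : ∀ u ∈ wordSpace n (rowLetters t), rightAct n q (tableauIdempotent n q t) u = u →
      rightAct n q g u (listWord n s) = 0 → u = 0 := fun u hu hE h0 => by
    have := eq_zero_of_coeff_listWord_eq_zero h hs hlen' hsort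
      (by rw [← rowLetters_perm hp]; exact rightAct_mem_wordSpace g hu) (hfix u hE) h0
    rw [← hback u hE, this, map_zero]
  have hne : rightAct n q g u (listWord n s) ≠ 0 := fun h0 => hu0 (hdet u hu hEu h0)
  -- After transport to the row sorted tableau one coefficient determines a weight vector; the
  -- scalar is the quotient of the two coefficients.
  refine ⟨rightAct n q g v (listWord n s) / rightAct n q g u (listWord n s), sub_eq_zero.1 (hdet _
    (sub_mem hv (Submodule.smul_mem _ _ hu)) (by rw [map_sub, map_smul, hEu, hEv]) ?_)⟩
  rw [map_sub, map_smul, Finsupp.sub_apply, Finsupp.smul_apply, smul_eq_mul, div_mul_cancel₀ _ hne,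
    sub_self]

end WeightVectors

/-! ### From fillings of diagrams to lists of cells -/

namespace SkewSYT
variable {ν : YoungDiagram}

theorem mem_sdiff_bot {c : ℕ × ℕ} : c ∈ ν.cells \ (⊥ : YoungDiagram).cells ↔ c ∈ ν.cells := by simp

theorem card_bot : (⊥ : YoungDiagram).card = 0 := by simp [YoungDiagram.card]

theorem entry_mem (t : SYT ν) {c : ℕ × ℕ} (hc : c ∈ ν.cells) : 1 ≤ t.entry c ∧ t.entry c ≤ ν.card := by
  rw [entry, dif_pos (mem_sdiff_bot.2 hc)]
  have := Finset.mem_Ioc.1 (t.fill ⟨c, mem_sdiff_bot.2 hc⟩).2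
  have h0 : (⊥ : YoungDiagram).card = 0 := card_bot
  omega

theorem cell_entry (t : SYT ν) {c : ℕ × ℕ} (hc : c ∈ ν.cells) : t.cell (t.entry c) = c := by
  have h := mem_sdiff_bot.2 hc
  rw [entry, dif_pos h, cell, dif_pos (t.fill ⟨c, h⟩).2]
  simp

theorem mem_Ioc_bot {k : ℕ} : k ∈ Finset.Ioc (⊥ : YoungDiagram).card ν.card ↔ 1 ≤ k ∧ k ≤ ν.card := by
  rw [Finset.mem_Ioc, card_bot]; omega

theorem cell_mem (t : SYT ν) {k : ℕ} (hk : 1 ≤ k ∧ k ≤ ν.card) : t.cell k ∈ ν.cells := by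
  rw [cell, dif_pos (mem_Ioc_bot.2 hk)]
  exact mem_sdiff_bot.1 (t.fill.symm _).2

theorem entry_cell (t : SYT ν) {k : ℕ} (hk : 1 ≤ k ∧ k ≤ ν.card) : t.entry (t.cell k) = k := by
  have h := mem_sdiff_bot.2 (t.cell_mem hk)
  rw [entry, dif_pos h]
  have : (⟨t.cell k, h⟩ : {c // c ∈ ν.cells \ (⊥ : YoungDiagram).cells}) =
      t.fill.symm ⟨k, mem_Ioc_bot.2 hk⟩ := by
    apply Subtype.ext
    simp only [cell]
    rw [dif_pos (mem_Ioc_bot.2 hk)]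
  rw [this]
  simp

theorem entry_le (t : SYT ν) {c d : ℕ × ℕ} (hc : c ∈ ν.cells) (hd : d ∈ ν.cells) (hcd : c ≤ d) :
    t.entry c ≤ t.entry d := by
  rw [entry, entry, dif_pos (mem_sdiff_bot.2 hc), dif_pos (mem_sdiff_bot.2 hd)]
  exact t.fill_le ⟨c, _⟩ ⟨d, _⟩ hcd

/-- The cells of the entries `k, …, 1` of `t`. -/
def cellList (t : SYT ν) : ℕ → List (ℕ × ℕ)
  | 0 => []
  | k + 1 => t.cell (k + 1) :: t.cellList k

theorem length_cellList (t : SYT ν) (k : ℕ) : (t.cellList k).length = k := by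
  induction k with
  | zero => rfl
  | succ k ih => rw [cellList, List.length_cons, ih]

theorem mem_cellList (t : SYT ν) {k : ℕ} (hk : k ≤ ν.card) {c : ℕ × ℕ} :
    c ∈ t.cellList k ↔ c ∈ ν.cells ∧ t.entry c ≤ k := by
  induction k with
  | zero =>
    simp only [cellList, List.not_mem_nil, false_iff, not_and]
    intro hc
    have := t.entry_mem hc
    omega
  | succ k ih =>
    rw [cellList, List.mem_cons, ih (by omega)]
    constructor
    · rintro (rfl | ⟨h1, h2⟩)
      · exact ⟨t.cell_mem (by omega), (t.entry_cell (by omega)).le⟩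
      · exact ⟨h1, by omega⟩
    · rintro ⟨h1, h2⟩
      rcases h2.lt_or_eq with h2 | h2
      · exact Or.inr ⟨h1, by omega⟩
      · exact Or.inl (by rw [← h2, t.cell_entry h1])

theorem isTableau_cellList (t : SYT ν) {k : ℕ} (hk : k ≤ ν.card) : IsTableau (t.cellList k) := by
  induction k with
  | zero => trivial
  | succ k ih =>
    have hkc : 1 ≤ k + 1 ∧ k + 1 ≤ ν.card := by omega
    refine ⟨⟨fun hm => ?_, fun c hc => ?_⟩, ih (by omega)⟩
    · have := ((t.mem_cellList (by omega)).1 hm).2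
      rw [t.entry_cell hkc] at this
      omega
    · have hcν : c ∈ ν.cells := ν.isLowerSet hc.le (t.cell_mem hkc)
      refine (t.mem_cellList (by omega)).2 ⟨hcν, ?_⟩
      have h1 := t.entry_le hcν (t.cell_mem hkc) hc.le
      rw [t.entry_cell hkc] at h1
      rcases h1.lt_or_eq with h1 | h1
      · omega
      · have := t.cell_entry hcν
        rw [h1] at this
        exact absurd this hc.ne'

theorem coe_cellList (t : SYT ν) : (t.cellList ν.card : Multiset (ℕ × ℕ)) = ν.cells.val := by
  refine (Multiset.Nodup.ext (Multiset.coe_nodup.2 (t.isTableau_cellList le_rfl).nodup) ν.cells.nodup).2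
    fun c => ?_
  rw [Multiset.mem_coe, t.mem_cellList le_rfl]
  exact ⟨fun h => h.1, fun h => ⟨h, (t.entry_mem h).2⟩⟩

theorem content_eq (t : SYT ν) (k : ℕ) : t.content k = cellContent (t.cell k) := rfl

theorem cellList_eq_append (t : SYT ν) {k : ℕ} {u r : List (ℕ × ℕ)} {b : ℕ × ℕ}
    (h : t.cellList k = u ++ b :: r) : b = t.cell (r.length + 1) := by
  induction u generalizing k with
  | nil =>
    cases k with
    | zero => simp [cellList] at h
    | succ k =>
      simp only [cellList, List.nil_append, List.cons.injEq] at h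
      obtain ⟨rfl, rfl⟩ := h
      rw [length_cellList]
  | cons c u ih =>
    cases k with
    | zero => simp [cellList] at h
    | succ k =>
      simp only [cellList, List.cons_append, List.cons.injEq] at h
      exact ih h.2

theorem mul_jucysMurphy_of_mem {n : ℕ} {q : ℂ} (t : SYT ν) {k : ℕ} {x : Hecke n q}
    (hx : x ∈ weightSpace n q (t.cellList k)) {m : ℕ} (h1 : 1 ≤ m) (h2 : m ≤ k) :
    x * jucysMurphy n q m = qInt q (t.content m) • x := by
  induction k with
  | zero => omega
  | succ k ih =>
    rw [cellList, mem_weightSpace_cons, length_cellList] at hx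
    rcases h2.lt_or_eq with h2 | rfl
    · exact ih hx.1 (by omega)
    · exact hx.2

end SkewSYT

/-! ### The Young idempotents are the tableau idempotents -/

section YoungIdempotent
variable {n : ℕ} {q : ℂ} {t s r u : List (ℕ × ℕ)} {b : ℕ × ℕ} {ν : YoungDiagram}

theorem exists_mul_jucysMurphy_eq {x : Hecke n q} (hx : x ∈ weightSpace n q s) {m : ℕ} (h1 : 1 ≤ m)
    (h2 : m ≤ s.length) : ∃ l : ℂ, x * jucysMurphy n q m = l • x := by
  induction s with
  | nil => simp at h2; omega
  | cons b s ih =>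
    rcases h2.lt_or_eq with h2 | rfl
    · exact ih hx.1 (by simpa using h2)
    · exact ⟨_, hx.2⟩

theorem mul_list_prod_eq_self {A : Type*} [Ring A] {x : A} {l : List A} (h : ∀ f ∈ l, x * f = x) :
    x * l.prod = x := by
  induction l with
  | nil => simp
  | cons f l ih =>
    rw [List.prod_cons, ← mul_assoc, h f (by simp), ih fun g hg => h g (List.mem_cons_of_mem _ hg)]

theorem mul_list_prod_eq_zero {A : Type*} [Ring A] [Algebra ℂ A] {x : A} {l : List A}
    (h : ∀ f ∈ l, ∃ c : ℂ, x * f = c • x) {f : A} (hf : f ∈ l) (h0 : x * f = 0) : x * l.prod = 0 := by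
  induction l with
  | nil => simp at hf
  | cons g l ih =>
    rw [List.prod_cons, ← mul_assoc]
    rcases List.mem_cons.1 hf with rfl | hf
    · rw [h0, zero_mul]
    · obtain ⟨c, hc⟩ := h g (by simp)
      rw [hc, smul_mul_assoc, ih (fun g hg => h g (List.mem_cons_of_mem _ hg)) hf, smul_zero]

/-- The entries 2 and 3 never lie on the diagonal: the cell (0, 0) holds 1, and any further diagonal
cell requires three earlier cells. -/
theorem cellContent_mem_contentSet (hr : IsTableau (b :: r)) :
    cellContent b ∈ contentSet (r.length + 1) := by
  have hle := abs_le.1 hr.1.content_le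
  have hIoo : cellContent b ∈ Finset.Ioo (-((r.length + 1 : ℕ) : ℤ)) ((r.length + 1 : ℕ) : ℤ) := by
    rw [Finset.mem_Ioo]; push_cast; omega
  unfold contentSet
  split_ifs with h
  · refine Finset.mem_erase.2 ⟨fun h0 => ?_, hIoo⟩
    obtain ⟨i, j⟩ := b
    obtain rfl : i = j := by simp only [cellContent] at h0; omega
    rcases Nat.eq_zero_or_pos i with rfl | hi
    · cases r with
      | nil => simp at h
      | cons c r =>
        exact hr.1.1 (hr.2.mem_of_le (b := c) (by simp) ⟨Nat.zero_le _, Nat.zero_le _⟩)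
    · have := hook_le_length (t := r) (p := 2) (m := 2)
        (fun y hy => hr.1.2 _ (cell_lt_iff.2 (by simp; omega)))
        (fun x hx => hr.1.2 _ (cell_lt_iff.2 (by simp; omega)))
      omega
  · exact hIoo

/-- Both elements act on a weight space by a scalar, 1 for the tableau itself and 0 otherwise. For
the Young idempotent the zero comes from the first entry at which the tableaux differ: there both
cells are addable to the same diagram, so the q-contents differ and the corresponding factor is
present. -/
theorem weightSpace_mul_youngIdempotent (h : IsGeneric n q) (hν : ν.card = n) (t : SYT ν)
    (hs : IsTableau s) (hlen : s.length = n) {x : Hecke n q} (hx : x ∈ weightSpace n q s) :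
    x * youngIdempotent n q t = x * tableauIdempotent n q (t.cellList n) := by
  classical
  have ht : IsTableau (t.cellList n) := t.isTableau_cellList hν.ge
  have htl := t.length_cellList n
  by_cases hst : s = t.cellList n
  · subst hst
    rw [mul_tableauIdempotent_self h ht htl.le hx, youngIdempotent]
    refine mul_list_prod_eq_self fun f hf => ?_
    obtain ⟨m, hm, rfl⟩ := List.mem_map.1 hf
    rw [List.Ico.mem] at hm
    rw [mul_aeval_of_mul_eq (t.mul_jucysMurphy_of_mem hx hm.1 (by omega)), eval_prod]
    rw [Finset.prod_eq_one, one_smul]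
    intro d hd
    have hd := (Finset.mem_filter.1 hd).2
    rw [eval_mul, eval_C, eval_sub, eval_X, eval_C, inv_mul_cancel₀ (sub_ne_zero.2 hd.symm)]
  · rw [mul_tableauIdempotent_of_ne h htl.le ht hs (htl.trans hlen.symm) hst hx, youngIdempotent]
    obtain ⟨u, b, u', b', r, rfl, e, hbb⟩ := exists_first_difference (hlen.trans htl.symm) hst
    have hb' := t.cellList_eq_append e
    have hbr := hs.of_append
    have hrn : r.length + 1 ≤ n := by simp at hlen; omega
    have hx' := (mem_weightSpace_cons.1 (weightSpace_append hx)).2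
    have hb'r : IsTableau (b' :: r) := by rw [e] at ht; exact ht.of_append
    refine mul_list_prod_eq_zero (fun f hf => ?_) (List.mem_map.2 ⟨r.length + 1, ?_, rfl⟩) ?_
    · obtain ⟨m, hm, rfl⟩ := List.mem_map.1 hf
      rw [List.Ico.mem] at hm
      obtain ⟨l, hl⟩ := exists_mul_jucysMurphy_eq hx hm.1 (by omega)
      exact ⟨_, mul_aeval_of_mul_eq hl _⟩
    · rw [List.Ico.mem]; omega
    · rw [mul_aeval_of_mul_eq hx', eval_prod, Finset.prod_eq_zero (i := cellContent b), zero_smul]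
      · refine Finset.mem_filter.2 ⟨cellContent_mem_contentSet hbr, ?_⟩
        rw [t.content_eq, ← hb']
        exact qInt_content_ne_of_addable h (by omega) hb'r.1 hbr.1 hbb.symm
      · simp

theorem youngIdempotent_eq (h : IsGeneric n q) (hν : ν.card = n) (t : SYT ν) :
    youngIdempotent n q t = tableauIdempotent n q (t.cellList n) := by
  have key : ∀ y ∈ Submodule.span ℂ {x | ∃ s, IsTableau s ∧ s.length = n ∧ x = tableauIdempotent n q s},
      y * youngIdempotent n q t = y * tableauIdempotent n q (t.cellList n) := fun y hy => by
    induction hy using Submodule.span_induction with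
    | mem y hy =>
      obtain ⟨s, hs, hlen, rfl⟩ := hy
      exact weightSpace_mul_youngIdempotent h hν t hs hlen
        (tableauIdempotent_mem_weightSpace h hs hlen.le)
    | zero => simp
    | add y z _ _ hy hz => rw [add_mul, add_mul, hy, hz]
    | smul l y _ hy => rw [smul_mul_assoc, smul_mul_assoc, hy]
  simpa using key 1 (one_mem_span_tableauIdempotent h le_rfl)

end YoungIdempotent

/-! ### Specht modules, contents and isotypic projectors -/

section Specht
variable {n : ℕ} {q : ℂ} {ν : YoungDiagram}

/-- The letters of the words of content `ν`. -/
def diagramLetters (ν : YoungDiagram) : Multiset ℕ := ν.cells.val.map fun c => c.1 + 1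

theorem rowLetters_cellList (hν : ν.card = n) (t : SYT ν) :
    rowLetters (t.cellList n) = diagramLetters ν := by
  subst hν
  rw [rowLetters, t.coe_cellList, diagramLetters]

theorem reverse_cellList_getD (t : SYT ν) {k i : ℕ} (hi : i < k) :
    (t.cellList k).reverse.getD i (0, 0) = t.cell (i + 1) := by
  induction k with
  | zero => omega
  | succ k ih =>
    rw [SkewSYT.cellList, List.reverse_cons]
    rcases (Nat.lt_succ_iff.1 hi).lt_or_eq with hi | rfl
    · rw [List.getD_append _ _ _ _ (by rw [List.length_reverse, t.length_cellList]; exact hi), ih hi]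
    · rw [List.getD_append_right _ _ _ _ (by rw [List.length_reverse, t.length_cellList])]
      simp [t.length_cellList]

theorem word_mem_wordSpace (hν : ν.card = n) (t : SYT ν) : word n t ∈ wordSpace n (diagramLetters ν) := by
  refine Finsupp.single_mem_supported ℂ 1 ?_
  rw [Set.mem_ofPred_eq, ← rowLetters_cellList hν t, ← map_listWord (t.length_cellList n)]
  congr 1
  ext i
  rw [listWord, reverse_cellList_getD t i.2]
  rfl

theorem op_smul_eq_rightAct (x : Hecke n q) (u : Words n) : u <• x = rightAct n q x u := rfl

theorem seminormalUnit_mem_wordSpace (hν : ν.card = n) (t : SYT ν) :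
    seminormalUnit n q t ∈ wordSpace n (diagramLetters ν) :=
  rightAct_mem_wordSpace _ (word_mem_wordSpace hν t)

theorem rightAct_mem_specht {u : Words n} (hu : u ∈ specht n q ν) (x : Hecke n q) :
    rightAct n q x u ∈ specht n q ν := (specht n q ν).smul_mem (MulOpposite.op x) hu

theorem specht_le_wordSpace (hν : ν.card = n) {u : Words n} (hu : u ∈ specht n q ν) :
    u ∈ wordSpace n (diagramLetters ν) := by
  induction hu using Submodule.span_induction with
  | mem u hu => obtain ⟨t, rfl⟩ := hu; exact seminormalUnit_mem_wordSpace hν t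
  | zero => exact zero_mem _
  | add u v _ _ hu hv => exact add_mem hu hv
  | smul x u _ hu => exact rightAct_mem_wordSpace x.unop hu

theorem rightAct_tableauIdempotent_seminormalUnit (h : IsGeneric n q) (hν : ν.card = n) (t : SYT ν) :
    rightAct n q (tableauIdempotent n q (t.cellList n)) (seminormalUnit n q t) = seminormalUnit n q t := by
  have ht := t.isTableau_cellList hν.ge
  have hl := t.length_cellList n
  rw [seminormalUnit, op_smul_eq_rightAct, youngIdempotent_eq h hν, ← rightAct_mul,
    mul_tableauIdempotent_self h ht hl.le (tableauIdempotent_mem_weightSpace h ht hl.le)]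

theorem sum_content (hν : ν.card = n) (t : SYT ν) :
    ∑ m ∈ Finset.Icc 1 n, qInt q (t.content m) = skewContent q ⊥ ν := by
  rw [skewContent]
  refine Finset.sum_bij' (fun m _ => t.cell m) (fun c _ => t.entry c) ?_ ?_ ?_ ?_ ?_
  · intro m hm
    exact SkewSYT.mem_sdiff_bot.2 (t.cell_mem (by have := Finset.mem_Icc.1 hm; omega))
  · intro c hc
    have := t.entry_mem (SkewSYT.mem_sdiff_bot.1 hc)
    exact Finset.mem_Icc.2 (by omega)
  · intro m hm
    exact t.entry_cell (by have := Finset.mem_Icc.1 hm; omega)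
  · intro c hc
    exact t.cell_entry (SkewSYT.mem_sdiff_bot.1 hc)
  · intro m _; rfl

/-- The sum of the Jucys-Murphy elements acts on a Specht module as the content of its shape. -/
theorem rightAct_jucysMurphySum (h : IsGeneric n q) (hν : ν.card = n) {u : Words n}
    (hu : u ∈ specht n q ν) : rightAct n q (jucysMurphySum n q n) u = skewContent q ⊥ ν • u := by
  induction hu using Submodule.span_induction with
  | mem u hu =>
    obtain ⟨t, rfl⟩ := hu
    have ht := t.isTableau_cellList hν.ge
    have hl := t.length_cellList n
    have hE := tableauIdempotent_mem_weightSpace h ht hl.le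
    have : tableauIdempotent n q (t.cellList n) * jucysMurphySum n q n =
        skewContent q ⊥ ν • tableauIdempotent n q (t.cellList n) := by
      rw [jucysMurphySum, Finset.mul_sum, ← sum_content hν t, Finset.sum_smul]
      refine Finset.sum_congr rfl fun m hm => ?_
      have := Finset.mem_Icc.1 hm
      exact t.mul_jucysMurphy_of_mem hE this.1 this.2
    change rightAct n q _ (seminormalUnit n q t) = _ • seminormalUnit n q t
    rw [← rightAct_tableauIdempotent_seminormalUnit h hν t, ← rightAct_mul, this, rightAct_smul]
  | zero => simp
  | add u v _ _ hu hv => rw [map_add, hu, hv, smul_add]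
  | smul x u _ hu =>
    change rightAct n q _ (rightAct n q x.unop u) = _ • rightAct n q x.unop u
    rw [← rightAct_mul, (jucysMurphySum_commute h.1 le_rfl (mem_parabolic x.unop)).eq, rightAct_mul, hu,
      map_smul]

/-- True also for the conventional value 0. Only this and centrality are used below, so neither
simplicity of the module nor existence of a projector has to be established. -/
theorem isotypicProjector_mem_isotypicComponent (R S : Type*) [Ring R] [AddCommGroup S]
    [Module Rᵐᵒᵖ S] : isotypicProjector R S ∈ isotypicComponent Rᵐᵒᵖ R S := by
  unfold isotypicProjector
  split_ifs with hex
  · rw [← SetLike.mem_coe, ← hex.choose_spec.range_eq]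
    exact ⟨1, one_mul _⟩
  · exact zero_mem _

theorem isotypicProjector_central (R S : Type*) [Ring R] [AddCommGroup S]
    [Module Rᵐᵒᵖ S] (x : R) : isotypicProjector R S * x = x * isotypicProjector R S := by
  unfold isotypicProjector
  split_ifs with hex
  · exact hex.choose_spec.central x
  · rw [zero_mul, mul_zero]

theorem shapeProjector_central (x : Hecke n q) :
    shapeProjector n q ν * x = x * shapeProjector n q ν := isotypicProjector_central _ _ x

/-- The sum of the Jucys-Murphy elements acts on the isotypic component as the content of its shape. -/
theorem shapeProjector_mul_jucysMurphySum (h : IsGeneric n q) (hν : ν.card = n) :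
    shapeProjector n q ν * jucysMurphySum n q n = skewContent q ⊥ ν • shapeProjector n q ν := by
  set z := jucysMurphySum n q n - skewContent q ⊥ ν • (1 : Hecke n q) with hz
  have hzc : ∀ x : Hecke n q, x * z = z * x := fun x => by
    rw [hz, mul_sub, sub_mul, (jucysMurphySum_commute h.1 le_rfl (mem_parabolic x)).eq, mul_smul_comm,
      smul_mul_assoc, mul_one, one_mul]
  let N : Submodule (Hecke n q)ᵐᵒᵖ (Hecke n q) :=
    { carrier := {x | x * z = 0}
      add_mem' := fun {x y} hx hy => by
        rw [Set.mem_ofPred_eq] at *; rw [add_mul, hx, hy, add_zero]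
      zero_mem' := zero_mul z
      smul_mem' := fun c x hx => by
        rw [Set.mem_ofPred_eq] at *
        rw [MulOpposite.smul_eq_mul_unop, mul_assoc, hzc, ← mul_assoc, hx, zero_mul] }
  -- The central element z annihilates S^ν, hence every right ideal isomorphic to it, hence their
  -- sum.
  have hle : isotypicComponent (Hecke n q)ᵐᵒᵖ (Hecke n q) (specht n q ν) ≤ N := by
    refine sSup_le ?_
    rintro I ⟨e⟩ x hx
    have h1 : MulOpposite.op z • e ⟨x, hx⟩ = 0 := by
      apply Subtype.ext
      change rightAct n q z (e ⟨x, hx⟩ : Words n) = 0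
      rw [hz, sub_eq_add_neg, rightAct_add, ← neg_smul, rightAct_smul, rightAct_one,
        rightAct_jucysMurphySum h hν (e ⟨x, hx⟩).2]
      module
    rw [← map_smul, LinearEquiv.map_eq_zero_iff] at h1
    exact congrArg Subtype.val h1
  have := hle (isotypicProjector_mem_isotypicComponent (Hecke n q) (specht n q ν))
  change shapeProjector n q ν * z = 0 at this
  rwa [hz, mul_sub, sub_eq_zero, mul_smul_comm, mul_one] at this

/-- The projector to the isotypic component maps the permutation module of shape `ν` to `S^ν`. -/
theorem rightAct_shapeProjector_mem_specht (h : IsGeneric n q) (hν : ν.card = n) {u : Words n}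
    (hu : u ∈ wordSpace n (diagramLetters ν)) : rightAct n q (shapeProjector n q ν) u ∈ specht n q ν := by
  let N : Submodule (Hecke n q)ᵐᵒᵖ (Hecke n q) :=
    { carrier := {x | rightAct n q x u ∈ specht n q ν}
      add_mem' := fun {x y} hx hy => by
        rw [Set.mem_ofPred_eq] at *; rw [rightAct_add]; exact add_mem hx hy
      zero_mem' := by rw [Set.mem_ofPred_eq, rightAct_zero]; exact zero_mem _
      smul_mem' := fun c x hx => by
        rw [Set.mem_ofPred_eq] at *
        rw [MulOpposite.smul_eq_mul_unop, rightAct_mul]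
        exact rightAct_mem_specht hx _ }
  have hle : isotypicComponent (Hecke n q)ᵐᵒᵖ (Hecke n q) (specht n q ν) ≤ N := by
    refine sSup_le ?_
    rintro I ⟨e⟩ x hx
    have key : ∀ (y : Words n) (hy : y ∈ specht n q ν),
        rightAct n q (e.symm ⟨y, hy⟩ : Hecke n q) u ∈ specht n q ν := fun y hy => by
      induction hy using Submodule.span_induction with
      | mem y hy' =>
        obtain ⟨t, rfl⟩ := hy'
        set w : specht n q ν := ⟨seminormalUnit n q t, Submodule.subset_span ⟨t, rfl⟩⟩ with hw
        change rightAct n q (e.symm w : Hecke n q) u ∈ specht n q ν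
        by_cases h0 : seminormalUnit n q t = 0
        · have : w = 0 := Subtype.ext h0
          rw [this, map_zero]
          change rightAct n q 0 u ∈ _
          rw [rightAct_zero]
          exact zero_mem _
        have hfix := rightAct_tableauIdempotent_seminormalUnit h hν t
        have hfix' : MulOpposite.op (tableauIdempotent n q (t.cellList n)) • w = w := Subtype.ext hfix
        have hmul : (e.symm w : Hecke n q) * tableauIdempotent n q (t.cellList n) = e.symm w := by
          have := congrArg e.symm hfix'
          rw [map_smul] at this
          exact congrArg Subtype.val this
        -- The preimage of a seminormal unit in the right ideal is fixed by its tableau idempotent,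
        -- and therefore so is its image on u; multiplicity one makes that image a multiple of the
        -- unit.
        obtain ⟨c, hc⟩ := exists_smul_of_weight (v := rightAct n q (e.symm w : Hecke n q) u) h
          (t.isTableau_cellList hν.ge) (t.length_cellList n)
          (by rw [rowLetters_cellList hν]; exact seminormalUnit_mem_wordSpace hν t)
          (by rw [rowLetters_cellList hν]; exact rightAct_mem_wordSpace _ hu) hfix
          (by rw [← rightAct_mul, hmul]) h0
        have hcs : c • seminormalUnit n q t = rightAct n q (c • 1) (seminormalUnit n q t) := by
          rw [rightAct_smul, rightAct_one]
        rw [hc, hcs]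
        exact rightAct_mem_specht w.2 _
      | zero =>
        have : (⟨0, zero_mem _⟩ : specht n q ν) = 0 := rfl
        rw [this, map_zero]
        change rightAct n q 0 u ∈ _
        rw [rightAct_zero]
        exact zero_mem _
      | add y z hy' hz' hy hz =>
        have : (⟨y + z, add_mem hy' hz'⟩ : specht n q ν) = ⟨y, hy'⟩ + ⟨z, hz'⟩ := rfl
        rw [this, map_add, Submodule.coe_add, rightAct_add]
        exact add_mem hy hz
      | smul x y hy' hy =>
        have : (⟨x • y, Submodule.smul_mem _ x hy'⟩ : specht n q ν) = x • ⟨y, hy'⟩ := rfl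
        rw [this, map_smul, Submodule.coe_smul, MulOpposite.smul_eq_mul_unop, rightAct_mul]
        exact rightAct_mem_specht hy _
    have := key (e ⟨x, hx⟩) (e ⟨x, hx⟩).2
    change rightAct n q x u ∈ specht n q ν
    simpa using this
  exact hle (isotypicProjector_mem_isotypicComponent (Hecke n q) (specht n q ν))

end Specht

/-! ### Semisimplicity forces the q-integers to be nonzero -/

section Semisimple
variable {n : ℕ} {q : ℂ}

/-- The element `B_1(q) B_2(q) ⋯ B_k(q)`, which is the sum of all `T_w` with `w` in `S_k`. -/
noncomputable def botChain (n : ℕ) (q : ℂ) : ℕ → Hecke n q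
  | 0 => 1
  | k + 1 => botChain n q k * botT n q (k + 1)

theorem botChain_mem_parabolic (k : ℕ) : botChain n q k ∈ parabolic n q k := by
  induction k with
  | zero => exact one_mem _
  | succ k ih => exact mul_mem (parabolic_mono (by omega) ih) (botT_mem_parabolic _)

theorem heckeT_mul_botChain {i k : ℕ} (hi : 1 ≤ i) (hik : i < k) (hk : k ≤ n) :
    heckeT n q i * botChain n q k = q • botChain n q k := by
  induction k with
  | zero => omega
  | succ k ih =>
    rcases Nat.lt_succ_iff_lt_or_eq.1 hik with h | rfl
    · rw [botChain, ← mul_assoc, ih h (by omega), smul_mul_assoc]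
    · obtain ⟨i, rfl⟩ := Nat.exists_eq_add_of_le' hi
      have hc := (commute_heckeT_of_mem_parabolic (m := i + 1) (by omega)
        (botChain_mem_parabolic (n := n) (q := q) i)).eq
      rw [botChain, botChain, mul_assoc, ← mul_assoc, ← hc, mul_assoc,
        heckeT_mul_botT_mul_botT (by omega), mul_smul_comm]

/-- Each generator acts on the symmetrizer from the left by q, so the symmetrizer spans a left ideal
of dimension at most one. -/
theorem exists_mul_botChain (x : Hecke n q) : ∃ c : ℂ, x * botChain n q n = c • botChain n q n := by
  have hx := mem_parabolic x
  induction hx using Algebra.adjoin_induction with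
  | mem x hx => obtain ⟨i, h1, h2, rfl⟩ := hx; exact ⟨q, heckeT_mul_botChain h1 h2 le_rfl⟩
  | algebraMap c => exact ⟨c, by rw [Algebra.smul_def]⟩
  | add x y _ _ hx hy =>
    obtain ⟨c, hc⟩ := hx
    obtain ⟨d, hd⟩ := hy
    exact ⟨c + d, by rw [add_mul, hc, hd, add_smul]⟩
  | mul x y _ _ hx hy =>
    obtain ⟨c, hc⟩ := hx
    obtain ⟨d, hd⟩ := hy
    exact ⟨d * c, by rw [mul_assoc, hd, mul_smul_comm, hc, smul_smul]⟩

theorem botT_mul_botChain {k : ℕ} (hk : k ≤ n) :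
    botT n q k * botChain n q n = (∑ i ∈ Finset.range k, q ^ i) • botChain n q n := by
  induction k with
  | zero => rw [botT_zero, Finset.range_zero, Finset.sum_empty, zero_mul, zero_smul]
  | succ k ih =>
    rw [botT_succ, add_mul, one_mul, mul_assoc, ih (by omega), mul_smul_comm]
    rcases Nat.eq_zero_or_pos k with rfl | h
    · simp
    · rw [heckeT_mul_botChain h hk le_rfl, smul_smul, geom_sum_succ, add_smul, one_smul, mul_comm,
        add_comm]

theorem botChain_mul_botChain {k : ℕ} (hk : k ≤ n) : botChain n q k * botChain n q n =
    (∏ m ∈ Finset.range k, ∑ i ∈ Finset.range (m + 1), q ^ i) • botChain n q n := by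
  induction k with
  | zero => simp [botChain]
  | succ k ih =>
    rw [botChain, mul_assoc, botT_mul_botChain hk, mul_smul_comm, ih (by omega), smul_smul,
      Finset.prod_range_succ, mul_comm]

theorem rightAct_mem_supported {S : Set (Fin n → ℕ)} {k : ℕ}
    (hS : ∀ a b : Fin n, (a : ℕ) < k → (b : ℕ) < k → ∀ w ∈ S, w ∘ Equiv.swap a b ∈ S) {x : Hecke n q}
    (hx : x ∈ parabolic n q k) (hk : k ≤ n) {u : Words n} (hu : u ∈ Finsupp.supported ℂ ℂ S) :
    rightAct n q x u ∈ Finsupp.supported ℂ ℂ S :=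
  rightAct_mem_of_heckeT (fun i h1 h2 u hu => by
    rw [rightAct_heckeT ⟨h1, by omega⟩]
    exact swapAct_mem_supported _ _ (hS _ _ (by change i - 1 < k; omega) h2) hu) hx hu

/-- In the factor B_{k+1} = 1 + T_k B_k, the second term moves the letter k away from its own
position, and what follows permutes earlier positions only. So only the term 1 can restore the word
0 1 ... n-1. -/
theorem rightAct_botChain_apply {k : ℕ} (hk : k ≤ n) :
    rightAct n q (botChain n q k) (Finsupp.single (fun i : Fin n => (i : ℕ)) 1)
      (fun i : Fin n => (i : ℕ)) = 1 := by
  induction k with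
  | zero => rw [botChain, rightAct_one, Finsupp.single_eq_same]
  | succ k ih =>
    rw [botChain, botT_succ, mul_add, mul_one, rightAct_add, Finsupp.add_apply, ih (by omega)]
    rcases Nat.eq_zero_or_pos k with rfl | h
    · rw [botT_zero, mul_zero, mul_zero, rightAct_zero]; simp
    rw [add_eq_left]
    let κ : Fin n := ⟨k, hk⟩
    let S : Set (Fin n → ℕ) := {w | w κ = k ∧ ∀ j : Fin n, (j : ℕ) < k → w j < k}
    let D : Set (Fin n → ℕ) := {w | w κ < k}
    have hne : ∀ a b : Fin n, (a : ℕ) < k → (b : ℕ) < k → Equiv.swap a b κ = κ := fun a b ha hb =>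
      Equiv.swap_apply_of_ne_of_ne (by rintro rfl; exact lt_irrefl _ ha)
        (by rintro rfl; exact lt_irrefl _ hb)
    have h1 : rightAct n q (botChain n q k) (Finsupp.single (fun i : Fin n => (i : ℕ)) 1) ∈
        Finsupp.supported ℂ ℂ S := by
      refine rightAct_mem_supported (S := S) (fun a b ha hb w hw => ⟨?_, fun j hj => ?_⟩)
        (botChain_mem_parabolic k) (by omega)
        (Finsupp.single_mem_supported ℂ 1 (show _ ∈ S from ⟨rfl, fun j hj => hj⟩))
      · rw [Function.comp_apply, hne a b ha hb]; exact hw.1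
      · refine hw.2 _ ?_
        rw [Equiv.swap_apply_def]
        split_ifs <;> assumption
    have h2 : ∀ u ∈ Finsupp.supported ℂ ℂ S, rightAct n q (heckeT n q k) u ∈
        Finsupp.supported ℂ ℂ D := by
      intro u hu
      rw [rightAct_heckeT ⟨h, hk⟩]
      rw [Finsupp.supported_eq_span_single] at hu
      induction hu using Submodule.span_induction with
      | mem x hx =>
        obtain ⟨w, hw, rfl⟩ := hx
        have hlt : w ⟨k - 1, by omega⟩ < k := hw.2 _ (by change k - 1 < k; omega)
        rw [swapAct_lt q _ _ w (hlt.trans_eq hw.1.symm)]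
        refine Finsupp.single_mem_supported ℂ 1 ?_
        change w (Equiv.swap _ κ κ) < k
        rw [Equiv.swap_apply_right]; exact hlt
      | zero => rw [map_zero]; exact zero_mem _
      | add u v _ _ hu hv => rw [map_add]; exact add_mem hu hv
      | smul c u _ hu => rw [map_smul]; exact Submodule.smul_mem _ _ hu
    have h3 := rightAct_mem_supported (q := q) (S := D) (fun a b ha hb w hw => by
      change w (Equiv.swap a b κ) < k
      rw [hne a b ha hb]; exact hw) (botT_mem_parabolic k) (by omega) (h2 _ h1)
    rw [rightAct_mul, rightAct_mul]
    exact Finsupp.notMem_support_iff.1 fun hmem =>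
      lt_irrefl k ((Finsupp.mem_supported ℂ _).1 h3 hmem)

theorem botChain_ne_zero : botChain n q n ≠ 0 := by
  intro h0
  have := rightAct_botChain_apply (n := n) (q := q) le_rfl
  rw [h0, rightAct_zero] at this
  exact zero_ne_one this

/-- If `H_n(q)` is semisimple then `[m]_q ≠ 0` for `1 ≤ m ≤ n`. -/
theorem isGeneric_of_isSemisimpleRing (hq : q ≠ 0) [IsSemisimpleRing (Hecke n q)] : IsGeneric n q := by
  refine ⟨hq, fun m h1 h2 h0 => ?_⟩
  -- The symmetrizer squares to [n]_q! times itself, so a vanishing [m]_q makes its left ideal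
  -- square to zero. In a semisimple ring that ideal is generated by an idempotent, which must then
  -- be 0, contradicting `botChain_ne_zero`.
  have hsq : ∀ x, botChain n q n * (x * botChain n q n) = 0 := fun x => by
    obtain ⟨c, hc⟩ := exists_mul_botChain x
    rw [hc, mul_smul_comm, botChain_mul_botChain le_rfl,
      Finset.prod_eq_zero (Finset.mem_range.2 (show m - 1 < n by omega))
        (by rw [Nat.sub_add_cancel h1]; exact h0), zero_smul, smul_zero]
  obtain ⟨e, he, hspan⟩ := IsSemisimpleRing.ideal_eq_span_idempotent (Ideal.span {botChain n q n})
  obtain ⟨y, hy⟩ := Ideal.mem_span_singleton'.1 (hspan ▸ Ideal.mem_span_singleton_self e)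
  have he0 : e = 0 := by
    rw [← he.eq, ← hy, mul_assoc, hsq, mul_zero]
  have := hspan ▸ Ideal.mem_span_singleton_self (botChain n q n)
  rw [he0, Ideal.mem_span_singleton'] at this
  obtain ⟨z, hz⟩ := this
  exact botChain_ne_zero (hz.symm.trans (mul_zero z))

end Semisimple

/-! ### Change of rank: inclusions of Hecke algebras and extension of words -/

section Inclusion
variable {k m n : ℕ} {q : ℂ}

theorem heckeIncl_heckeT (h : k ≤ n) {i : ℕ} (hi : 1 ≤ i ∧ i < k) :
    heckeIncl q h (heckeT k q i) = heckeT n q i := by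
  rw [heckeT, dif_pos hi, heckeT, dif_pos ⟨hi.1, hi.2.trans_le h⟩, heckeIncl, heckeLift_gen]

/-- Induction over the generators of the Hecke algebra. -/
theorem hecke_induction {p : Hecke n q → Prop} (hT : ∀ i, 1 ≤ i → i < n → p (heckeT n q i))
    (hc : ∀ c : ℂ, p (algebraMap ℂ _ c)) (hadd : ∀ x y, p x → p y → p (x + y))
    (hmul : ∀ x y, p x → p y → p (x * y)) (x : Hecke n q) : p x := by
  have hx := mem_parabolic x
  induction hx using Algebra.adjoin_induction with
  | mem x hx => obtain ⟨i, h1, h2, rfl⟩ := hx; exact hT i h1 h2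
  | algebraMap c => exact hc c
  | add x y _ _ hx hy => exact hadd x y hx hy
  | mul x y _ _ hx hy => exact hmul x y hx hy

theorem heckeIncl_heckeIncl (h : k ≤ m) (h' : m ≤ n) (x : Hecke k q) :
    heckeIncl q h' (heckeIncl q h x) = heckeIncl q (h.trans h') x := by
  induction x using hecke_induction with
  | hT i h1 h2 =>
    rw [heckeIncl_heckeT h ⟨h1, h2⟩, heckeIncl_heckeT h' ⟨h1, by omega⟩, heckeIncl_heckeT _ ⟨h1, h2⟩]
  | hc c => simp only [AlgHom.commutes]
  | hadd x y hx hy => simp only [map_add, hx, hy]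
  | hmul x y hx hy => simp only [map_mul, hx, hy]

theorem heckeIncl_self (x : Hecke n q) : heckeIncl q le_rfl x = x := by
  induction x using hecke_induction with
  | hT i h1 h2 => exact heckeIncl_heckeT le_rfl ⟨h1, h2⟩
  | hc c => simp only [AlgHom.commutes]
  | hadd x y hx hy => rw [map_add, hx, hy]
  | hmul x y hx hy => rw [map_mul, hx, hy]

theorem heckeUp_self (x : Hecke n q) : heckeUp n x = x := by
  rw [heckeUp, dif_pos le_rfl, heckeIncl_self]

theorem heckeIncl_heckeUp (h : k ≤ m) (h' : m ≤ n) (x : Hecke k q) :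
    heckeIncl q h' (heckeUp m x) = heckeUp n x := by
  rw [heckeUp, dif_pos h, heckeUp, dif_pos (h.trans h'), heckeIncl_heckeIncl]

theorem heckeIncl_botT (h : m ≤ n) (hk : k ≤ m) : heckeIncl q h (botT m q k) = botT n q k := by
  induction k with
  | zero => rw [botT_zero, botT_zero, map_zero]
  | succ k ih =>
    rw [botT_succ, botT_succ, map_add, map_one, map_mul, ih (by omega)]
    rcases Nat.eq_zero_or_pos k with rfl | h0
    · rw [botT_zero, mul_zero, mul_zero]
    · rw [heckeIncl_heckeT h ⟨h0, hk⟩]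

theorem heckeIncl_topT (h : m ≤ n) (hk : k ≤ m) : heckeIncl q h (topT m q k) = topT n q k := by
  induction k with
  | zero => rw [topT_zero, topT_zero, map_zero]
  | succ k ih =>
    rw [topT_succ, topT_succ, map_add, map_one, map_mul, ih (by omega)]
    rcases Nat.eq_zero_or_pos k with rfl | h0
    · rw [topT_zero, zero_mul, zero_mul]
    · rw [heckeIncl_heckeT h ⟨h0, hk⟩]

theorem heckeIncl_randomToRandom (h : k ≤ n) :
    heckeIncl q h (randomToRandom k q) = topT n q k * botT n q k := by
  rw [randomToRandom, map_mul]
  exact congrArg₂ _ (heckeIncl_topT h le_rfl) (heckeIncl_botT h le_rfl)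

theorem heckeIncl_jucysMurphy (hq : q ≠ 0) (h : m ≤ n) (hk : k ≤ m) :
    heckeIncl q h (jucysMurphy m q k) = jucysMurphy n q k := by
  induction k with
  | zero => rw [jucysMurphy_zero, jucysMurphy_zero, map_zero]
  | succ k ih =>
    rcases Nat.eq_zero_or_pos k with rfl | h0
    · rw [jucysMurphy_one, jucysMurphy_one, map_zero]
    · rw [jucysMurphy_succ hq h0, jucysMurphy_succ hq h0, map_add, map_smul, map_smul, map_mul, map_mul,
        ih (by omega), heckeIncl_heckeT h ⟨h0, hk⟩]

theorem heckeIncl_jucysMurphySum (hq : q ≠ 0) (h : k ≤ n) :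
    heckeIncl q h (jucysMurphySum k q k) = jucysMurphySum n q k := by
  rw [jucysMurphySum, jucysMurphySum, map_sum]
  exact Finset.sum_congr rfl fun m hm => heckeIncl_jucysMurphy hq h (Finset.mem_Icc.1 hm).2

/-- The word `w` of length `j`, continued by the letters `f (j + 1), …, f n`. -/
def extendWord (n : ℕ) (f : ℕ → ℕ) {j : ℕ} (w : Fin j → ℕ) (i : Fin n) : ℕ :=
  if h : i.1 < j then w ⟨i.1, h⟩ else f (i.1 + 1)

/-- The linear extension of `extendWord`. -/
noncomputable def extend (j n : ℕ) (f : ℕ → ℕ) : Words j →ₗ[ℂ] Words n :=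
  Finsupp.lmapDomain ℂ ℂ (extendWord n f)

theorem extend_single (j n : ℕ) (f : ℕ → ℕ) (w : Fin j → ℕ) :
    extend j n f (Finsupp.single w 1) = Finsupp.single (extendWord n f w) 1 := by
  rw [extend, Finsupp.lmapDomain_apply, Finsupp.mapDomain_single]

theorem extend_self (f : ℕ → ℕ) (u : Words n) : extend n n f u = u := by
  have : extendWord n f (j := n) = id := by
    funext w i
    rw [extendWord, dif_pos i.2]; rfl
  rw [extend, this, Finsupp.lmapDomain_apply, Finsupp.mapDomain_id]

theorem extend_extend (h : k ≤ m) (f : ℕ → ℕ) (u : Words k) :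
    extend m n f (extend k m f u) = extend k n f u := by
  rw [extend, extend, extend, Finsupp.lmapDomain_apply, Finsupp.lmapDomain_apply,
    Finsupp.lmapDomain_apply, ← Finsupp.mapDomain_comp]
  congr 1
  funext w i
  simp only [Function.comp_apply, extendWord]
  split_ifs <;> first | rfl | omega

theorem extendWord_comp_swap (h : k ≤ n) (f : ℕ → ℕ) (w : Fin k → ℕ) (a b : Fin k) :
    extendWord n f (w ∘ Equiv.swap a b) =
      extendWord n f w ∘ Equiv.swap (a.castLE h) (b.castLE h) := by
  funext i
  simp only [extendWord, Function.comp_apply]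
  by_cases hi : i.1 < k
  · obtain ⟨c, rfl⟩ : ∃ c : Fin k, i = c.castLE h := ⟨⟨i.1, hi⟩, rfl⟩
    have : Equiv.swap (a.castLE h) (b.castLE h) (c.castLE h) = (Equiv.swap a b c).castLE h :=
      ((Fin.castLE_injective h).swap_apply a b c)
    rw [this]
    simp
  · have hne : ∀ c : Fin k, i ≠ c.castLE h := by
      rintro c rfl
      exact hi c.2
    rw [Equiv.swap_apply_of_ne_of_ne (hne a) (hne b)]
    simp [hi]

/-- Appended letters do not affect an exchange among the first k positions. This gives the
equivariance of word extension under the smaller Hecke algebra. -/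
theorem extend_swapAct (h : k ≤ n) (f : ℕ → ℕ) (a b : Fin k) (u : Words k) :
    extend k n f (swapAct q a b u) = swapAct q (a.castLE h) (b.castLE h) (extend k n f u) := by
  have : extend k n f ∘ₗ swapAct q a b = swapAct q (a.castLE h) (b.castLE h) ∘ₗ extend k n f := by
    refine Finsupp.lhom_ext' fun w => LinearMap.ext_ring ?_
    simp only [LinearMap.coe_comp, Function.comp_apply, Finsupp.lsingle_apply]
    have hw : ∀ c : Fin k, extendWord n f w (c.castLE h) = w c := fun c => by simp [extendWord]
    rw [extend_single]
    rcases lt_trichotomy (w a) (w b) with hab | hab | hab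
    · rw [swapAct_lt q a b w hab, swapAct_lt q _ _ _ (by rwa [hw, hw]), extend_single,
        extendWord_comp_swap h]
    · rw [swapAct_eq q a b w hab, swapAct_eq q _ _ _ (by rwa [hw, hw]), map_smul, extend_single]
    · rw [swapAct_gt q a b w hab, swapAct_gt q _ _ _ (by rwa [hw, hw]), map_add, map_smul, map_smul,
        extend_single, extend_single, extendWord_comp_swap h]
  exact LinearMap.congr_fun this u

theorem extend_rightAct (h : k ≤ n) (f : ℕ → ℕ) (x : Hecke k q) (u : Words k) :
    extend k n f (rightAct k q x u) = rightAct n q (heckeIncl q h x) (extend k n f u) := by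
  induction x using hecke_induction generalizing u with
  | hT i h1 h2 =>
    rw [heckeIncl_heckeT h ⟨h1, h2⟩, rightAct_heckeT ⟨h1, h2⟩, rightAct_heckeT ⟨h1, by omega⟩,
      extend_swapAct h]
    rfl
  | hc c =>
    rw [AlgHom.commutes, Algebra.algebraMap_eq_smul_one, Algebra.algebraMap_eq_smul_one, rightAct_smul,
      rightAct_smul, rightAct_one, rightAct_one, map_smul]
  | hadd x y hx hy => rw [map_add, rightAct_add, rightAct_add, map_add, hx, hy]
  | hmul x y hx hy => rw [map_mul, rightAct_mul, rightAct_mul, hy, hx]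

theorem extend_mem_wordSpace (f : ℕ → ℕ) {M : Multiset ℕ} {u : Words k} (hu : u ∈ wordSpace k M) :
    extend k (k + 1) f u ∈ wordSpace (k + 1) (f (k + 1) ::ₘ M) := by
  rw [wordSpace, Finsupp.supported_eq_span_single] at hu
  induction hu using Submodule.span_induction with
  | mem x hx =>
    obtain ⟨w, hw, rfl⟩ := hx
    change extend k (k + 1) f (Finsupp.single w 1) ∈ _
    rw [extend_single]
    refine Finsupp.single_mem_supported ℂ 1 ?_
    rw [Set.mem_ofPred_eq] at hw ⊢
    rw [Fin.univ_val_map] at hw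
    have : (fun i : Fin k => extendWord (k + 1) f w i.castSucc) = w := by
      funext i; simp [extendWord]
    rw [Fin.univ_val_map, List.ofFn_succ_last, this, ← Multiset.coe_add, hw, add_comm,
      ← Multiset.singleton_add]
    simp [extendWord]
  | zero => rw [map_zero]; exact zero_mem _
  | add u v _ _ hu hv => rw [map_add]; exact add_mem hu hv
  | smul c u _ hu => rw [map_smul]; exact Submodule.smul_mem _ _ hu

end Inclusion

/-! ### Adding one box -/

section Lifting
variable {k n : ℕ} {q : ℂ} {ν ν' : YoungDiagram}

theorem skewContent_eq_sub (h : ν' ≤ ν) :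
    skewContent q ν' ν = skewContent q ⊥ ν - skewContent q ⊥ ν' := by
  simp only [skewContent, YoungDiagram.cells_bot, Finset.sdiff_empty]
  exact eq_sub_of_add_eq (Finset.sum_sdiff h)

theorem skewContent_insert {μ : YoungDiagram} (h : μ ≤ ν') (h' : ν' ≤ ν) :
    skewContent q μ ν = skewContent q μ ν' + skewContent q ν' ν := by
  rw [skewContent_eq_sub h', skewContent_eq_sub h, skewContent_eq_sub (h.trans h')]
  ring

/-- The lifting of eigenvectors of the random-to-random operator along a cover. -/
theorem lift_eigenvector (h : IsGeneric (k + 1) q) (hν : ν.card = k + 1) {c : ℕ × ℕ}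
    (hc : c ∉ ν'.cells) (hins : ν.cells = insert c ν'.cells) {f : ℕ → ℕ} (hf : f (k + 1) = c.1 + 1)
    {u : Words k} (hu : u ∈ specht k q ν') {E : ℂ} (hE : rightAct k q (randomToRandom k q) u = E • u) :
    rightAct (k + 1) q (bottomToRandom (k + 1) q * shapeProjector (k + 1) q ν) (extend k (k + 1) f u) ∈
        specht (k + 1) q ν ∧
      rightAct (k + 1) q (randomToRandom (k + 1) q)
        (rightAct (k + 1) q (bottomToRandom (k + 1) q * shapeProjector (k + 1) q ν)
          (extend k (k + 1) f u)) =
      (q * E + qInt q ((k + 1 : ℕ) : ℤ) + q ^ (k + 1) * skewContent q ν' ν) •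
        rightAct (k + 1) q (bottomToRandom (k + 1) q * shapeProjector (k + 1) q ν)
          (extend k (k + 1) f u) := by
  have hν' : ν'.card = k := by
    have : ν.cells.card = k + 1 := hν
    rw [hins, Finset.card_insert_of_notMem hc] at this
    exact Nat.succ_injective this
  have hle : ν' ≤ ν := by
    change ν'.cells ⊆ ν.cells
    rw [hins]; exact Finset.subset_insert _ _
  have hv : extend k (k + 1) f u ∈ wordSpace (k + 1) (diagramLetters ν) := by
    have := extend_mem_wordSpace f (specht_le_wordSpace hν' hu)
    rwa [hf, diagramLetters, ← Multiset.map_cons (fun c : ℕ × ℕ => c.1 + 1),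
      ← Finset.insert_val_of_notMem hc, ← hins] at this
  have hR : rightAct (k + 1) q (topT (k + 1) q k * botT (k + 1) q k) (extend k (k + 1) f u) =
      E • extend k (k + 1) f u := by
    rw [← heckeIncl_randomToRandom (Nat.le_succ k), ← extend_rightAct, hE, map_smul]
  have hZ : rightAct (k + 1) q (jucysMurphySum (k + 1) q k) (extend k (k + 1) f u) =
      skewContent q ⊥ ν' • extend k (k + 1) f u := by
    rw [← heckeIncl_jucysMurphySum h.1 (Nat.le_succ k), ← extend_rightAct,
      rightAct_jucysMurphySum (h.mono (Nat.le_succ k)) hν' hu, map_smul]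
  refine ⟨by rw [rightAct_mul];
             exact rightAct_shapeProjector_mem_specht h hν (rightAct_mem_wordSpace _ hv), ?_⟩
  -- J_{k+1} has no eigenvalue on the extended vector by itself; the two central sums do have one,
  -- the larger through the projector and the smaller through u.
  have hJ : jucysMurphy (k + 1) q (k + 1) = jucysMurphySum (k + 1) q (k + 1) -
      jucysMurphySum (k + 1) q k := by
    rw [jucysMurphySum, jucysMurphySum, Finset.sum_Icc_succ_top (by omega), add_sub_cancel_left]
  have hB := botT_mul_randomToRandom h.1 (Nat.lt_succ_self k)
  change bottomToRandom (k + 1) q * randomToRandom (k + 1) q = _ * bottomToRandom (k + 1) q at hB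
  have hcomm : jucysMurphySum (k + 1) q (k + 1) *
      (bottomToRandom (k + 1) q * shapeProjector (k + 1) q ν) =
      skewContent q ⊥ ν • (bottomToRandom (k + 1) q * shapeProjector (k + 1) q ν) := by
    rw [← (jucysMurphySum_commute h.1 le_rfl (mem_parabolic _)).eq, mul_assoc,
      shapeProjector_mul_jucysMurphySum h hν, mul_smul_comm]
  -- The operators of size k stand on the left, so they act first, directly on the extended vector,
  -- where their values are known.
  have key : bottomToRandom (k + 1) q * shapeProjector (k + 1) q ν * randomToRandom (k + 1) q =
      q • (topT (k + 1) q k * botT (k + 1) q k * (bottomToRandom (k + 1) q * shapeProjector (k + 1) q ν)) +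
      (qInt q ((k + 1 : ℕ) : ℤ) + q ^ (k + 1) * skewContent q ⊥ ν) •
        (bottomToRandom (k + 1) q * shapeProjector (k + 1) q ν) -
      q ^ (k + 1) • (jucysMurphySum (k + 1) q k *
        (bottomToRandom (k + 1) q * shapeProjector (k + 1) q ν)) := by
    rw [mul_assoc, shapeProjector_central, ← mul_assoc, hB, hJ, mul_assoc, add_mul, add_mul,
      smul_mul_assoc, smul_mul_assoc, one_mul, smul_mul_assoc, sub_mul, hcomm, qInt_natCast]
    module
  rw [← rightAct_mul, key]
  generalize bottomToRandom (k + 1) q * shapeProjector (k + 1) q ν = y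
  rw [sub_eq_add_neg, ← neg_smul, rightAct_add, rightAct_add, rightAct_smul, rightAct_smul, rightAct_smul,
    rightAct_mul (topT _ _ _ * _), rightAct_mul (jucysMurphySum _ _ _), hR, hZ, map_smul, map_smul, skewContent_eq_sub hle]
  module

end Lifting

/-! ### Intermediate shapes of a skew tableau -/

namespace SkewSYT
variable {μ ν : YoungDiagram}

theorem cell_mem_sdiff (t : SkewSYT μ ν) {k : ℕ} (hk : k ∈ Finset.Ioc μ.card ν.card) :
    t.cell k ∈ ν.cells \ μ.cells := by
  rw [cell, dif_pos hk]
  exact (t.fill.symm ⟨k, hk⟩).2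

theorem entry_eq_iff (t : SkewSYT μ ν) {c : ℕ × ℕ} (hc : c ∈ ν.cells \ μ.cells) {k : ℕ}
    (hk : k ∈ Finset.Ioc μ.card ν.card) : t.entry c = k ↔ c = t.cell k := by
  rw [entry, dif_pos hc, cell, dif_pos hk]
  constructor
  · rintro rfl
    simp
  · intro h
    have : (⟨c, hc⟩ : {c : ℕ × ℕ // c ∈ ν.cells \ μ.cells}) = t.fill.symm ⟨k, hk⟩ := Subtype.ext h
    rw [this, Equiv.apply_symm_apply]

theorem entry_mem_Ioc (t : SkewSYT μ ν) {c : ℕ × ℕ} (hc : c ∈ ν.cells \ μ.cells) :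
    t.entry c ∈ Finset.Ioc μ.card ν.card := by
  rw [entry, dif_pos hc]
  exact (t.fill ⟨c, hc⟩).2

theorem mem_shape (t : SkewSYT μ ν) {k : ℕ} {c : ℕ × ℕ} : c ∈ (t.shape k).cells ↔
    c ∈ μ.cells ∨ c ∈ ν.cells \ μ.cells ∧ t.entry c ≤ k := by
  rw [shape, Finset.mem_union, Finset.mem_filter]

theorem le_shape (t : SkewSYT μ ν) (k : ℕ) : μ ≤ t.shape k :=
  fun _ hc => t.mem_shape.2 (Or.inl hc)

theorem shape_card_left (t : SkewSYT μ ν) : t.shape μ.card = μ := by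
  refine YoungDiagram.ext (Finset.ext fun c => ?_)
  rw [mem_shape]
  refine ⟨fun h => h.resolve_right fun h => ?_, Or.inl⟩
  exact absurd h.2 (Finset.mem_Ioc.1 (t.entry_mem_Ioc h.1)).1.not_ge

theorem shape_card_right (hμν : μ ≤ ν) (t : SkewSYT μ ν) : t.shape ν.card = ν := by
  refine YoungDiagram.ext (Finset.ext fun c => ?_)
  rw [mem_shape]
  constructor
  · rintro (h | h)
    · exact hμν h
    · exact (Finset.mem_sdiff.1 h.1).1
  · intro hc
    by_cases h : c ∈ μ.cells
    · exact Or.inl h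
    · have := Finset.mem_sdiff.2 ⟨hc, h⟩
      exact Or.inr ⟨this, (Finset.mem_Ioc.1 (t.entry_mem_Ioc this)).2⟩

theorem cell_notMem_shape (t : SkewSYT μ ν) {k : ℕ} (h1 : μ.card ≤ k) (h2 : k < ν.card) :
    t.cell (k + 1) ∉ (t.shape k).cells := by
  have hk : k + 1 ∈ Finset.Ioc μ.card ν.card := Finset.mem_Ioc.2 ⟨by omega, h2⟩
  have hm := t.cell_mem_sdiff hk
  rw [mem_shape, (t.entry_eq_iff hm hk).2 rfl]
  rintro (h | h)
  · exact (Finset.mem_sdiff.1 hm).2 h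
  · omega

theorem shape_succ (t : SkewSYT μ ν) {k : ℕ} (h1 : μ.card ≤ k) (h2 : k < ν.card) :
    (t.shape (k + 1)).cells = insert (t.cell (k + 1)) (t.shape k).cells := by
  have hk : k + 1 ∈ Finset.Ioc μ.card ν.card := Finset.mem_Ioc.2 ⟨by omega, h2⟩
  ext c
  rw [Finset.mem_insert, mem_shape, mem_shape]
  constructor
  · rintro (h | ⟨h, h'⟩)
    · exact Or.inr (Or.inl h)
    · rcases Nat.le_succ_iff.1 h' with h' | h'
      · exact Or.inr (Or.inr ⟨h, h'⟩)
      · exact Or.inl ((t.entry_eq_iff h hk).1 h')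
  · rintro (rfl | h | ⟨h, h'⟩)
    · have hm := t.cell_mem_sdiff hk
      exact Or.inr ⟨hm, ((t.entry_eq_iff hm hk).2 rfl).le⟩
    · exact Or.inl h
    · exact Or.inr ⟨h, h'.trans (Nat.le_succ k)⟩

theorem card_shape (t : SkewSYT μ ν) {k : ℕ} (h1 : μ.card ≤ k) (h2 : k ≤ ν.card) :
    (t.shape k).card = k := by
  induction k, h1 using Nat.le_induction with
  | base => rw [shape_card_left]
  | succ k h1 ih =>
    rw [YoungDiagram.card, t.shape_succ h1 h2, Finset.card_insert_of_notMem (t.cell_notMem_shape h1 h2)]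
    exact congrArg Nat.succ (ih (by omega))

end SkewSYT

/-! ### Adding boxes along a skew tableau -/

section Kernel
variable {μ ν : YoungDiagram} {q : ℂ}

/-- The partial products of `skewProjector`. -/
noncomputable def shapeProduct (q : ℂ) (t : SkewSYT μ ν) (k : ℕ) : Hecke k q :=
  ((List.Ico (μ.card + 1) (k + 1)).map fun m => heckeUp k (shapeProjector m q (t.shape m))).prod

theorem heckeIncl_list_prod {k n : ℕ} (h : k ≤ n) (j : ℕ) (F : ∀ m, Hecke m q) :
    heckeIncl q h ((List.Ico (j + 1) (k + 1)).map fun m => heckeUp k (F m)).prod =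
      ((List.Ico (j + 1) (k + 1)).map fun m => heckeUp n (F m)).prod := by
  rw [map_list_prod, List.map_map]
  congr 1
  refine List.map_congr_left fun m hm => ?_
  have := List.Ico.mem.1 hm
  exact heckeIncl_heckeUp (by omega) h (F m)

theorem list_prod_heckeUp_succ {j k : ℕ} (h : j ≤ k) (F : ∀ m, Hecke m q) :
    ((List.Ico (j + 1) (k + 1 + 1)).map fun m => heckeUp (k + 1) (F m)).prod =
      heckeIncl q (Nat.le_succ k) ((List.Ico (j + 1) (k + 1)).map fun m => heckeUp k (F m)).prod *
        F (k + 1) := by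
  rw [List.Ico.succ_top (by omega), List.map_append, List.prod_append, heckeIncl_list_prod]
  simp [heckeUp_self]

/-- The lifting of the kernel of the random-to-random operator along a standard tableau. -/
theorem lift_kernel {n : ℕ} (h : IsGeneric n q) (hν : ν.card = n) (t : SkewSYT μ ν) {u : Words μ.card}
    (hu : u ∈ specht μ.card q μ) (hu0 : rightAct μ.card q (randomToRandom μ.card q) u = 0) {k : ℕ}
    (h1 : μ.card ≤ k) (h2 : k ≤ n) :
    rightAct k q (shapeProduct q t k * bottomProduct μ.card k q) (extend μ.card k t.row u) ∈
        specht k q (t.shape k) ∧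
      rightAct k q (randomToRandom k q)
        (rightAct k q (shapeProduct q t k * bottomProduct μ.card k q) (extend μ.card k t.row u)) =
      (q ^ k * skewContent q μ (t.shape k) +
          ∑ m ∈ Finset.Icc (μ.card + 1) k, q ^ (k - m) * qInt q m) •
        rightAct k q (shapeProduct q t k * bottomProduct μ.card k q) (extend μ.card k t.row u) := by
  induction k, h1 using Nat.le_induction with
  | base =>
    have : shapeProduct q t μ.card * bottomProduct μ.card μ.card q = 1 := by
      simp [shapeProduct, bottomProduct]
    rw [this, rightAct_one, extend_self, t.shape_card_left]
    refine ⟨hu, ?_⟩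
    rw [hu0]
    simp [skewContent]
  | succ k h1 ih =>
    obtain ⟨hmem, heig⟩ := ih (by omega)
    have hcell := t.shape_succ h1 (by omega)
    have hnot := t.cell_notMem_shape h1 (by omega)
    have hstep := lift_eigenvector (h.mono h2) (t.card_shape (by omega) (by omega)) hnot hcell
      (f := t.row) rfl hmem heig
    -- Lifting applies B and then the projector at every size, whereas the statement has all
    -- projectors first; centrality of the newest projector in its own algebra moves it in front of
    -- the B's.
    have hcomp : rightAct (k + 1) q
        (bottomToRandom (k + 1) q * shapeProjector (k + 1) q (t.shape (k + 1)))
        (extend k (k + 1) t.row (rightAct k q (shapeProduct q t k * bottomProduct μ.card k q)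
          (extend μ.card k t.row u))) =
        rightAct (k + 1) q (shapeProduct q t (k + 1) * bottomProduct μ.card (k + 1) q)
          (extend μ.card (k + 1) t.row u) := by
      rw [extend_rightAct (Nat.le_succ k), extend_extend h1, ← rightAct_mul]
      congr 1
      rw [shapeProduct, bottomProduct, shapeProduct, bottomProduct, list_prod_heckeUp_succ h1,
        list_prod_heckeUp_succ h1 fun m => bottomToRandom m q, ← shapeProjector_central, map_mul]
      simp only [mul_assoc]
      rw [← mul_assoc _ (shapeProjector _ _ _), ← shapeProjector_central, mul_assoc]
    rw [hcomp] at hstep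
    refine ⟨hstep.1, hstep.2.trans ?_⟩
    congr 1
    have hle : t.shape k ≤ t.shape (k + 1) := by
      change (t.shape k).cells ⊆ (t.shape (k + 1)).cells
      rw [hcell]; exact Finset.subset_insert _ _
    rw [skewContent_insert (t.le_shape k) hle, Finset.sum_Icc_succ_top (by omega), Nat.sub_self,
      pow_zero, one_mul, mul_add, Finset.mul_sum, pow_succ]
    -- Each lift multiplies the old eigenvalue by q, which raises every power of q in it by one.
    have : ∀ m ∈ Finset.Icc (μ.card + 1) k, q ^ (k + 1 - m) * qInt q m =
        q * (q ^ (k - m) * qInt q m) := fun m hm => by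
      rw [Nat.succ_sub (Finset.mem_Icc.1 hm).2, pow_succ]; ring
    rw [Finset.sum_congr rfl this]
    ring

end Kernel

end QShuffle

/-! ### The two families of eigenvectors -/

theorem mainTheorem8 (n : ℕ) (q : ℂ) (hq : q ≠ 0) [IsSemisimpleRing (Hecke n q)] :
    (∀ (ν' ν : YoungDiagram) (hcov : IsCover ν' ν), ν.card = n →
      ∀ (E : ℂ) (u' : Words (n - 1)), u' ∈ specht (n - 1) q ν' →
        Module.End.HasEigenvector (rightAct (n - 1) q (randomToRandom (n - 1) q)) E u' →
        ∀ u : Words n,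
          u = Phi (n - 1) n (boxTableau hcov) u' <• bottomToRandom n q <• shapeProjector n q ν →
          u ∈ specht n q ν ∧
            (u = 0 ∨ Module.End.HasEigenvector (rightAct n q (randomToRandom n q))
              (q * E + qInt q n + q ^ n * skewContent q ν' ν) u)) ∧
    (∀ (j : ℕ) (μ ν : YoungDiagram), μ ≤ ν → μ.card = j → ν.card = n →
      ∀ (t : SkewSYT μ ν) (u : Words j), u ∈ specht j q μ → u <• randomToRandom j q = 0 →
        ∀ v : Words n, v = Phi j n t u <• skewProjector n q t <• bottomProduct j n q →
          v ∈ specht n q ν ∧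
            (v = 0 ∨ Module.End.HasEigenvector (rightAct n q (randomToRandom n q))
              (q ^ n * skewContent q μ ν + ∑ k ∈ Finset.Icc (j + 1) n, q ^ (n - k) * qInt q k) v)) := by
  have h := isGeneric_of_isSemisimpleRing (n := n) hq
  have of_eq : ∀ {u : Words n} {c : ℂ}, rightAct n q (randomToRandom n q) u = c • u →
      (u = 0 ∨ Module.End.HasEigenvector (rightAct n q (randomToRandom n q)) c u) := fun hc =>
    or_iff_not_imp_left.2 fun h0 => ⟨Module.End.mem_eigenspace_iff.2 hc, h0⟩
  constructor
  · intro ν' ν hcov hν E u' hu' hE u hu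
    obtain ⟨k, rfl⟩ : ∃ k, n = k + 1 := ⟨ν'.card, hν.symm.trans hcov.2⟩
    have hν' : ν'.card = k := Nat.succ_injective (hcov.2.symm.trans hν)
    let t := boxTableau hcov
    have hlt : ν'.card < ν.card := by omega
    have hc := t.cell_notMem_shape le_rfl hlt
    have hins := t.shape_succ le_rfl hlt
    -- For a single box, the shapes before and after its only entry are the two diagrams, so the box
    -- is the cell that distinguishes them.
    rw [← hcov.2, t.shape_card_right hcov.1, t.shape_card_left] at hins
    rw [t.shape_card_left, ← hcov.2] at hc
    have hstep := lift_eigenvector h hν hc hins (f := t.row)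
      (by rw [← hν]; rfl) hu' (Module.End.mem_eigenspace_iff.1 hE.1)
    have hueq : u = rightAct (k + 1) q (bottomToRandom (k + 1) q * shapeProjector (k + 1) q ν)
        (extend k (k + 1) t.row u') := by rw [rightAct_mul]; exact hu
    rw [← hueq] at hstep
    exact ⟨hstep.1, of_eq hstep.2⟩
  · rintro j μ ν hμν rfl hν t u hu hu0 v hv
    have hcard : μ.card ≤ n := hν ▸ Finset.card_le_card hμν
    have hstep := lift_kernel h hν t hu hu0 hcard le_rfl
    have hveq : v = rightAct n q (shapeProduct q t n * bottomProduct μ.card n q)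
        (extend μ.card n t.row u) := by rw [rightAct_mul]; exact hv
    have hshape : t.shape n = ν := hν ▸ t.shape_card_right hμν
    rw [← hveq, hshape] at hstep
    exact ⟨hstep.1, of_eq hstep.2⟩
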